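/- There is a randomized algorithm (one real-RAM program, working for all inputs) with the following property. Its input consists of a finite non-empty set $P\subset\mathbb{R}^d$ of $n$ points ($d\ge 1$), an integer $k\ge 1$ and a real number $0<\epsilon<1$. In time $2^{\tilde O(k/\epsilon^{O(1)})}\,nd$ it outputs a list $L$ of at most $2^{\tilde O(k/\epsilon^{O(1)})}$ sets of centers $C=\{c_1,\dots,c_k\}\subset\mathbb{R}^d$, each of size exactly $k$, such that for every partition $\mathbb{P}^*=\{P_1^*,\dots,P_k^*\}$ of $P$ into $k$ (possibly empty) parts, with probability at least $1/2$ over the random choices of the algorithm, the list $L$ contains a set $C$ with \[ \mathrm{cost}_C(\mathbb{P}^*)\le(1+\epsilon)\max_{i\in[k]}\mathrm{cost}(P_i^*). \] Here, for a finite set $O\subset\mathbb{R}^d$ and $c\in\mathbb{R}^d$, $\mathrm{cost}_c(O)=\sum_{x\in O}\|x-c\|_2$ and $\mathrm{cost}(O)=\min_{c\in\mathbb{R}^d}\mathrm{cost}_c(O)$. The minimum-load cost of the partition with respect to $C$ is $\mathrm{cost}_C(\mathbb{P}^*)=\min_{\pi}\max_{j\in[k]}\mathrm{cost}_{c_j}(P^*_{\pi(j)})$,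 where $\pi$ ranges over the permutations of $[k]$. The expression $2^{\tilde O(k/\epsilon^{O(1)})}$ stands for $2^{A X\log^b(2+X)}$ with $X=k/\epsilon^{c}$ and absolute constants $A,b,c$. The time and list-size bounds hold for every outcome of the random choices. Time is counted on a real RAM: the exact real operations $+,-,\cdot,/,\sqrt{\ }$, comparisons, addition and subtraction of integers, indirect memory access and a flip of a fair coin each take one step. -/

import Mathlib

/-! ## Minimum-load clustering costs in Euclidean space -/

namespace MinLoad

/-- `ℝ^d` with the Euclidean distance. -/
abbrev Pt (d : ℕ) : Type := EuclideanSpace ℝ (Fin d)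

/-- `cost_c(O) = ∑_{x ∈ O} d(x, c)`. -/
noncomputable def centerCost {d : ℕ} (c : Pt d) (O : Finset (Pt d)) : ℝ :=
  ∑ x ∈ O, dist x c

/-- `cost(O) = min_{c ∈ ℝ^d} cost_c(O)`. -/
noncomputable def optCost {d : ℕ} (O : Finset (Pt d)) : ℝ :=
  ⨅ c : Pt d, centerCost c O

/-- `cost_C(O_1, …, O_k)`: the minimum over all permutations `i_1, …, i_k` of the clusters of
`max_j cost_{c_j}(O_{i_j})`. -/
noncomputable def minLoadCost {d k : ℕ} (C : Fin k → Pt d) (O : Fin k → Finset (Pt d)) : ℝ :=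
  ⨅ σ : Equiv.Perm (Fin k), ⨆ j : Fin k, centerCost (C j) (O (σ j))

/-- `O_1, …, O_k` is a partition of `P`; empty parts are allowed. -/
structure IsPartition {d k : ℕ} (P : Finset (Pt d)) (O : Fin k → Finset (Pt d)) : Prop where
  disjoint : ∀ i j, i ≠ j → Disjoint (O i) (O j)
  mem_iff : ∀ x, x ∈ P ↔ ∃ i, x ∈ O i

end MinLoad

/-! ## A randomized real RAM

Programs are finite pieces of syntax that work on integer arrays and real arrays (each array is
an unbounded row of cells, with indirect addressing) and may flip fair coins. Every operation,
memory access, comparison and coin flip takes one step. There is no rounding of reals to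
integers, the only constants are natural numbers, and integers can only be added, subtracted and
compared. -/

namespace RealRAM

/-- The memory, together with the sequence of coin flips that have not been used yet. -/
structure State where
  /-- `nat a i` is cell `i` of the integer array `a` -/
  nat : ℕ → ℕ → ℕ
  /-- `real a i` is cell `i` of the real array `a` -/
  real : ℕ → ℕ → ℝ
  coins : ℕ → Bool

/-- Integer expressions. -/
inductive NExp where
  | lit (c : ℕ)
  | get (a : ℕ) (i : NExp)
  | add (e f : NExp)
  | sub (e f : NExp)

/-- Real expressions. -/
inductive RExp where
  | ofNat (e : NExp)
  | get (a : ℕ) (i : NExp)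
  | add (e f : RExp)
  | sub (e f : RExp)
  | mul (e f : RExp)
  | div (e f : RExp)
  | sqrt (e : RExp)

/-- Tests. -/
inductive BExp where
  | natLt (e f : NExp)
  | realLt (e f : RExp)
  | not (b : BExp)
  | and (b c : BExp)

/-- Value of an integer expression; subtraction is truncated at zero. -/
def NExp.eval (s : State) : NExp → ℕ
  | .lit c => c
  | .get a i => s.nat a (i.eval s)
  | .add e f => e.eval s + f.eval s
  | .sub e f => e.eval s - f.eval s

/-- Number of steps taken by the evaluation of an integer expression. -/
def NExp.cost : NExp → ℕ
  | .lit _ => 1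
  | .get _ i => i.cost + 1
  | .add e f => e.cost + f.cost + 1
  | .sub e f => e.cost + f.cost + 1

/-- Value of a real expression; division by zero and the root of a negative number give zero. -/
noncomputable def RExp.eval (s : State) : RExp → ℝ
  | .ofNat e => (e.eval s : ℝ)
  | .get a i => s.real a (i.eval s)
  | .add e f => e.eval s + f.eval s
  | .sub e f => e.eval s - f.eval s
  | .mul e f => e.eval s * f.eval s
  | .div e f => e.eval s / f.eval s
  | .sqrt e => Real.sqrt (e.eval s)

/-- Number of steps taken by the evaluation of a real expression. -/
def RExp.cost : RExp → ℕ
  | .ofNat e => e.cost + 1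
  | .get _ i => i.cost + 1
  | .add e f => e.cost + f.cost + 1
  | .sub e f => e.cost + f.cost + 1
  | .mul e f => e.cost + f.cost + 1
  | .div e f => e.cost + f.cost + 1
  | .sqrt e => e.cost + 1

/-- Truth of a test. -/
def BExp.Holds (s : State) : BExp → Prop
  | .natLt e f => e.eval s < f.eval s
  | .realLt e f => e.eval s < f.eval s
  | .not b => ¬ b.Holds s
  | .and b c => b.Holds s ∧ c.Holds s

/-- Number of steps taken by a test. -/
def BExp.cost : BExp → ℕ
  | .natLt e f => e.cost + f.cost + 1
  | .realLt e f => e.cost + f.cost + 1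
  | .not b => b.cost + 1
  | .and b c => b.cost + c.cost + 1

/-- Programs. -/
inductive Prog where
  | skip
  /-- `natArray a [i] := e` -/
  | setNat (a : ℕ) (i e : NExp)
  /-- `realArray a [i] := e` -/
  | setReal (a : ℕ) (i : NExp) (e : RExp)
  /-- flip a fair coin and store the result, 0 or 1, in `natArray a [i]` -/
  | flip (a : ℕ) (i : NExp)
  | seq (p q : Prog)
  | cond (b : BExp) (p q : Prog)
  | loop (b : BExp) (p : Prog)

/-- Write an integer cell. -/
def State.writeNat (s : State) (a i v : ℕ) : State :=
  { s with nat := Function.update s.nat a (Function.update (s.nat a) i v) }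

/-- Write a real cell. -/
noncomputable def State.writeReal (s : State) (a i : ℕ) (v : ℝ) : State :=
  { s with real := Function.update s.real a (Function.update (s.real a) i v) }

/-- Use up one coin flip and store its result. -/
def State.flip (s : State) (a i : ℕ) : State :=
  { s.writeNat a i (s.coins 0).toNat with coins := fun m => s.coins (m + 1) }

/-- `Exec p s t s'`: started in state `s`, the program `p` halts after exactly `t` steps, in
state `s'`. -/
inductive Exec : Prog → State → ℕ → State → Prop where
  | skip (s : State) : Exec .skip s 1 s
  | setNat (s : State) (a : ℕ) (i e : NExp) :
      Exec (.setNat a i e) s (i.cost + e.cost + 1) (s.writeNat a (i.eval s) (e.eval s))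
  | setReal (s : State) (a : ℕ) (i : NExp) (e : RExp) :
      Exec (.setReal a i e) s (i.cost + e.cost + 1) (s.writeReal a (i.eval s) (e.eval s))
  | flip (s : State) (a : ℕ) (i : NExp) :
      Exec (.flip a i) s (i.cost + 1) (s.flip a (i.eval s))
  | seq {p q : Prog} {s s' s'' : State} {t t' : ℕ} :
      Exec p s t s' → Exec q s' t' s'' → Exec (.seq p q) s (t + t') s''
  | cond_true {b : BExp} {p q : Prog} {s s' : State} {t : ℕ} :
      b.Holds s → Exec p s t s' → Exec (.cond b p q) s (b.cost + t + 1) s'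
  | cond_false {b : BExp} {p q : Prog} {s s' : State} {t : ℕ} :
      ¬ b.Holds s → Exec q s t s' → Exec (.cond b p q) s (b.cost + t + 1) s'
  | loop_true {b : BExp} {p : Prog} {s s' s'' : State} {t t' : ℕ} :
      b.Holds s → Exec p s t s' → Exec (.loop b p) s' t' s'' →
      Exec (.loop b p) s (b.cost + t + 1 + t') s''
  | loop_false {b : BExp} {p : Prog} {s : State} :
      ¬ b.Holds s → Exec (.loop b p) s (b.cost + 1) s

/-- For given coin flips a program has at most one run. -/
theorem Exec.unique {p : Prog} {s s₁ s₂ : State} {t₁ t₂ : ℕ}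
    (h₁ : Exec p s t₁ s₁) (h₂ : Exec p s t₂ s₂) : t₁ = t₂ ∧ s₁ = s₂ := by
  induction h₁ generalizing t₂ s₂ with
  | skip | setNat | setReal | flip => cases h₂; exact ⟨rfl, rfl⟩
  | seq _ _ ih ih' =>
    cases h₂ with
    | seq g g' =>
      obtain ⟨rfl, rfl⟩ := ih g
      obtain ⟨rfl, rfl⟩ := ih' g'
      exact ⟨rfl, rfl⟩
  | cond_true hb _ ih =>
    cases h₂ with
    | cond_true _ g => obtain ⟨rfl, rfl⟩ := ih g; exact ⟨rfl, rfl⟩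
    | cond_false hb' _ => exact absurd hb hb'
  | cond_false hb _ ih =>
    cases h₂ with
    | cond_true hb' _ => exact absurd hb' hb
    | cond_false _ g => obtain ⟨rfl, rfl⟩ := ih g; exact ⟨rfl, rfl⟩
  | loop_true hb _ _ ih ih' =>
    cases h₂ with
    | loop_true _ g g' =>
      obtain ⟨rfl, rfl⟩ := ih g
      obtain ⟨rfl, rfl⟩ := ih' g'
      exact ⟨rfl, rfl⟩
    | loop_false hb' => exact absurd hb hb'
  | loop_false hb =>
    cases h₂ with
    | loop_true hb' _ _ => exact absurd hb' hb
    | loop_false _ => exact ⟨rfl, rfl⟩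

/-- The law of an infinite sequence of independent fair coin flips. -/
noncomputable def coinLaw : MeasureTheory.Measure (ℕ → Bool) :=
  MeasureTheory.Measure.infinitePi fun _ : ℕ => (PMF.uniformOfFintype Bool).toMeasure

end RealRAM

namespace MinLoad

/-- The initial state for `n` points `x 0, …, x (n-1)` of `ℝ^d`, and parameters `k`, `ε`:
integer array `0` holds `n, d, k`; real array `0` holds `ε`; real array `1` holds the points, with
coordinate `j` of `x i` in cell `i * d + j`; all other cells are `0`. -/
noncomputable def inputState {n d : ℕ} (x : Fin n → Pt d) (k : ℕ) (ε : ℝ) (ω : ℕ → Bool) :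
    RealRAM.State where
  nat a i :=
    if a = 0 then (if i = 0 then n else if i = 1 then d else if i = 2 then k else 0) else 0
  real a m :=
    if a = 0 then (if m = 0 then ε else 0)
    else if a = 1 then
      (if h : m < n * d then
        x (finProdFinEquiv.symm ⟨m, h⟩).1 (finProdFinEquiv.symm ⟨m, h⟩).2
      else 0)
    else 0
  coins := ω

/-- The list of `k`-tuples of centers found in a state: its length is in cell `0` of integer
array `1`, and coordinate `c` of center `j` of tuple `l` is in cell `(l * k + j) * d + c` of real
array `2`. -/
noncomputable def outputList (k d : ℕ) (s : RealRAM.State) : List (Fin k → Pt d) :=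
  (List.range (s.nat 1 0)).map fun l j =>
    WithLp.toLp 2 fun c : Fin d => s.real 2 ((l * k + (j : ℕ)) * d + (c : ℕ))

/-- A bound of the form `2 ^ Õ(k / ε ^ O(1))`, with the hidden constants made explicit:
`2 ^ (A * X * (log (2 + X)) ^ b)` where `X = k / ε ^ c`. -/
noncomputable def expTildeO (A b c k : ℕ) (ε : ℝ) : ℝ :=
  (2 : ℝ) ^ ((A : ℝ) * ((k : ℝ) / ε ^ c) * Real.log (2 + (k : ℝ) / ε ^ c) ^ b)

end MinLoad

/-! Let `M` be the largest optimal cluster cost, `q i` an optimal center of the cluster `O i`, `μ =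
M / |O i|` and `e = ε / 2`. A round of the algorithm grows a pool of points by sampling input points
with probability proportional to their distance to the pool. It then guesses `k` centers: each
starts at a pool point, moves `J = O(1/ε²)` times by a guessed fraction of the way towards a guessed
pool point, and is finally shifted a little.

A potential counts the clusters that the pool serves up to a factor 5, the number of moves available
for each cluster, and a pair of close pool points. While the pool is not good enough, points of at
least a fraction `e² / (960 k)` of the total weight raise the potential
(`Clusters.exists_progress`). If some cluster is uncovered, the heaviest one carries a `1/k`
fraction, and its central points carry a fifth of that (`uncovered_cluster`). If a cluster is
covered but a reachable `c` is still a bad center, many points `y` are notably nearer to `q i` than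
to `c` (`card_gap_points`). A suitable move of `c` towards such a `y` lowers `dist c (q i) ^ 2` by a
fixed multiple of `e² μ²` (`exists_grid_step`), which can happen only `O(1/e²)` times. Either a pool
point near `y` already allows the move, or `y` is far from the pool and so has a large weight
(`level_progress`). As the potential is at most `k + k J + 1`, a run of `S = O(k/ε²)` lucky samples
suffices.

The list may contain only sets of exactly `k` centers. Guessed multiples of a short vector `y - y'`
separate coinciding centers at an extra cost of at most `ε M / 2`; Hall's theorem shows that
suitable multiples exist (`Clusters.Done.exists_centers`). Tuples that are not distinct are
discarded.

A round needs at most `4 S h` lucky bits, where `2 ^ h` lies between `2 S` and `4 S`. Among `2 ^ (4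
S h)` rounds one succeeds with probability at least `1 - exp (-1)`, which exceeds one half. Since `h
= O(log (2 + k/ε²))`, this number of rounds has the required size.

On the machine side every block uses a number of coins that does not depend on their outcome.
Probabilities are therefore fractions of bit strings, and sure statements (`All`) and likely
statements (`Luck`) compose along the program. -/

/-! ## Fractions of bit strings -/

namespace RealRAM

open scoped Classical in
/-- The fraction of the bit strings of length `B` that satisfy `A`. -/
noncomputable def bitProb : ℕ → (List Bool → Prop) → ℝ
  | 0, A => if A [] then 1 else 0
  | B + 1, A =>
    (bitProb B (fun l => A (true :: l)) + bitProb B (fun l => A (false :: l))) / 2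

theorem bitProb_mono {B : ℕ} {A A' : List Bool → Prop}
    (h : ∀ l, l.length = B → A l → A' l) : bitProb B A ≤ bitProb B A' := by
  induction B generalizing A A' with
  | zero =>
    simp only [bitProb]
    have := h [] rfl
    split_ifs <;> simp_all
  | succ B ih =>
    simp only [bitProb]
    have h1 := ih (A := fun l => A (true :: l)) (A' := fun l => A' (true :: l))
      (fun l hl => h _ (by simp [hl]))
    have h2 := ih (A := fun l => A (false :: l)) (A' := fun l => A' (false :: l))
      (fun l hl => h _ (by simp [hl]))
    linarith

theorem bitProb_congr {B : ℕ} {A A' : List Bool → Prop}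
    (h : ∀ l, l.length = B → (A l ↔ A' l)) : bitProb B A = bitProb B A' :=
  le_antisymm (bitProb_mono fun l hl => (h l hl).1) (bitProb_mono fun l hl => (h l hl).2)

theorem bitProb_false (B : ℕ) : bitProb B (fun _ => False) = 0 := by
  induction B with
  | zero => simp [bitProb]
  | succ B ih => simp [bitProb, ih]

theorem bitProb_true (B : ℕ) : bitProb B (fun _ => True) = 1 := by
  induction B with
  | zero => simp [bitProb]
  | succ B ih => simp [bitProb, ih]

theorem bitProb_nonneg (B : ℕ) (A : List Bool → Prop) : 0 ≤ bitProb B A := by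
  rw [← bitProb_false B]
  exact bitProb_mono fun _ _ h => h.elim

theorem bitProb_eq_one {B : ℕ} {A : List Bool → Prop} (h : ∀ l, l.length = B → A l) :
    bitProb B A = 1 := by
  rw [← bitProb_true B]
  exact bitProb_congr fun l hl => by simp [h l hl]

theorem le_bitProb_of_mem {B : ℕ} {A : List Bool → Prop} (l : List Bool) (hl : l.length = B)
    (h : A l) : (1 / 2 : ℝ) ^ B ≤ bitProb B A := by
  induction B generalizing A l with
  | zero =>
    obtain rfl := List.length_eq_zero_iff.1 hl
    simp [bitProb, h]
  | succ B ih =>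
    cases l with
    | nil => simp at hl
    | cons b l =>
      simp only [bitProb, pow_succ]
      have n1 := bitProb_nonneg B (fun l => A (true :: l))
      have n2 := bitProb_nonneg B (fun l => A (false :: l))
      cases b with
      | true =>
        have := ih (A := fun l => A (true :: l)) l (by simpa using hl) h
        linarith
      | false =>
        have := ih (A := fun l => A (false :: l)) l (by simpa using hl) h
        linarith

/-- The law of total probability over the first `B₁` bits. The bound `b` is the fallback chance when
`A₁` fails: `b = 0` yields the product rule for sequential composition, a positive `b` yields
independent retries. -/
theorem le_bitProb_add {B₁ B₂ : ℕ} {A₁ A : List Bool → Prop} {a b : ℝ}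
    (h₁ : ∀ l, l.length = B₁ → A₁ l → a ≤ bitProb B₂ (fun l' => A (l ++ l')))
    (h₂ : ∀ l, l.length = B₁ → b ≤ bitProb B₂ (fun l' => A (l ++ l'))) :
    bitProb B₁ A₁ * a + (1 - bitProb B₁ A₁) * b ≤ bitProb (B₁ + B₂) A := by
  induction B₁ generalizing A₁ A with
  | zero =>
    have e : bitProb (0 + B₂) A = bitProb B₂ A := by rw [Nat.zero_add]
    rw [e]
    simp only [bitProb]
    have h1 := h₁ [] rfl
    have h2 := h₂ [] rfl
    simp only [List.nil_append] at h1 h2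
    split_ifs with hA
    · linarith [h1 hA]
    · linarith
  | succ n ih =>
    have e : n + 1 + B₂ = (n + B₂) + 1 := by omega
    rw [e]
    simp only [bitProb]
    have i1 := ih (A₁ := fun l => A₁ (true :: l)) (A := fun l => A (true :: l))
      (fun l hl hA => h₁ (true :: l) (by simp [hl]) hA) (fun l hl => h₂ (true :: l) (by simp [hl]))
    have i2 := ih (A₁ := fun l => A₁ (false :: l)) (A := fun l => A (false :: l))
      (fun l hl hA => h₁ (false :: l) (by simp [hl]) hA)
      (fun l hl => h₂ (false :: l) (by simp [hl]))
    linarith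

theorem sum_bitProb_le {ι : Type*} {B : ℕ} (G : Finset ι) (A : ι → List Bool → Prop)
    (hd : ∀ l, l.length = B → ∀ i ∈ G, ∀ j ∈ G, A i l → A j l → i = j) :
    ∑ i ∈ G, bitProb B (A i) ≤ bitProb B (fun l => ∃ i ∈ G, A i l) := by
  induction B generalizing A with
  | zero =>
    simp only [bitProb]
    have hd := hd [] rfl
    split_ifs with h
    · obtain ⟨i, hi, hA⟩ := h
      rw [Finset.sum_eq_single_of_mem i hi]
      · simp [hA]
      · intro j hj hji
        rw [if_neg]
        intro hAj
        exact hji (hd _ hj _ hi hAj hA)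
    · rw [Finset.sum_eq_zero]
      intro i hi
      rw [if_neg]
      exact fun hA => h ⟨i, hi, hA⟩
  | succ B ih =>
    simp only [bitProb]
    rw [← Finset.sum_div, Finset.sum_add_distrib]
    have i1 := ih (fun i l => A i (true :: l)) (fun l hl => hd _ (by simp [hl]))
    have i2 := ih (fun i l => A i (false :: l)) (fun l hl => hd _ (by simp [hl]))
    linarith

/-- The number with the given binary digits, most significant digit first. -/
def bitsVal : List Bool → ℕ
  | [] => 0
  | b :: l => b.toNat * 2 ^ l.length + bitsVal l

theorem bitsVal_lt (l : List Bool) : bitsVal l < 2 ^ l.length := by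
  induction l with
  | nil => simp [bitsVal]
  | cons b l ih => cases b <;> simp [bitsVal, pow_succ] <;> omega

theorem bitsVal_append (l l' : List Bool) :
    bitsVal (l ++ l') = bitsVal l * 2 ^ l'.length + bitsVal l' := by
  induction l with
  | nil => simp [bitsVal]
  | cons b l ih => simp [bitsVal, ih, pow_add]; ring

theorem exists_bitsVal_eq {h v : ℕ} (hv : v < 2 ^ h) : ∃ l, l.length = h ∧ bitsVal l = v := by
  induction h generalizing v with
  | zero => exact ⟨[], rfl, by simp [bitsVal]; omega⟩
  | succ h ih =>
    rw [pow_succ] at hv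
    by_cases hb : v < 2 ^ h
    · obtain ⟨l, hl, rfl⟩ := ih hb
      exact ⟨false :: l, by simp [hl], by simp [bitsVal]⟩
    · obtain ⟨l, hl, e⟩ := ih (v := v - 2 ^ h) (by omega)
      exact ⟨true :: l, by simp [hl], by simp [bitsVal, hl, e]; omega⟩

/-- The leading digit replaces the threshold `x` by `2 * x - 1` or by `2 * x`. According to whether
`x ≤ 1 / 2`, one of the two branches has probability 0 or 1, and averaging halves the rounding error
of the other. -/
theorem bitProb_cdf {B : ℕ} {x : ℝ} (h0 : 0 ≤ x) (h1 : x ≤ 1) :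
    x ≤ bitProb B (fun l => (bitsVal l : ℝ) / 2 ^ B < x) ∧
      bitProb B (fun l => (bitsVal l : ℝ) / 2 ^ B < x) ≤ x + (1 / 2) ^ B := by
  induction B generalizing x with
  | zero =>
    simp only [bitProb, bitsVal, Nat.cast_zero, zero_div, pow_zero]
    split_ifs <;> constructor <;> linarith
  | succ B ih =>
    simp only [bitProb]
    have p2 : (0 : ℝ) < 2 ^ B := by positivity
    have et : bitProb B (fun l => ((bitsVal (true :: l) : ℕ) : ℝ) / 2 ^ (B + 1) < x)
        = bitProb B (fun l => (bitsVal l : ℝ) / 2 ^ B < 2 * x - 1) := by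
      refine bitProb_congr fun l hl => ?_
      simp only [bitsVal, hl, Bool.toNat_true, one_mul, Nat.cast_add, Nat.cast_pow, Nat.cast_ofNat]
      rw [pow_succ, div_lt_iff₀ (by positivity), div_lt_iff₀ p2]
      constructor <;> intro h <;> nlinarith
    have ef : bitProb B (fun l => ((bitsVal (false :: l) : ℕ) : ℝ) / 2 ^ (B + 1) < x)
        = bitProb B (fun l => (bitsVal l : ℝ) / 2 ^ B < 2 * x) := by
      refine bitProb_congr fun l hl => ?_
      simp only [bitsVal, Bool.toNat_false, zero_mul, zero_add]
      rw [pow_succ, div_lt_iff₀ (by positivity), div_lt_iff₀ p2]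
      constructor <;> intro h <;> nlinarith
    rw [et, ef, pow_succ]
    by_cases hx : x ≤ 1 / 2
    · have z : bitProb B (fun l => (bitsVal l : ℝ) / 2 ^ B < 2 * x - 1) = 0 := by
        rw [← bitProb_false B]
        refine bitProb_congr fun l hl => ?_
        have : (0 : ℝ) ≤ (bitsVal l : ℝ) / 2 ^ B := by positivity
        simp only [iff_false, not_lt]
        linarith
      have := ih (x := 2 * x) (by linarith) (by linarith)
      rw [z]
      constructor <;> linarith [this.1, this.2]
    · have z : bitProb B (fun l => (bitsVal l : ℝ) / 2 ^ B < 2 * x) = 1 := by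
        refine bitProb_eq_one fun l hl => ?_
        have h3 := bitsVal_lt l
        rw [hl] at h3
        have : (bitsVal l : ℝ) < 2 ^ B := by exact_mod_cast h3
        have : (bitsVal l : ℝ) / 2 ^ B < 1 := by rw [div_lt_one p2]; exact this
        linarith
      have := ih (x := 2 * x - 1) (by linarith) (by linarith)
      rw [z]
      constructor <;> linarith [this.1, this.2]

theorem bitProb_interval {B : ℕ} {x y : ℝ} (h0 : 0 ≤ x) (hxy : x ≤ y) (h1 : y ≤ 1) :
    y - x - (1 / 2) ^ B ≤
      bitProb B (fun l => x ≤ (bitsVal l : ℝ) / 2 ^ B ∧ (bitsVal l : ℝ) / 2 ^ B < y) := by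
  have hy := (bitProb_cdf (B := B) (x := y) (by linarith) h1).1
  have hx := (bitProb_cdf (B := B) (x := x) h0 (by linarith)).2
  -- Subadditivity, which turns the two bounds on the distribution function into a bound for the
  -- interval.
  have key : ∀ (B : ℕ) (A A' : List Bool → Prop),
      bitProb B A ≤ bitProb B A' + bitProb B (fun l => ¬ A' l ∧ A l) := by
    intro B
    induction B with
    | zero => intro A A'; simp only [bitProb]; split_ifs <;> simp_all
    | succ B ih =>
      intro A A'
      simp only [bitProb]
      have := ih (fun l => A (true :: l)) (fun l => A' (true :: l))
      have := ih (fun l => A (false :: l)) (fun l => A' (false :: l))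
      linarith
  have := key B (fun l => (bitsVal l : ℝ) / 2 ^ B < y) (fun l => (bitsVal l : ℝ) / 2 ^ B < x)
  simp only [not_lt] at this
  linarith

/-- Picking an index with probability proportional to its weight, by comparing a random dyadic
number with the partial sums of the weights. -/
theorem le_bitProb_pick {n B : ℕ} (w : ℕ → ℝ) (hw : ∀ i, i < n → 0 ≤ w i)
    (hW : 0 < ∑ i ∈ Finset.range n, w i) (G : Finset ℕ) (hG : ∀ i ∈ G, i < n) :
    (∑ i ∈ G, w i) / (∑ i ∈ Finset.range n, w i) - n * (1 / 2) ^ B ≤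
      bitProb B (fun l => ∃ i ∈ G,
        ∑ j ∈ Finset.range i, w j ≤
            (bitsVal l : ℝ) / 2 ^ B * ∑ i ∈ Finset.range n, w i ∧
          (bitsVal l : ℝ) / 2 ^ B * ∑ i ∈ Finset.range n, w i
            < ∑ j ∈ Finset.range (i + 1), w j) := by
  set W := ∑ i ∈ Finset.range n, w i with hWdef
  have hmono : ∀ i j, i ≤ j → j ≤ n →
      ∑ m ∈ Finset.range i, w m ≤ ∑ m ∈ Finset.range j, w m := by
    intro i j hij hj
    refine Finset.sum_le_sum_of_subset_of_nonneg
      (Finset.range_subset_range.2 hij) fun m hm _ => hw m ?_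
    have := Finset.mem_range.1 hm
    omega
  -- The half-open intervals between successive partial sums are disjoint, so their probabilities
  -- add up. Each falls short of `w i / W` by at most `(1 / 2) ^ B`, and there are at most `n` of
  -- them.
  refine le_trans ?_ (sum_bitProb_le G _ ?_)
  · have hcard : (G.card : ℝ) ≤ n := by
      have : G ⊆ Finset.range n := fun i hi => Finset.mem_range.2 (hG i hi)
      exact_mod_cast (Finset.card_le_card this).trans (by simp)
    have h2 : ∑ i ∈ G, (w i / W - (1 / 2) ^ B) ≤ ∑ i ∈ G, bitProb B (fun l =>
        ∑ j ∈ Finset.range i, w j ≤ (bitsVal l : ℝ) / 2 ^ B * W ∧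
          (bitsVal l : ℝ) / 2 ^ B * W < ∑ j ∈ Finset.range (i + 1), w j) := by
      refine Finset.sum_le_sum fun i hi => ?_
      have hin := hG i hi
      have h0 : 0 ≤ (∑ j ∈ Finset.range i, w j) / W :=
        div_nonneg (by simpa using hmono 0 i (by omega) (by omega)) hW.le
      have h3 : (∑ j ∈ Finset.range i, w j) / W ≤ (∑ j ∈ Finset.range (i + 1), w j) / W :=
        div_le_div_of_nonneg_right (hmono _ _ (by omega) (by omega)) hW.le
      have h1 : (∑ j ∈ Finset.range (i + 1), w j) / W ≤ 1 := by
        rw [div_le_one hW]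
        exact hmono _ _ (by omega) le_rfl
      have := bitProb_interval (B := B) h0 h3 h1
      rw [Finset.sum_range_succ, add_div] at this
      refine le_trans (by linarith) (this.trans (bitProb_mono fun l _ hl => ?_))
      rw [← add_div, ← Finset.sum_range_succ, div_le_iff₀ hW, lt_div_iff₀ hW] at hl
      exact hl
    refine le_trans ?_ h2
    rw [Finset.sum_sub_distrib, ← Finset.sum_div, Finset.sum_const, nsmul_eq_mul]
    have : (G.card : ℝ) * (1 / 2) ^ B ≤ n * (1 / 2) ^ B := by gcongr
    linarith
  · rintro l - i hi j hj ⟨hi1, hi2⟩ ⟨hj1, hj2⟩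
    by_contra hne
    rcases lt_or_gt_of_ne hne with hlt | hlt
    · have := hmono (i + 1) j hlt (hG j hj).le
      linarith
    · have := hmono (j + 1) i hlt (hG i hi).le
      linarith

/-! ## Coin sequences with a prescribed beginning -/

/-- The coin sequence `ω` with the coins `l` put in front. -/
def prependCoins : List Bool → (ℕ → Bool) → ℕ → Bool
  | [], ω => ω
  | b :: l, ω => fun m => Nat.casesOn m b (prependCoins l ω)

theorem prependCoins_append (l l' : List Bool) (ω : ℕ → Bool) :
    prependCoins (l ++ l') ω = prependCoins l (prependCoins l' ω) := by
  induction l with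
  | nil => rfl
  | cons b l ih => simp [prependCoins, ih]

theorem exists_eq_prependCoins (B : ℕ) (ω : ℕ → Bool) :
    ∃ l ω', l.length = B ∧ ω = prependCoins l ω' := by
  induction B generalizing ω with
  | zero => exact ⟨[], ω, rfl, rfl⟩
  | succ B ih =>
    obtain ⟨l, ω', hl, e⟩ := ih (fun m => ω (m + 1))
    refine ⟨ω 0 :: l, ω', by simp [hl], ?_⟩
    funext m
    cases m with
    | zero => rfl
    | succ m => exact congrFun e m

theorem bitProb_eq_sum (B : ℕ) (A : List Bool → Prop) [DecidablePred A] :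
    bitProb B A = ∑ v : Fin B → Bool, if A (List.ofFn v) then (1 / 2 : ℝ) ^ B else 0 := by
  classical
  induction B generalizing A with
  | zero => simp [bitProb]
  | succ B ih =>
    simp only [bitProb]
    have hc : ∀ (b : Bool) (v : Fin B → Bool),
        List.ofFn ((Fin.consEquiv (fun _ : Fin (B + 1) => Bool)) (b, v)) = b :: List.ofFn v := by
      intro b v
      simp [Fin.consEquiv, List.ofFn_succ]
    rw [ih, ih, ← (Fin.consEquiv (fun _ : Fin (B + 1) => Bool)).sum_comp, Fintype.sum_prod_type]
    simp only [hc, Fintype.univ_bool, Finset.mem_singleton, Bool.true_eq_false, not_false_eq_true,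
      Finset.sum_insert, Finset.sum_singleton]
    rw [add_div, Finset.sum_div, Finset.sum_div]
    congr 1 <;> refine Finset.sum_congr rfl fun v _ => ?_ <;> split_ifs <;> simp [pow_succ] <;> rfl

theorem prependCoins_ofFn {B : ℕ} (ω : ℕ → Bool) :
    ∃ ω', ω = prependCoins (List.ofFn fun i : Fin B => ω i) ω' := by
  induction B generalizing ω with
  | zero => exact ⟨ω, by simp [prependCoins]⟩
  | succ B ih =>
    obtain ⟨ω', e⟩ := ih (fun m => ω (m + 1))
    refine ⟨ω', ?_⟩
    funext m
    rw [List.ofFn_succ]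
    cases m with
    | zero => rfl
    | succ m => exact congrFun e m

theorem coinLaw_cylinder {B : ℕ} (v : Fin B → Bool) :
    coinLaw {ω | ∀ i : Fin B, ω i = v i} = ENNReal.ofReal ((1 / 2) ^ B) := by
  have h := MeasureTheory.Measure.infinitePi_pi
    (μ := fun _ : ℕ => (PMF.uniformOfFintype Bool).toMeasure) (s := Finset.range B)
    (t := fun i => {b | ∀ h : i < B, b = v ⟨i, h⟩}) (fun _ _ => MeasurableSet.of_discrete)
  have e : {ω : ℕ → Bool | ∀ i : Fin B, ω i = v i} =
      Set.pi (Finset.range B : Set ℕ) (fun i => {b | ∀ h : i < B, b = v ⟨i, h⟩}) := by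
    ext ω
    simp only [Set.mem_ofPred_eq, Set.mem_pi, Finset.coe_range, Set.mem_Iio]
    exact ⟨fun h i hi _ => h ⟨i, hi⟩, fun h i => h i i.2 i.2⟩
  rw [e, coinLaw, h, Finset.prod_congr rfl (g := fun _ => ENNReal.ofReal (1 / 2))]
  · rw [Finset.prod_const, Finset.card_range, ENNReal.ofReal_pow (by norm_num)]
  · intro i hi
    have hi' := Finset.mem_range.1 hi
    have : {b | ∀ h : i < B, b = v ⟨i, h⟩} = {v ⟨i, hi'⟩} := by
      ext b
      simp [hi']
    rw [this, PMF.toMeasure_apply_singleton _ _ MeasurableSet.of_discrete,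
      PMF.uniformOfFintype_apply]
    simp

/-- The event contains disjoint cylinders, one for each good string of length `B`. Only a lower
bound is wanted, so `E` need not be measurable. This is the single passage from counting strings to
the coin measure. -/
theorem bitProb_le_coinLaw {B : ℕ} {A : List Bool → Prop} {E : Set (ℕ → Bool)}
    (h : ∀ l ω, l.length = B → A l → prependCoins l ω ∈ E) :
    ENNReal.ofReal (bitProb B A) ≤ coinLaw E := by
  classical
  rw [bitProb_eq_sum, ← Finset.sum_filter, ENNReal.ofReal_sum_of_nonneg
    (fun _ _ => by positivity)]
  rw [Finset.sum_congr rfl fun v _ => (coinLaw_cylinder v).symm]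
  rw [← MeasureTheory.measure_biUnion_finset]
  · refine MeasureTheory.measure_mono fun ω hω => ?_
    simp only [Set.mem_iUnion, Finset.mem_filter, Finset.mem_univ, true_and,
      Set.mem_ofPred_eq] at hω
    obtain ⟨v, hA, hv⟩ := hω
    obtain ⟨ω', e⟩ := prependCoins_ofFn (B := B) ω
    have : (fun i : Fin B => ω i) = v := funext hv
    rw [this] at e
    rw [e]
    exact h _ _ (by simp) hA
  · intro v _ w _ hvw
    rw [Function.onFun, Set.disjoint_left]
    intro ω h1 h2
    exact hvw (funext fun i => (h1 i).symm.trans (h2 i))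
  · intro v _
    have : {ω : ℕ → Bool | ∀ i : Fin B, ω i = v i} = ⋂ i : Fin B, (fun ω => ω i) ⁻¹' {v i} := by
      ext ω; simp
    rw [this]
    exact MeasurableSet.iInter fun i => measurable_pi_apply _ MeasurableSet.of_discrete

end RealRAM

/-! ## Reasoning about runs of programs -/

namespace RealRAM

/-- The same memory with other coins. -/
def State.withCoins (s : State) (ω : ℕ → Bool) : State := { s with coins := ω }

@[simp] theorem State.withCoins_nat (s : State) (ω : ℕ → Bool) : (s.withCoins ω).nat = s.nat := rfl

@[simp] theorem State.withCoins_real (s : State) (ω : ℕ → Bool) :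
    (s.withCoins ω).real = s.real := rfl

@[simp] theorem State.writeNat_nat (s : State) (a i v b j : ℕ) :
    (s.writeNat a i v).nat b j = if b = a ∧ j = i then v else s.nat b j := by
  by_cases h : b = a
  · subst h
    by_cases h' : j = i
    · subst h'; simp [State.writeNat]
    · simp [State.writeNat, h']
  · simp [State.writeNat, h]

@[simp] theorem State.writeNat_real (s : State) (a i v : ℕ) :
    (s.writeNat a i v).real = s.real := rfl

@[simp] theorem State.writeReal_nat (s : State) (a i : ℕ) (v : ℝ) :
    (s.writeReal a i v).nat = s.nat := rfl

@[simp] theorem State.writeReal_real (s : State) (a i : ℕ) (v : ℝ) (b j : ℕ) :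
    (s.writeReal a i v).real b j = if b = a ∧ j = i then v else s.real b j := by
  by_cases h : b = a
  · subst h
    by_cases h' : j = i
    · subst h'; simp [State.writeReal]
    · simp [State.writeReal, h']
  · simp [State.writeReal, h]

theorem State.writeNat_nat_of_ne (s : State) {a i v b : ℕ} (h : b ≠ a) :
    (s.writeNat a i v).nat b = s.nat b := by
  simp [State.writeNat, h]

theorem State.writeReal_real_of_ne (s : State) {a i b : ℕ} {v : ℝ} (h : b ≠ a) :
    (s.writeReal a i v).real b = s.real b := by
  simp [State.writeReal, h]

@[simp] theorem NExp.eval_withCoins (s : State) (ω : ℕ → Bool) (e : NExp) :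
    e.eval (s.withCoins ω) = e.eval s := by
  induction e with
  | lit c => rfl
  | get a i ih => simp [NExp.eval, ih]
  | add e f ih ih' => simp [NExp.eval, ih, ih']
  | sub e f ih ih' => simp [NExp.eval, ih, ih']

@[simp] theorem RExp.eval_withCoins (s : State) (ω : ℕ → Bool) (e : RExp) :
    e.eval (s.withCoins ω) = e.eval s := by
  induction e with
  | ofNat e => simp [RExp.eval]
  | get a i => simp [RExp.eval]
  | add e f ih ih' => simp [RExp.eval, ih, ih']
  | sub e f ih ih' => simp [RExp.eval, ih, ih']
  | mul e f ih ih' => simp [RExp.eval, ih, ih']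
  | div e f ih ih' => simp [RExp.eval, ih, ih']
  | sqrt e ih => simp [RExp.eval, ih]

@[simp] theorem BExp.holds_withCoins (s : State) (ω : ℕ → Bool) (b : BExp) :
    b.Holds (s.withCoins ω) ↔ b.Holds s := by
  induction b with
  | natLt e f => simp [BExp.Holds]
  | realLt e f => simp [BExp.Holds]
  | not b ih => simp [BExp.Holds, ih]
  | and b c ih ih' => simp [BExp.Holds, ih, ih']

/-- Whether the program contains an instruction that writes to the integer array `a`. -/
def Prog.writesNat : Prog → ℕ → Bool
  | .skip, _ => false
  | .setNat b _ _, a => b == a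
  | .setReal _ _ _, _ => false
  | .flip b _, a => b == a
  | .seq p q, a => p.writesNat a || q.writesNat a
  | .cond _ p q, a => p.writesNat a || q.writesNat a
  | .loop _ p, a => p.writesNat a

/-- Whether the program contains an instruction that writes to the real array `a`. -/
def Prog.writesReal : Prog → ℕ → Bool
  | .skip, _ => false
  | .setNat _ _ _, _ => false
  | .setReal b _ _, a => b == a
  | .flip _ _, _ => false
  | .seq p q, a => p.writesReal a || q.writesReal a
  | .cond _ p q, a => p.writesReal a || q.writesReal a
  | .loop _ p, a => p.writesReal a

/-- `s'` differs from `s` only in arrays that are written to by `p`. -/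
structure Frame (p : Prog) (s s' : State) : Prop where
  nat : ∀ a, p.writesNat a = false → s'.nat a = s.nat a
  real : ∀ a, p.writesReal a = false → s'.real a = s.real a

/-- Framing is syntactic: the side condition that an array is not written is evaluated on the
program text, mostly by `rfl`. In this way facts about untouched arrays travel through long
programs. -/
theorem Exec.frame {p : Prog} {s s' : State} {t : ℕ} (h : Exec p s t s') : Frame p s s' := by
  induction h with
  | skip => exact ⟨fun _ _ => rfl, fun _ _ => rfl⟩
  | setNat s a i e =>
    refine ⟨fun b hb => ?_, fun _ _ => rfl⟩
    simp only [Prog.writesNat, beq_eq_false_iff_ne] at hb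
    exact State.writeNat_nat_of_ne _ (Ne.symm hb)
  | setReal s a i e =>
    refine ⟨fun _ _ => rfl, fun b hb => ?_⟩
    simp only [Prog.writesReal, beq_eq_false_iff_ne] at hb
    exact State.writeReal_real_of_ne _ (Ne.symm hb)
  | flip s a i =>
    refine ⟨fun b hb => ?_, fun _ _ => rfl⟩
    simp only [Prog.writesNat, beq_eq_false_iff_ne] at hb
    exact State.writeNat_nat_of_ne s (Ne.symm hb)
  | seq _ _ ih ih' =>
    constructor
    · intro a ha
      simp only [Prog.writesNat, Bool.or_eq_false_iff] at ha
      rw [ih'.nat a ha.2, ih.nat a ha.1]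
    · intro a ha
      simp only [Prog.writesReal, Bool.or_eq_false_iff] at ha
      rw [ih'.real a ha.2, ih.real a ha.1]
  | cond_true _ _ ih =>
    constructor
    · intro a ha
      simp only [Prog.writesNat, Bool.or_eq_false_iff] at ha
      exact ih.nat a ha.1
    · intro a ha
      simp only [Prog.writesReal, Bool.or_eq_false_iff] at ha
      exact ih.real a ha.1
  | cond_false _ _ ih =>
    constructor
    · intro a ha
      simp only [Prog.writesNat, Bool.or_eq_false_iff] at ha
      exact ih.nat a ha.2
    · intro a ha
      simp only [Prog.writesReal, Bool.or_eq_false_iff] at ha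
      exact ih.real a ha.2
  | loop_true _ _ _ ih ih' =>
    exact ⟨fun a ha => (ih'.nat a ha).trans (ih.nat a ha),
      fun a ha => (ih'.real a ha).trans (ih.real a ha)⟩
  | loop_false => exact ⟨fun _ _ => rfl, fun _ _ => rfl⟩

/-- Started in the memory `s`, the program `p` uses exactly the coins `l`, takes at most `T`
steps and ends with the memory `s'`. -/
def Run (p : Prog) (s : State) (l : List Bool) (T : ℕ) (s' : State) : Prop :=
  ∀ ω, ∃ t ≤ T, Exec p (s.withCoins (prependCoins l ω)) t (s'.withCoins ω)

/-- Started in the memory `s`, the program `p` uses exactly the coins `l`, takes at most `T`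
steps and ends with a memory that satisfies `Q`. -/
def Hoare (p : Prog) (s : State) (l : List Bool) (T : ℕ) (Q : State → Prop) : Prop :=
  ∃ s', Run p s l T s' ∧ Q s'

theorem Hoare.mono {p : Prog} {s : State} {l : List Bool} {T T' : ℕ} {Q Q' : State → Prop}
    (h : Hoare p s l T Q) (hT : T ≤ T') (hQ : ∀ s', Q s' → Q' s') : Hoare p s l T' Q' := by
  obtain ⟨s', hr, hq⟩ := h
  refine ⟨s', fun ω => ?_, hQ _ hq⟩
  obtain ⟨t, ht, he⟩ := hr ω
  exact ⟨t, ht.trans hT, he⟩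

theorem Hoare.frame {p : Prog} {s : State} {l : List Bool} {T : ℕ} {Q : State → Prop}
    (h : Hoare p s l T Q) : Hoare p s l T (fun s' => Q s' ∧ Frame p s s') := by
  obtain ⟨s', hr, hq⟩ := h
  obtain ⟨t, ht, he⟩ := hr fun _ => true
  exact ⟨s', hr, hq, he.frame.nat, he.frame.real⟩

/-- For fixed coins there is only one run, but the two final states are known to agree only up to
their unused coins. Hence the requirement `hc` that `Q'` depend on the memory alone. -/
theorem Hoare.and {p : Prog} {s : State} {l : List Bool} {T : ℕ} {Q Q' : State → Prop}
    (h : Hoare p s l T Q) (h' : Hoare p s l T Q') (hc : ∀ s s', Q' s → s.nat = s'.nat →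
      s.real = s'.real → Q' s') : Hoare p s l T (fun s' => Q s' ∧ Q' s') := by
  obtain ⟨s₁, hr, hq⟩ := h
  obtain ⟨s₂, hr', hq'⟩ := h'
  obtain ⟨t, ht, he⟩ := hr fun _ => true
  obtain ⟨t', ht', he'⟩ := hr' fun _ => true
  have := (he'.unique he).2
  exact ⟨s₁, hr, hq, hc _ _ hq' (by simpa using congrArg State.nat this)
    (by simpa using congrArg State.real this)⟩

theorem Hoare.skip {s : State} {Q : State → Prop} (h : Q s) : Hoare .skip s [] 1 Q :=
  ⟨s, fun _ => ⟨1, le_rfl, .skip _⟩, h⟩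

theorem Hoare.setNat {s : State} {a : ℕ} {i e : NExp} {Q : State → Prop}
    (h : Q (s.writeNat a (i.eval s) (e.eval s))) :
    Hoare (.setNat a i e) s [] (i.cost + e.cost + 1) Q := by
  refine ⟨_, fun ω => ⟨_, le_rfl, ?_⟩, h⟩
  have := Exec.setNat (s.withCoins ω) a i e
  rw [NExp.eval_withCoins, NExp.eval_withCoins] at this
  exact this

theorem Hoare.setReal {s : State} {a : ℕ} {i : NExp} {e : RExp} {Q : State → Prop}
    (h : Q (s.writeReal a (i.eval s) (e.eval s))) :
    Hoare (.setReal a i e) s [] (i.cost + e.cost + 1) Q := by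
  refine ⟨_, fun ω => ⟨_, le_rfl, ?_⟩, h⟩
  have := Exec.setReal (s.withCoins ω) a i e
  rw [NExp.eval_withCoins, RExp.eval_withCoins] at this
  exact this

theorem Hoare.flip {s : State} {a : ℕ} {i : NExp} {b : Bool} {Q : State → Prop}
    (h : Q (s.writeNat a (i.eval s) b.toNat)) :
    Hoare (.flip a i) s [b] (i.cost + 1) Q := by
  refine ⟨_, fun ω => ⟨_, le_rfl, ?_⟩, h⟩
  have := Exec.flip (s.withCoins (prependCoins [b] ω)) a i
  rw [NExp.eval_withCoins] at this
  exact this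

theorem Hoare.seq {p q : Prog} {s : State} {l l' : List Bool} {T T' : ℕ} {Q Q' : State → Prop}
    (h : Hoare p s l T Q) (h' : ∀ s', Q s' → Hoare q s' l' T' Q') :
    Hoare (.seq p q) s (l ++ l') (T + T') Q' := by
  obtain ⟨s₁, hr, hq⟩ := h
  obtain ⟨s₂, hr', hq'⟩ := h' s₁ hq
  refine ⟨s₂, fun ω => ?_, hq'⟩
  obtain ⟨t, ht, he⟩ := hr (prependCoins l' ω)
  obtain ⟨t', ht', he'⟩ := hr' ω
  rw [← prependCoins_append] at he
  exact ⟨t + t', by omega, .seq he he'⟩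

/-- Sequential composition when the first part uses no coins. -/
theorem Hoare.seq_nil {p q : Prog} {s : State} {l : List Bool} {T T' : ℕ} {Q Q' : State → Prop}
    (h : Hoare p s [] T Q) (h' : ∀ s', Q s' → Frame p s s' → Hoare q s' l T' Q') :
    Hoare (.seq p q) s l (T + T') Q' :=
  h.frame.seq (l' := l) fun s' hs' => h' s' hs'.1 hs'.2

theorem Hoare.setNat_seq {q : Prog} {s : State} {a : ℕ} {i e : NExp} {l : List Bool} {T : ℕ}
    {Q : State → Prop} (h : Hoare q (s.writeNat a (i.eval s) (e.eval s)) l T Q) :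
    Hoare (.seq (.setNat a i e) q) s l (i.cost + e.cost + 1 + T) Q :=
  (Hoare.setNat (Q := fun s' => s' = s.writeNat a (i.eval s) (e.eval s)) rfl).seq (l' := l)
    (by rintro s' rfl; exact h)

theorem Hoare.setReal_seq {q : Prog} {s : State} {a : ℕ} {i : NExp} {e : RExp} {l : List Bool}
    {T : ℕ} {Q : State → Prop} (h : Hoare q (s.writeReal a (i.eval s) (e.eval s)) l T Q) :
    Hoare (.seq (.setReal a i e) q) s l (i.cost + e.cost + 1 + T) Q :=
  (Hoare.setReal (Q := fun s' => s' = s.writeReal a (i.eval s) (e.eval s)) rfl).seq (l' := l)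
    (by rintro s' rfl; exact h)

theorem Hoare.cond {b : BExp} {p q : Prog} {s : State} {l : List Bool} {T : ℕ}
    {Q : State → Prop} (h : b.Holds s → Hoare p s l T Q) (h' : ¬ b.Holds s → Hoare q s l T Q) :
    Hoare (.cond b p q) s l (b.cost + T + 1) Q := by
  by_cases hb : b.Holds s
  · obtain ⟨s', hr, hq⟩ := h hb
    refine ⟨s', fun ω => ?_, hq⟩
    obtain ⟨t, ht, he⟩ := hr ω
    exact ⟨_, by omega, .cond_true (by simpa using hb) he⟩
  · obtain ⟨s', hr, hq⟩ := h' hb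
    refine ⟨s', fun ω => ?_, hq⟩
    obtain ⟨t, ht, he⟩ := hr ω
    exact ⟨_, by omega, .cond_false (by simpa using hb) he⟩

theorem Hoare.loop_false {b : BExp} {p : Prog} {s : State} {Q : State → Prop}
    (hb : ¬ b.Holds s) (h : Q s) : Hoare (.loop b p) s [] (b.cost + 1) Q :=
  ⟨s, fun ω => ⟨_, le_rfl, .loop_false (by simpa [prependCoins] using hb)⟩, h⟩

theorem Hoare.loop_true {b : BExp} {p : Prog} {s : State} {l : List Bool} {T : ℕ}
    {Q : State → Prop} (hb : b.Holds s) (h : Hoare (.seq p (.loop b p)) s l T Q) :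
    Hoare (.loop b p) s l (b.cost + 1 + T) Q := by
  obtain ⟨s', hr, hq⟩ := h
  refine ⟨s', fun ω => ?_, hq⟩
  obtain ⟨t, ht, he⟩ := hr ω
  cases he with
  | seq h₁ h₂ => exact ⟨_, by omega, .loop_true (by simpa using hb) h₁ h₂⟩

/-- Whatever the coins show, `p` uses `B` coins and at most `T` steps, and then `Q` holds. -/
def All (p : Prog) (s : State) (T B : ℕ) (Q : State → Prop) : Prop :=
  ∀ l : List Bool, l.length = B → Hoare p s l T Q

/-- With probability at least `q`, `p` uses `B` coins and at most `T` steps, and then `Q`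
holds. -/
def Luck (p : Prog) (s : State) (T B : ℕ) (q : ℝ) (Q : State → Prop) : Prop :=
  q ≤ bitProb B fun l => Hoare p s l T Q

theorem Hoare.all {p : Prog} {s : State} {T : ℕ} {Q : State → Prop} (h : Hoare p s [] T Q) :
    All p s T 0 Q := by
  intro l hl
  rwa [List.length_eq_zero_iff.1 hl]

theorem All.hoare {p : Prog} {s : State} {T : ℕ} {Q : State → Prop} (h : All p s T 0 Q) :
    Hoare p s [] T Q := h [] rfl

theorem All.luck {p : Prog} {s : State} {T B : ℕ} {Q : State → Prop} (h : All p s T B Q) :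
    Luck p s T B 1 Q := (bitProb_eq_one h).ge

theorem All.mono {p : Prog} {s : State} {T T' B : ℕ} {Q Q' : State → Prop}
    (h : All p s T B Q) (hT : T ≤ T') (hQ : ∀ s', Q s' → Q' s') : All p s T' B Q' :=
  fun l hl => (h l hl).mono hT hQ

theorem Luck.mono {p : Prog} {s : State} {T T' B : ℕ} {q q' : ℝ} {Q Q' : State → Prop}
    (h : Luck p s T B q Q) (hT : T ≤ T') (hq : q' ≤ q) (hQ : ∀ s', Q s' → Q' s') :
    Luck p s T' B q' Q' :=
  hq.trans (h.trans (bitProb_mono fun _ _ hl => hl.mono hT hQ))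

theorem All.frame {p : Prog} {s : State} {T B : ℕ} {Q : State → Prop} (h : All p s T B Q) :
    All p s T B (fun s' => Q s' ∧ Frame p s s') := fun l hl => (h l hl).frame

theorem Luck.and_all {p : Prog} {s : State} {T B : ℕ} {q : ℝ} {Q Q' : State → Prop}
    (h : Luck p s T B q Q) (h' : All p s T B Q') (hc : ∀ s s', Q' s → s.nat = s'.nat →
      s.real = s'.real → Q' s') : Luck p s T B q (fun s' => Q s' ∧ Q' s') :=
  h.trans (bitProb_mono fun l hl hh => hh.and (h' l hl) hc)

theorem All.seq {p p' : Prog} {s : State} {T T' B B' : ℕ} {Q Q' : State → Prop}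
    (h : All p s T B Q) (h' : ∀ s', Q s' → Frame p s s' → All p' s' T' B' Q') :
    All (.seq p p') s (T + T') (B + B') Q' := by
  intro l hl
  have e : l = l.take B ++ l.drop B := (List.take_append_drop _ _).symm
  rw [e]
  refine (h.frame _ (by simp; omega)).seq fun s' hs' => h' s' hs'.1 hs'.2 _ (by simp; omega)

/-- The first block consumes exactly `B` coins, so the second one sees fresh coins and the
probabilities multiply. -/
theorem Luck.seq {p p' : Prog} {s : State} {T T' B B' : ℕ} {q q' : ℝ} {Q Q' : State → Prop}
    (hq' : 0 ≤ q') (h : Luck p s T B q Q)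
    (h' : ∀ s', Q s' → Frame p s s' → Luck p' s' T' B' q' Q') :
    Luck (.seq p p') s (T + T') (B + B') (q * q') Q' := by
  have := le_bitProb_add (B₁ := B) (B₂ := B') (A₁ := fun l => Hoare p s l T Q)
    (A := fun l => Hoare (.seq p p') s l (T + T') Q') (a := q') (b := 0)
    (by
      rintro l - hl
      obtain ⟨s', hr, hQ, hF⟩ := hl.frame
      refine (h' s' hQ hF).trans (bitProb_mono fun l' _ hl' => ?_)
      exact Hoare.seq (Q := fun t => t = s') ⟨s', hr, rfl⟩ (by rintro _ rfl; exact hl'))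
    (fun _ _ => bitProb_nonneg _ _)
  refine le_trans ?_ this
  have : q * q' ≤ bitProb B (fun l => Hoare p s l T Q) * q' := mul_le_mul_of_nonneg_right h hq'
  linarith

/-- Sequential composition in which the second part may make up for a failure of the first. -/
theorem Luck.seq_or {p p' : Prog} {s : State} {T T' B B' : ℕ} {q a b : ℝ} {Q I Q' : State → Prop}
    (hab : b ≤ a) (hI : All p s T B I) (h : Luck p s T B q Q)
    (ha : ∀ s', Q s' → Frame p s s' → Luck p' s' T' B' a Q')
    (hb : ∀ s', I s' → Frame p s s' → Luck p' s' T' B' b Q') :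
    Luck (.seq p p') s (T + T') (B + B') (q * a + (1 - q) * b) Q' := by
  have := le_bitProb_add (B₁ := B) (B₂ := B') (A₁ := fun l => Hoare p s l T Q)
    (A := fun l => Hoare (.seq p p') s l (T + T') Q') (a := a) (b := b)
    (by
      rintro l - hl
      obtain ⟨s', hr, hQ, hF⟩ := hl.frame
      refine (ha s' hQ hF).trans (bitProb_mono fun l' _ hl' => ?_)
      exact Hoare.seq (Q := fun t => t = s') ⟨s', hr, rfl⟩ (by rintro _ rfl; exact hl'))
    (by
      intro l hlen
      obtain ⟨s', hr, hQ, hF⟩ := (hI l hlen).frame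
      refine (hb s' hQ hF).trans (bitProb_mono fun l' _ hl' => ?_)
      exact Hoare.seq (Q := fun t => t = s') ⟨s', hr, rfl⟩ (by rintro _ rfl; exact hl'))
  refine le_trans ?_ this
  have : q * (a - b) ≤ bitProb B (fun l => Hoare p s l T Q) * (a - b) :=
    mul_le_mul_of_nonneg_right h (by linarith)
  linarith

/-! ### Bounded loops -/

/-- `for i := 0, …, N - 1 do p`, where `N` is read from cell `c` of the integer array `a`, and
cell `0` of the integer array `i` is the counter. -/
def forLoop (i a c : ℕ) (p : Prog) : Prog :=
  .seq (.setNat i (.lit 0) (.lit 0))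
    (.loop (.natLt (.get i (.lit 0)) (.get a (.lit c)))
      (.seq p (.setNat i (.lit 0) (.add (.get i (.lit 0)) (.lit 1)))))

theorem Frame.refl (p : Prog) (s : State) : Frame p s s := ⟨fun _ _ => rfl, fun _ _ => rfl⟩

theorem Frame.trans_forLoop {i a c : ℕ} {p : Prog} {s s₁ s₂ : State} {v : ℕ}
    (h : Frame (forLoop i a c p) s s₁) (h' : Frame p s₁ s₂) :
    Frame (forLoop i a c p) s (s₂.writeNat i 0 v) := by
  constructor
  · intro b hb
    have hb' := hb
    simp only [forLoop, Prog.writesNat, Bool.or_eq_false_iff, beq_eq_false_iff_ne] at hb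
    rw [State.writeNat_nat_of_ne _ (Ne.symm hb.1), h'.nat b hb.2.1, h.nat b hb']
  · intro b hb
    have hb' := hb
    simp only [forLoop, Prog.writesReal, Bool.or_eq_false_iff] at hb
    rw [State.writeNat_real, h'.real b hb.2.1, h.real b hb']

theorem forLoop_frame_start (i a c : ℕ) (p : Prog) (s : State) :
    Frame (forLoop i a c p) s (s.writeNat i 0 0) := by
  constructor
  · intro b hb
    simp only [forLoop, Prog.writesNat, Bool.or_eq_false_iff, beq_eq_false_iff_ne] at hb
    exact State.writeNat_nat_of_ne _ (Ne.symm hb.1)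
  · intro b _
    rfl

section forLoop

variable {i a c : ℕ} {p : Prog} {s : State} {N T B : ℕ} {I : ℕ → State → Prop}

/-- Besides the body, a round costs 6 steps for the test and 6 for the increment. The initialization
(3) and the failing test (6) make up the 9. By `hi` the body leaves the counter alone, and by `ha`
the bound stays fixed. -/
theorem All.forLoop (hi : p.writesNat i = false) (ha : (forLoop i a c p).writesNat a = false)
    (hN : s.nat a c = N) (h0 : I 0 (s.writeNat i 0 0))
    (hs : ∀ m s', m < N → I m s' → s'.nat i 0 = m → Frame (forLoop i a c p) s s' →
      All p s' T B (fun s'' => I (m + 1) (s''.writeNat i 0 (m + 1)))) :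
    All (forLoop i a c p) s (N * (T + 12) + 9) (N * B) (I N) := by
  have key : ∀ r m s', m + r = N → I m s' → s'.nat i 0 = m → Frame (RealRAM.forLoop i a c p) s s' →
      All (.loop (.natLt (.get i (.lit 0)) (.get a (.lit c)))
        (.seq p (.setNat i (.lit 0) (.add (.get i (.lit 0)) (.lit 1))))) s' (r * (T + 12) + 6)
        (r * B) (I N) := by
    intro r
    induction r with
    | zero =>
      intro m s' hm hI hc hF
      have e : m = N := by omega
      subst e
      rw [Nat.zero_mul, Nat.zero_mul]
      refine Hoare.all (Hoare.loop_false ?_ hI)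
      simp [BExp.Holds, NExp.eval, hc, hF.nat a ha, hN]
    | succ r ih =>
      intro m s' hm hI hc hF
      have hb : (BExp.natLt (.get i (.lit 0)) (.get a (.lit c))).Holds s' := by
        simp only [BExp.Holds, NExp.eval, hc, hF.nat a ha, hN]
        omega
      have step := All.seq (All.seq (p' := .setNat i (.lit 0) (.add (.get i (.lit 0)) (.lit 1)))
        (T' := 6) (B' := 0)
        (Q' := fun s'' => I (m + 1) s'' ∧ s''.nat i 0 = m + 1 ∧
          Frame (RealRAM.forLoop i a c p) s s'')
        (hs m s' (by omega) hI hc hF) fun s₁ hs₁ hF₁ => Hoare.all (Hoare.setNat (by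
          have : s₁.nat i 0 = m := by rw [hF₁.nat i hi, hc]
          simp only [NExp.eval, this]
          exact ⟨hs₁, by simp, hF.trans_forLoop hF₁⟩)))
        (fun s₁ hs₁ _ => ih (m + 1) s₁ (by omega) hs₁.1 hs₁.2.1 hs₁.2.2)
      intro l hl
      refine (Hoare.loop_true hb (step l (by rw [hl, Nat.succ_mul]; omega))).mono ?_ fun _ h => h
      simp only [BExp.cost, NExp.cost, Nat.succ_mul]
      omega
  have := All.seq (p := .setNat i (.lit 0) (.lit 0)) (B := 0) (T := 3)
    (Q := fun s' => s' = s.writeNat i 0 0)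
    (Hoare.all (Hoare.setNat rfl)) (fun s' hs' _ => by
      subst hs'
      exact key N 0 _ (by omega) h0 (by simp) (forLoop_frame_start i a c p s))
  rw [Nat.zero_add] at this
  exact this.mono (by omega) fun _ h => h

theorem Luck.forLoop {q : ℝ} (hq : 0 ≤ q) (hi : p.writesNat i = false)
    (ha : (forLoop i a c p).writesNat a = false)
    (hN : s.nat a c = N) (h0 : I 0 (s.writeNat i 0 0))
    (hs : ∀ m s', m < N → I m s' → s'.nat i 0 = m → Frame (forLoop i a c p) s s' →
      Luck p s' T B q (fun s'' => I (m + 1) (s''.writeNat i 0 (m + 1)))) :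
    Luck (forLoop i a c p) s (N * (T + 12) + 9) (N * B) (q ^ N) (I N) := by
  have key : ∀ r m s', m + r = N → I m s' → s'.nat i 0 = m → Frame (RealRAM.forLoop i a c p) s s' →
      Luck (.loop (.natLt (.get i (.lit 0)) (.get a (.lit c)))
        (.seq p (.setNat i (.lit 0) (.add (.get i (.lit 0)) (.lit 1))))) s' (r * (T + 12) + 6)
        (r * B) (q ^ r) (I N) := by
    intro r
    induction r with
    | zero =>
      intro m s' hm hI hc hF
      have e : m = N := by omega
      subst e
      rw [Nat.zero_mul, Nat.zero_mul, pow_zero]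
      refine All.luck (Hoare.all (Hoare.loop_false ?_ hI))
      simp [BExp.Holds, NExp.eval, hc, hF.nat a ha, hN]
    | succ r ih =>
      intro m s' hm hI hc hF
      have hb : (BExp.natLt (.get i (.lit 0)) (.get a (.lit c))).Holds s' := by
        simp only [BExp.Holds, NExp.eval, hc, hF.nat a ha, hN]
        omega
      have step := Luck.seq (pow_nonneg hq r) (Luck.seq zero_le_one
        (p' := .setNat i (.lit 0) (.add (.get i (.lit 0)) (.lit 1)))
        (T' := 6) (B' := 0)
        (Q' := fun s'' => I (m + 1) s'' ∧ s''.nat i 0 = m + 1 ∧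
          Frame (RealRAM.forLoop i a c p) s s'')
        (hs m s' (by omega) hI hc hF) fun s₁ hs₁ hF₁ => All.luck (Hoare.all (Hoare.setNat (by
          have : s₁.nat i 0 = m := by rw [hF₁.nat i hi, hc]
          simp only [NExp.eval, this]
          exact ⟨hs₁, by simp, hF.trans_forLoop hF₁⟩))))
        (fun s₁ hs₁ _ => ih (m + 1) s₁ (by omega) hs₁.1 hs₁.2.1 hs₁.2.2)
      have eB : B + 0 + r * B = (r + 1) * B := by ring
      have eq : q * 1 * q ^ r = q ^ (r + 1) := by ring
      rw [eB, eq] at step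
      refine step.trans (bitProb_mono fun l _ hl => ?_)
      refine (Hoare.loop_true hb hl).mono ?_ fun _ h => h
      simp only [BExp.cost, NExp.cost, Nat.succ_mul]
      omega
  have := Luck.seq (pow_nonneg hq N) (p := .setNat i (.lit 0) (.lit 0)) (B := 0) (T := 3)
    (Q := fun s' => s' = s.writeNat i 0 0)
    (All.luck (Hoare.all (Hoare.setNat rfl))) (fun s' hs' _ => by
      subst hs'
      exact key N 0 _ (by omega) h0 (by simp) (forLoop_frame_start i a c p s))
  rw [Nat.zero_add] at this
  exact this.mono (by omega) (by simp) fun _ h => h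

/-- Independent repetitions: each round reaches the goal `G` with probability at least `q`. -/
theorem Luck.forLoop_repeat {q : ℝ} {G : State → Prop} (hq : 0 ≤ q) (hq1 : q ≤ 1)
    (hi : p.writesNat i = false)
    (ha : (RealRAM.forLoop i a c p).writesNat a = false)
    (hN : s.nat a c = N) (h0 : I 0 (s.writeNat i 0 0))
    (hG : ∀ s' v, G s' → G (s'.writeNat i 0 v))
    (hs : ∀ m s', m < N → I m s' → s'.nat i 0 = m → Frame (RealRAM.forLoop i a c p) s s' →
      All p s' T B (fun s'' => I (m + 1) (s''.writeNat i 0 (m + 1)) ∧ (G s' → G s'')) ∧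
      Luck p s' T B q (fun s'' => I (m + 1) (s''.writeNat i 0 (m + 1)) ∧ G s'')) :
    Luck (RealRAM.forLoop i a c p) s (N * (T + 12) + 9) (N * B) (1 - (1 - q) ^ N) G := by
  -- One induction carries two claims: the chance of reaching the goal in the remaining rounds, and
  -- that a goal already reached is kept with probability one. The second supplies `a = 1` in
  -- `Luck.seq_or`.
  have key : ∀ r m s', m + r = N → I m s' → s'.nat i 0 = m → Frame (RealRAM.forLoop i a c p) s s' →
      Luck (.loop (.natLt (.get i (.lit 0)) (.get a (.lit c)))
        (.seq p (.setNat i (.lit 0) (.add (.get i (.lit 0)) (.lit 1))))) s' (r * (T + 12) + 6)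
        (r * B) (1 - (1 - q) ^ r) G ∧ (G s' →
      Luck (.loop (.natLt (.get i (.lit 0)) (.get a (.lit c)))
        (.seq p (.setNat i (.lit 0) (.add (.get i (.lit 0)) (.lit 1))))) s' (r * (T + 12) + 6)
        (r * B) 1 G) := by
    intro r
    induction r with
    | zero =>
      intro m s' hm hI hc hF
      have e : m = N := by omega
      subst e
      rw [Nat.zero_mul, Nat.zero_mul, pow_zero, sub_self]
      refine ⟨bitProb_nonneg _ _, fun hGs => All.luck (Hoare.all (Hoare.loop_false ?_ hGs))⟩
      simp [BExp.Holds, NExp.eval, hc, hF.nat a ha, hN]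
    | succ r ih =>
      intro m s' hm hI hc hF
      have hb : (BExp.natLt (.get i (.lit 0)) (.get a (.lit c))).Holds s' := by
        simp only [BExp.Holds, NExp.eval, hc, hF.nat a ha, hN]
        omega
      obtain ⟨hA, hL⟩ := hs m s' (by omega) hI hc hF
      have inc : ∀ s₁, Frame p s' s₁ → I (m + 1) (s₁.writeNat i 0 (m + 1)) →
          Hoare (.setNat i (.lit 0) (.add (.get i (.lit 0)) (.lit 1))) s₁ [] 6
            (fun s'' => I (m + 1) s'' ∧ s''.nat i 0 = m + 1 ∧
              Frame (RealRAM.forLoop i a c p) s s'' ∧ (G s₁ → G s'')) := by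
        intro s₁ hF₁ hs₁
        refine Hoare.setNat ?_
        have : s₁.nat i 0 = m := by rw [hF₁.nat i hi, hc]
        simp only [NExp.eval, this]
        exact ⟨hs₁, by simp, hF.trans_forLoop hF₁, hG _ _⟩
      have hA' := All.seq hA fun s₁ hs₁ hF₁ => ((inc s₁ hF₁ hs₁.1).mono (le_refl 6)
        (Q' := fun s'' => I (m + 1) s'' ∧ s''.nat i 0 = m + 1 ∧
              Frame (RealRAM.forLoop i a c p) s s'' ∧ (G s' → G s''))
        fun s₂ hs₂ => ⟨hs₂.1, hs₂.2.1, hs₂.2.2.1, fun h => hs₂.2.2.2 (hs₁.2 h)⟩).all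
      have hL' := Luck.seq zero_le_one hL fun s₁ hs₁ hF₁ => ((inc s₁ hF₁ hs₁.1).mono (le_refl 6)
        (Q' := fun s'' => I (m + 1) s'' ∧ s''.nat i 0 = m + 1 ∧
              Frame (RealRAM.forLoop i a c p) s s'' ∧ G s'')
        fun s₂ hs₂ => ⟨hs₂.1, hs₂.2.1, hs₂.2.2.1, hs₂.2.2.2 hs₁.2⟩).all.luck
      have eB : B + 0 + r * B = (r + 1) * B := by ring
      have hpow : (1 - q) ^ r ≤ 1 := pow_le_one₀ (by linarith) (by linarith)
      constructor
      · have step := Luck.seq_or (a := 1) (b := 1 - (1 - q) ^ r)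
          (by have : 0 ≤ (1 - q) ^ r := pow_nonneg (by linarith) r
              linarith) hA' hL'
          (fun s₁ hs₁ _ => (ih (m + 1) s₁ (by omega) hs₁.1 hs₁.2.1 hs₁.2.2.1).2 hs₁.2.2.2)
          (fun s₁ hs₁ _ => (ih (m + 1) s₁ (by omega) hs₁.1 hs₁.2.1 hs₁.2.2.1).1)
        have eq : q * 1 * 1 + (1 - q * 1) * (1 - (1 - q) ^ r) = 1 - (1 - q) ^ (r + 1) := by ring
        rw [eB, eq] at step
        refine step.trans (bitProb_mono fun l _ hl => ?_)
        refine (Hoare.loop_true hb hl).mono ?_ fun _ h => h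
        simp only [BExp.cost, NExp.cost, Nat.succ_mul]
        omega
      · intro hGs
        have step := Luck.seq zero_le_one hA'.luck
          (fun s₁ hs₁ _ => (ih (m + 1) s₁ (by omega) hs₁.1 hs₁.2.1 hs₁.2.2.1).2 (hs₁.2.2.2 hGs))
        rw [eB, one_mul] at step
        refine step.trans (bitProb_mono fun l _ hl => ?_)
        refine (Hoare.loop_true hb hl).mono ?_ fun _ h => h
        simp only [BExp.cost, NExp.cost, Nat.succ_mul]
        omega
  have := Luck.seq (q := 1) (q' := 1 - (1 - q) ^ N)
    (by have := pow_le_one₀ (n := N) (a := 1 - q) (by linarith) (by linarith); linarith)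
    (p := .setNat i (.lit 0) (.lit 0)) (B := 0) (T := 3)
    (Q := fun s' => s' = s.writeNat i 0 0)
    (All.luck (Hoare.all (Hoare.setNat rfl))) (fun s' hs' _ => by
      subst hs'
      exact (key N 0 _ (by omega) h0 (by simp) (forLoop_frame_start i a c p s)).1)
  rw [Nat.zero_add] at this
  exact this.mono (by omega) (by simp) fun _ h => h

theorem Hoare.forLoop (hi : p.writesNat i = false) (ha : (RealRAM.forLoop i a c p).writesNat a = false)
    (hN : s.nat a c = N) (h0 : I 0 (s.writeNat i 0 0))
    (hs : ∀ m s', m < N → I m s' → s'.nat i 0 = m → Frame (RealRAM.forLoop i a c p) s s' →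
      Hoare p s' [] T (fun s'' => I (m + 1) (s''.writeNat i 0 (m + 1)))) :
    Hoare (RealRAM.forLoop i a c p) s [] (N * (T + 12) + 9) (I N) := by
  have := All.forLoop (B := 0) hi ha hN h0 fun m s' hm hI hc hF => (hs m s' hm hI hc hF).all
  exact this.hoare

end forLoop

end RealRAM

/-! ## Growing a pool of points -/

namespace MinLoad

open Metric

section Geometry

/-- A step of length proportional to the gap towards a point that is nearer to `q` than to `c`
decreases the distance to `q`. -/
theorem exists_grid_step {V : Type*} [NormedAddCommGroup V] [InnerProductSpace ℝ V] {c q y : V} {γ : ℝ} {N : ℕ} (hγ : 0 < γ)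
    (hgap : γ ≤ dist y c - dist y q) (hN : dist y c ≤ N * γ / 2) :
    ∃ a < N, dist (c + ((a : ℝ) / N) • (y - c)) q ^ 2 ≤ dist c q ^ 2 - 3 * γ ^ 2 / 16 := by
  set A := dist y c with hA
  have hb : 0 ≤ dist y q := dist_nonneg
  have hA0 : 0 < A := by linarith
  have hN0 : (0 : ℝ) < N := by
    by_contra h
    have : (N : ℝ) * γ ≤ 0 := mul_nonpos_of_nonpos_of_nonneg (not_lt.1 h) hγ.le
    linarith
  have hpos : 0 ≤ N * γ / (4 * A) := by positivity
  -- The moved length `a / N * A` shall lie between `γ / 4` and `3 * γ / 4`: the ceiling overshoots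
  -- by at most one grid step `A / N`, which is at most `γ / 2` by `hN`.
  set a := ⌈N * γ / (4 * A)⌉₊ with ha
  have ha1 : N * γ / (4 * A) ≤ a := Nat.le_ceil _
  have ha2 : (a : ℝ) < N * γ / (4 * A) + 1 := Nat.ceil_lt_add_one hpos
  have e : N * γ / (4 * A) * A / N = γ / 4 := by field_simp
  have l1 : γ / 4 ≤ (a : ℝ) / N * A := by
    rw [← e, div_mul_eq_mul_div (a : ℝ) (N : ℝ) A]
    exact div_le_div_of_nonneg_right (mul_le_mul_of_nonneg_right ha1 hA0.le) hN0.le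
  have l2 : (a : ℝ) / N * A ≤ 3 * γ / 4 := by
    have : (a : ℝ) / N * A ≤ (N * γ / (4 * A) + 1) * A / N := by
      rw [div_mul_eq_mul_div]
      gcongr
    have e2 : (N * γ / (4 * A) + 1) * A / N = γ / 4 + A / N := by rw [← e]; ring
    have : A / N ≤ γ / 2 := by rw [div_le_iff₀ hN0]; linarith
    linarith
  refine ⟨a, ?_, ?_⟩
  · have h1 : (a : ℝ) / N < 1 := by
      by_contra h
      have : 1 * A ≤ (a : ℝ) / N * A := mul_le_mul_of_nonneg_right (not_lt.1 h) hA0.le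
      linarith
    rw [div_lt_one hN0] at h1
    exact_mod_cast h1
  · set lam := (a : ℝ) / N with hlam
    have hl0 : 0 ≤ lam := by positivity
    have n1 : dist (c + lam • (y - c)) q ^ 2
        = dist c q ^ 2 + 2 * lam * inner ℝ (c - q) (y - c) + lam ^ 2 * A ^ 2 := by
      rw [dist_eq_norm, show c + lam • (y - c) - q = (c - q) + lam • (y - c) by abel,
        norm_add_sq_real, inner_smul_right, norm_smul, hA, dist_eq_norm, dist_eq_norm,
        Real.norm_of_nonneg hl0]
      ring
    have n2 : dist y q ^ 2 = dist c q ^ 2 + 2 * inner ℝ (c - q) (y - c) + A ^ 2 := by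
      rw [dist_eq_norm, show y - q = (c - q) + (y - c) by abel, norm_add_sq_real, hA,
        dist_eq_norm, dist_eq_norm]
    -- Factor the right side as `(A - dist y q) * (A + dist y q)`. With `n1` and `n2`, the squared
    -- distance then changes by at most `t * (t - γ)` for the moved length `t = lam * A`, and this
    -- is at most `-3 * γ ^ 2 / 16` on the window above.
    have n3 : γ * A ≤ A ^ 2 - dist y q ^ 2 := by nlinarith
    have n4 : 2 * inner ℝ (c - q) (y - c) ≤ -(γ * A) := by nlinarith [sq_nonneg (dist c q)]
    have n5 : lam * (2 * inner ℝ (c - q) (y - c)) ≤ lam * (-(γ * A)) :=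
      mul_le_mul_of_nonneg_left n4 hl0
    rw [n1]
    nlinarith

variable {V : Type*} [NormedAddCommGroup V]

/-- If `c` is a bad center, then many points are notably nearer to `q` than to `c`, and not too
far from `q`. -/
theorem card_gap_points {O : Finset V} {c q : V} {M e μ : ℝ} (he : 0 < e) (hμ : 0 < μ)
    (hm : O.card * μ = M) (hq : ∑ x ∈ O, dist x q ≤ M) (hc : (1 + e) * M < ∑ x ∈ O, dist x c)
    (hcq : dist c q ≤ 6 * μ) :
    e * O.card ≤ 24 *
      (O.filter fun y => e * μ / 2 ≤ dist y c - dist y q ∧ dist y q ≤ 24 * μ / e).card := by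
  classical
  set G := O.filter fun y => e * μ / 2 ≤ dist y c - dist y q ∧ dist y q ≤ 24 * μ / e with hG
  -- Outside `G` either the gap is below `e * μ / 2`, or `y` is so far from `q` that the
  -- displacement `6 * μ` is at most `e / 4 * dist y q`. After summation an excess of more than `e *
  -- M` is bounded by `6 * μ * G.card + e * M / 2 + e * M / 4`, so `G` cannot be small.
  have key : ∀ y ∈ O, dist y c ≤
      dist y q + (if y ∈ G then 6 * μ else 0) + e * μ / 2 + e / 4 * dist y q := by
    intro y hy
    have h1 : dist y c ≤ dist y q + dist c q := by
      rw [dist_comm c q]; exact dist_triangle y q c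
    have h0 : 0 ≤ dist y q := dist_nonneg
    have h3 : 0 ≤ e / 4 * dist y q := by positivity
    have h4 : 0 ≤ e * μ / 2 := by positivity
    split_ifs with hyG
    · linarith
    · have : dist y c - dist y q < e * μ / 2 ∨ 24 * μ / e < dist y q := by
        by_contra hcon
        push Not at hcon
        exact hyG (Finset.mem_filter.2 ⟨hy, hcon⟩)
      rcases this with h | h
      · linarith
      · rw [div_lt_iff₀ he] at h
        nlinarith
  have := Finset.sum_le_sum key
  simp only [Finset.sum_add_distrib, ← Finset.mul_sum, Finset.sum_const, nsmul_eq_mul] at this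
  rw [← Finset.sum_filter, Finset.sum_const, nsmul_eq_mul] at this
  have hf : O.filter (fun y => y ∈ G) = G := by
    ext y; simp [hG]
  rw [hf] at this
  have h5 : e / 4 * ∑ x ∈ O, dist x q ≤ e / 4 * M := by gcongr
  have h6 : (O.card : ℝ) * (e * μ / 2) = e * M / 2 := by rw [← hm]; ring
  rw [h6] at this
  have h7 : e * M / 4 ≤ G.card * (6 * μ) := by linarith
  rw [← hm] at h7
  have : e * (O.card : ℝ) * μ ≤ 24 * G.card * μ := by linarith
  exact le_of_mul_le_mul_right this hμ

theorem exists_dist_eq_infDist {C : Set V} (hC : C.Finite) (hne : C.Nonempty) (x : V) :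
    ∃ y ∈ C, infDist x C = dist x y :=
  hC.isCompact.exists_infDist_eq_dist hne x

/-- The points near the median of a cluster that is badly served by `C` carry a large part of the
distances to `C`, and each of them serves the cluster well. -/
theorem uncovered_cluster {O : Finset V} {q : V} {M : ℝ} {C : Set V}
    (hM : 0 ≤ M) (hq : ∑ x ∈ O, dist x q ≤ M) (hu : 5 * M < ∑ x ∈ O, infDist x C) :
    ∃ G ⊆ O, ∑ x ∈ O, infDist x C ≤ 5 * ∑ x ∈ G, infDist x C ∧
      ∀ y ∈ G, ∑ x ∈ O, infDist x (insert y C) ≤ 5 * M := by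
  classical
  -- The points within twice the average distance bound `M / O.card` of `q`, written without a
  -- division.
  set G := O.filter fun x => dist x q * O.card ≤ 2 * M with hG
  refine ⟨G, Finset.filter_subset _ _, ?_, ?_⟩
  · have hcard : (O.card : ℝ) ≤ 2 * G.card := by
      by_contra hlt
      push Not at hlt
      set G' := O.filter fun x => ¬ dist x q * O.card ≤ 2 * M with hG'
      have hc : G.card + G'.card = O.card := Finset.card_filter_add_card_filter_not _
      have hc' : (G.card : ℝ) + G'.card = O.card := by exact_mod_cast hc
      have hG'ne : G'.Nonempty := by
        rw [← Finset.card_pos]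
        have : (0 : ℝ) < G'.card := by
          have : (0 : ℝ) ≤ G.card := by positivity
          linarith
        exact_mod_cast this
      have h1 : ∑ x ∈ G', 2 * M < ∑ x ∈ G', dist x q * O.card :=
        Finset.sum_lt_sum_of_nonempty hG'ne fun x hx => not_le.1 (Finset.mem_filter.1 hx).2
      have h2 : ∑ x ∈ G', dist x q ≤ ∑ x ∈ O, dist x q :=
        Finset.sum_le_sum_of_subset_of_nonneg (Finset.filter_subset _ _)
          fun _ _ _ => dist_nonneg
      rw [Finset.sum_const, nsmul_eq_mul, ← Finset.sum_mul] at h1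
      have h3 : (∑ x ∈ G', dist x q) * O.card ≤ M * O.card := by gcongr; linarith
      nlinarith
    have h1 : ∑ x ∈ O, infDist x C ≤ O.card * infDist q C + M := by
      have : ∑ x ∈ O, infDist x C ≤ ∑ x ∈ O, (infDist q C + dist x q) :=
        Finset.sum_le_sum fun x _ => infDist_le_infDist_add_dist
      rw [Finset.sum_add_distrib, Finset.sum_const, nsmul_eq_mul] at this
      linarith
    have h2 : G.card * infDist q C - M ≤ ∑ x ∈ G, infDist x C := by
      have : ∑ x ∈ G, (infDist q C - dist x q) ≤ ∑ x ∈ G, infDist x C := by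
        refine Finset.sum_le_sum fun x _ => ?_
        have := infDist_le_infDist_add_dist (x := q) (y := x) (s := C)
        rw [dist_comm] at this
        linarith
      rw [Finset.sum_sub_distrib, Finset.sum_const, nsmul_eq_mul] at this
      have h3 : ∑ x ∈ G, dist x q ≤ ∑ x ∈ O, dist x q :=
        Finset.sum_le_sum_of_subset_of_nonneg (Finset.filter_subset _ _)
          fun _ _ _ => dist_nonneg
      linarith
    have h3 : (O.card : ℝ) * infDist q C ≤ 2 * G.card * infDist q C := by
      have := infDist_nonneg (x := q) (s := C)
      gcongr
    linarith
  · intro y hy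
    have hy2 := (Finset.mem_filter.1 hy).2
    have : ∑ x ∈ O, infDist x (insert y C) ≤ ∑ x ∈ O, (dist x q + dist y q) := by
      refine Finset.sum_le_sum fun x _ => ?_
      refine (infDist_le_dist_of_mem (Set.mem_insert y C)).trans ?_
      rw [dist_comm y q]
      exact dist_triangle x q y
    rw [Finset.sum_add_distrib, Finset.sum_const, nsmul_eq_mul] at this
    linarith

/-- The points that can be reached from points of `C` in `j` steps, each of which leads a fraction
`a / N` of the way towards a point of `C`. -/
def reach [InnerProductSpace ℝ V] (N : ℕ) (C : Set V) : ℕ → Set V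
  | 0 => C
  | j + 1 => {z | ∃ c ∈ reach N C j, ∃ y ∈ C, ∃ a < N, z = c + ((a : ℝ) / N) • (y - c)}

theorem reach_mono [InnerProductSpace ℝ V] {N : ℕ} {C C' : Set V} (h : C ⊆ C') (j : ℕ) : reach N C j ⊆ reach N C' j := by
  induction j with
  | zero => exact h
  | succ j ih =>
    rintro z ⟨c, hc, y, hy, a, ha, rfl⟩
    exact ⟨c, ih hc, y, h hy, a, ha, rfl⟩

theorem reach_subset [InnerProductSpace ℝ V] {N : ℕ} (hN : 0 < N) {C : Set V} (hne : C.Nonempty) {i j : ℕ} (hij : i ≤ j) :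
    reach N C i ⊆ reach N C j := by
  induction hij with
  | refl => exact subset_rfl
  | step _ ih =>
    intro z hz
    obtain ⟨y, hy⟩ := hne
    -- A step with fraction 0 stays put.
    exact ⟨z, ih hz, y, hy, 0, hN, by simp⟩

end Geometry

/-! ### A potential that measures how good a pool is -/

/-- The clusters `O i` with centers `q i` of cost at most `M`. -/
structure Clusters (V : Type*) [NormedAddCommGroup V] [InnerProductSpace ℝ V] (k : ℕ) where
  /-- the clusters -/
  O : Fin k → Finset V
  /-- their centers -/
  q : Fin k → V
  /-- the largest cost of a cluster -/
  M : ℝ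
  nonneg : 0 ≤ M
  cost_le : ∀ i, ∑ x ∈ O i, dist x (q i) ≤ M
  exists_pair : 0 < M → ∃ i, ∃ x ∈ O i, ∃ y ∈ O i, x ≠ y

namespace Clusters

variable {V : Type*} [NormedAddCommGroup V] [InnerProductSpace ℝ V] {k : ℕ}
  (K : Clusters V k) (N J : ℕ) (e : ℝ)

/-- The average distance of a cluster of cost `M`. -/
noncomputable def mu (i : Fin k) : ℝ := K.M / (K.O i).card

/-- The cluster `i` is served by `C` up to a constant factor. -/
def Covered (C : Set V) (i : Fin k) : Prop := ∑ x ∈ K.O i, infDist x C ≤ 5 * K.M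

/-- Some point that can be reached in `j` steps is within the distance from the center of the
cluster `i` that is expected after `j` steps. -/
def LevelOK (C : Set V) (i : Fin k) (j : ℕ) : Prop :=
  j = 0 ∨ ∃ c ∈ reach N C j,
    dist c (K.q i) ^ 2 ≤ 36 * K.mu i ^ 2 - j * (3 * e ^ 2 * K.mu i ^ 2 / 256)

/-- Some point that can be reached is a good center of the cluster `i`. -/
def Served (C : Set V) (i : Fin k) : Prop :=
  ∃ c ∈ reach N C J, ∑ x ∈ K.O i, dist x c ≤ (1 + e) * K.M

/-- Some pair of distinct points of `C` has a distance that is not too large. -/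
def PairOK (C : Set V) : Prop :=
  ∃ y ∈ C, ∃ y' ∈ C, y ≠ y' ∧ (K.M = 0 ∨ dist y y' ≤ 5 * k * K.M)

/-- The pool `C` is good enough for all clusters. -/
def Done (C : Set V) : Prop := (∀ i, K.Served N J e C i) ∧ K.PairOK C

open scoped Classical in
/-- A measure of the progress that has been made towards `Done`. -/
noncomputable def potential (C : Set V) : ℕ :=
  (Finset.univ.filter fun i => K.Covered C i).card +
    (∑ i, Nat.findGreatest (fun j => K.LevelOK N e C i j) J) + if K.PairOK C then 1 else 0

/-- Each lucky sample raises the potential by at least one, so `k + k * J + 2` lucky samples would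
exceed this bound unless the pool has become `Done`. -/
theorem potential_le (C : Set V) : K.potential N J e C ≤ k + k * J + 1 := by
  classical
  unfold potential
  have h1 : (Finset.univ.filter fun i => K.Covered C i).card ≤ k :=
    (Finset.card_filter_le _ _).trans (by simp)
  have h2 : ∑ i : Fin k, Nat.findGreatest (fun j => K.LevelOK N e C i j) J ≤ k * J := by
    refine (Finset.sum_le_card_nsmul _ _ J fun i _ => Nat.findGreatest_le J).trans ?_
    simp
  split_ifs <;> omega

variable {K N J e}

/-- `C` has to be nonempty because `infDist` to the empty set is 0 by convention, which would make
the empty pool cover everything. -/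
theorem Covered.mono {C C' : Set V} (h : C ⊆ C') (hne : C.Nonempty) {i : Fin k}
    (hc : K.Covered C i) : K.Covered C' i :=
  (Finset.sum_le_sum fun _ _ => infDist_le_infDist_of_subset h hne).trans hc

theorem LevelOK.mono {C C' : Set V} (h : C ⊆ C') {i : Fin k} {j : ℕ}
    (hc : K.LevelOK N e C i j) : K.LevelOK N e C' i j := by
  rcases hc with h0 | ⟨c, hc, hd⟩
  · exact .inl h0
  · exact .inr ⟨c, reach_mono h j hc, hd⟩

theorem PairOK.mono {C C' : Set V} (h : C ⊆ C') (hc : K.PairOK C) : K.PairOK C' := by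
  obtain ⟨y, hy, y', hy', hh⟩ := hc
  exact ⟨y, h hy, y', h hy', hh⟩

theorem Done.mono {C C' : Set V} (h : C ⊆ C') (hc : K.Done N J e C) : K.Done N J e C' := by
  refine ⟨fun i => ?_, hc.2.mono h⟩
  obtain ⟨c, hc, hd⟩ := hc.1 i
  exact ⟨c, reach_mono h J hc, hd⟩

/-- All three summands of the potential are monotone in the pool, so it suffices that one of them
grows strictly. The lemmas on pairs and on levels treat the other two summands in the same way. -/
theorem potential_lt_of_covered {C C' : Set V} (h : C ⊆ C') (hne : C.Nonempty) {i : Fin k}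
    (h1 : ¬ K.Covered C i) (h2 : K.Covered C' i) :
    K.potential N J e C < K.potential N J e C' := by
  classical
  unfold potential
  refine add_lt_add_of_lt_of_le (add_lt_add_of_lt_of_le ?_ ?_) ?_
  · refine Finset.card_lt_card ⟨Finset.monotone_filter_right _ fun i _ hi => Covered.mono h hne hi,
      fun hs => ?_⟩
    have := hs (Finset.mem_filter.2 ⟨Finset.mem_univ i, h2⟩)
    exact h1 (Finset.mem_filter.1 this).2
  · exact Finset.sum_le_sum fun i _ => Nat.findGreatest_mono_left (fun j hj => LevelOK.mono h hj) J
  · split_ifs with h1 h2 <;> simp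
    exact h2 (h1.mono h)

theorem potential_lt_of_pairOK {C C' : Set V} (h : C ⊆ C') (hne : C.Nonempty)
    (h1 : ¬ K.PairOK C) (h2 : K.PairOK C') :
    K.potential N J e C < K.potential N J e C' := by
  classical
  unfold potential
  refine add_lt_add_of_le_of_lt (add_le_add ?_ ?_) ?_
  · exact Finset.card_le_card (Finset.monotone_filter_right _ fun i _ hi => Covered.mono h hne hi)
  · exact Finset.sum_le_sum fun i _ => Nat.findGreatest_mono_left (fun j hj => LevelOK.mono h hj) J
  · simp [h1, h2]

open scoped Classical in
theorem potential_lt_of_level {C C' : Set V} (h : C ⊆ C') (hne : C.Nonempty) {i : Fin k}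
    (hj : Nat.findGreatest (fun j => K.LevelOK N e C i j) J < J)
    (h2 : K.LevelOK N e C' i (Nat.findGreatest (fun j => K.LevelOK N e C i j) J + 1)) :
    K.potential N J e C < K.potential N J e C' := by
  unfold potential
  refine add_lt_add_of_lt_of_le (add_lt_add_of_le_of_lt ?_ ?_) ?_
  · exact Finset.card_le_card (Finset.monotone_filter_right _ fun i _ hi => Covered.mono h hne hi)
  · refine Finset.sum_lt_sum
      (fun i _ => Nat.findGreatest_mono_left (fun j hj => LevelOK.mono h hj) J)
      ⟨i, Finset.mem_univ i, ?_⟩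
    exact Nat.le_findGreatest (P := fun j => K.LevelOK N e C' i j) hj h2
  · split_ifs with h1 h2 <;> simp
    exact h2 (h1.mono h)

/-- Averaging over the cluster: its points are on average within `5 * μ` of `C` and within `μ` of
the center. This supplies the starting point of the moves and explains the 36 in `LevelOK`. -/
theorem Covered.exists_near {C : Set V} (hC : C.Finite) (hne : C.Nonempty) {i : Fin k}
    (hO : (K.O i).Nonempty) (hc : K.Covered C i) : ∃ c ∈ C, dist c (K.q i) ≤ 6 * K.mu i := by
  obtain ⟨c, hcC, hd⟩ := exists_dist_eq_infDist hC hne (K.q i)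
  refine ⟨c, hcC, ?_⟩
  have hpos : (0 : ℝ) < (K.O i).card := by exact_mod_cast Finset.card_pos.2 hO
  have : ∑ x ∈ K.O i, infDist (K.q i) C ≤ ∑ x ∈ K.O i, (infDist x C + dist x (K.q i)) :=
    Finset.sum_le_sum fun x _ => by
      rw [dist_comm]; exact infDist_le_infDist_add_dist
  rw [Finset.sum_const, nsmul_eq_mul, Finset.sum_add_distrib] at this
  have h2 := K.cost_le i
  unfold Covered at hc
  rw [dist_comm, ← hd, mu, mul_div_assoc', le_div_iff₀ hpos]
  linarith

/-- A cluster that is covered but not yet served has points of large total weight that allow a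
further step. -/
theorem level_progress {C : Set V} (hC : C.Finite) (hne : C.Nonempty) (he : 0 < e) (he1 : e ≤ 1)
    (hN : 256 ≤ N * e ^ 2) {i : Fin k} (hc : K.Covered C i) (hs : ¬ K.Served N J e C i)
    {j : ℕ} (hj : j ≤ J) (hl : K.LevelOK N e C i j) (hl' : ¬ K.LevelOK N e C i (j + 1)) :
    0 < K.M ∧
    ∃ G ⊆ K.O i, e ^ 2 * K.M ≤ 192 * ∑ y ∈ G, infDist y C ∧
      ∀ y ∈ G, K.LevelOK N e (insert y C) i (j + 1) := by
  classical
  have hN0 : 0 < N := by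
    rcases Nat.eq_zero_or_pos N with h | h
    · subst h; simp at hN; linarith
    · exact h
  have hO : (K.O i).Nonempty := by
    by_contra hO
    rw [Finset.not_nonempty_iff_eq_empty] at hO
    obtain ⟨c, hcC⟩ := hne
    refine hs ⟨c, reach_subset hN0 ⟨c, hcC⟩ (Nat.zero_le J) hcC, ?_⟩
    rw [hO, Finset.sum_empty]
    have := K.nonneg
    positivity
  have hpos : (0 : ℝ) < (K.O i).card := by exact_mod_cast Finset.card_pos.2 hO
  have hmu0 : 0 ≤ K.mu i := div_nonneg K.nonneg hpos.le
  obtain ⟨c, hcr, hcd⟩ : ∃ c ∈ reach N C j,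
      dist c (K.q i) ^ 2 ≤ 36 * K.mu i ^ 2 - j * (3 * e ^ 2 * K.mu i ^ 2 / 256) := by
    rcases hl with h0 | h
    · subst h0
      obtain ⟨c, hcC, hd⟩ := hc.exists_near hC hne hO
      refine ⟨c, hcC, ?_⟩
      have : dist c (K.q i) ^ 2 ≤ (6 * K.mu i) ^ 2 := by gcongr
      simp only [Nat.cast_zero, zero_mul, sub_zero]
      linarith
    · exact h
  have hcd6 : dist c (K.q i) ≤ 6 * K.mu i := by
    refine le_of_sq_le_sq ?_ (by positivity)
    have : 0 ≤ (j : ℝ) * (3 * e ^ 2 * K.mu i ^ 2 / 256) := by positivity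
    nlinarith
  have hbad : (1 + e) * K.M < ∑ x ∈ K.O i, dist x c := by
    by_contra hcon
    exact hs ⟨c, reach_subset hN0 hne hj hcr, not_lt.1 hcon⟩
  have hM : 0 < K.M := by
    rcases K.nonneg.lt_or_eq with h | h
    · exact h
    · exfalso
      have hz : K.mu i = 0 := by rw [mu, ← h, zero_div]
      rw [hz, mul_zero] at hcd6
      have := dist_le_zero.1 hcd6
      subst this
      have := K.cost_le i
      rw [← h] at this hbad
      linarith
  have hmu : 0 < K.mu i := div_pos hM hpos
  have hm : (K.O i).card * K.mu i = K.M := by rw [mu]; field_simp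
  refine ⟨hM, ?_⟩
  -- The target `y'` only has to be near `y`: the replacement costs at most `e * μ / 8` in each of
  -- two distances, so half of the gap `e * μ / 2` survives. A grid step with `γ = e * μ / 4` gains
  -- `3 * γ ^ 2 / 16 = 3 * e ^ 2 * μ ^ 2 / 256`, the decrement in `LevelOK`.
  have step : ∀ (C' : Set V) (y y' : V), C ⊆ C' → y' ∈ C' → dist y y' ≤ e * K.mu i / 8 →
      e * K.mu i / 2 ≤ dist y c - dist y (K.q i) → dist y (K.q i) ≤ 24 * K.mu i / e →
      K.LevelOK N e C' i (j + 1) := by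
    intro C' y y' hCC hy' hyy hgap hfar
    have t1 : dist y c ≤ dist y y' + dist y' c := dist_triangle _ _ _
    have t2 : dist y' (K.q i) ≤ dist y y' + dist y (K.q i) := by
      rw [dist_comm y y']; exact dist_triangle _ _ _
    have t3 : dist y' c ≤ dist y y' + dist y (K.q i) + dist c (K.q i) := by
      have := dist_triangle y' (K.q i) c
      rw [dist_comm (K.q i) c] at this
      linarith
    have t4 : dist y' c ≤ 31 * K.mu i / e := by
      have : e * K.mu i / 8 + 6 * K.mu i ≤ 7 * K.mu i / e := by
        rw [le_div_iff₀ he]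
        have m1 : e * K.mu i ≤ 1 * K.mu i := by gcongr
        have m2 : e * (e * K.mu i) ≤ 1 * (1 * K.mu i) := by gcongr
        nlinarith
      have e31 : 31 * K.mu i / e = 24 * K.mu i / e + 7 * K.mu i / e := by ring
      linarith
    -- The grid is fine enough for the longest move; `248 ≤ N * e ^ 2` would do.
    have t5 : 31 * K.mu i / e ≤ N * (e * K.mu i / 4) / 2 := by
      rw [div_le_iff₀ he]
      nlinarith
    obtain ⟨a, ha, hd⟩ := exists_grid_step (c := c) (q := K.q i) (y := y') (γ := e * K.mu i / 4)
      (N := N) (by positivity) (by linarith) (t4.trans t5)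
    refine .inr ⟨_, ⟨c, reach_mono hCC j hcr, y', hy', a, ha, rfl⟩, hd.trans ?_⟩
    push_cast
    linarith
  have hcard := card_gap_points (O := K.O i) (c := c) (q := K.q i) he hmu hm (K.cost_le i) hbad hcd6
  set G := (K.O i).filter fun y => e * K.mu i / 2 ≤ dist y c - dist y (K.q i) ∧
    dist y (K.q i) ≤ 24 * K.mu i / e with hG
  refine ⟨G, Finset.filter_subset _ _, ?_, ?_⟩
  -- If a good point were closer to the pool, a pool point could take its place and level `j + 1`
  -- would be reached already. So each of at least `e / 24 * |O i|` points has weight at least `e *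
  -- μ / 8`, which gives `e ^ 2 * M / 192` in total.
  · have far : ∀ y ∈ G, e * K.mu i / 8 ≤ infDist y C := by
      intro y hy
      have hy2 := (Finset.mem_filter.1 hy).2
      by_contra hcon
      obtain ⟨y', hy', hd⟩ := exists_dist_eq_infDist hC hne y
      exact hl' (step C y y' subset_rfl hy' (by linarith) hy2.1 hy2.2)
    have := Finset.sum_le_sum far
    rw [Finset.sum_const, nsmul_eq_mul] at this
    have h2 : e * (K.O i).card * (e * K.mu i) ≤ 24 * G.card * (e * K.mu i) := by gcongr
    have h3 : e * (K.O i).card * (e * K.mu i) = e ^ 2 * K.M := by rw [← hm]; ring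
    linarith
  · intro y hy
    have hy2 := (Finset.mem_filter.1 hy).2
    exact step _ y y (Set.subset_insert y C) (Set.mem_insert y C)
      (by rw [dist_self]; positivity) hy2.1 hy2.2

/-- As long as the pool is not good enough, there are points of large total weight each of which
makes progress. -/
theorem exists_progress {P : Finset V} (hPO : ∀ x, x ∈ P ↔ ∃ i, x ∈ K.O i)
    (hdisj : ∀ i j, i ≠ j → Disjoint (K.O i) (K.O j))
    {C : Set V} (hC : C.Finite) (h2 : ∃ y ∈ C, ∃ y' ∈ C, y ≠ y')
    (he : 0 < e) (he1 : e ≤ 1) (hN : 256 ≤ N * e ^ 2) (hJ : 3072 < J * e ^ 2) {L : ℝ}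
    (hL : 1 ≤ L * e ^ 2) (hd : ¬ K.Done N J e C) :
    ∃ G ⊆ P, 0 < ∑ x ∈ P, infDist x C ∧
      ∑ x ∈ P, infDist x C ≤ 960 * k * L * ∑ y ∈ G, infDist y C ∧
      ∀ y ∈ G, K.potential N J e C < K.potential N J e (insert y C) := by
  classical
  have hne : C.Nonempty := let ⟨y, hy, _⟩ := h2; ⟨y, hy⟩
  have hO : ∀ i, K.O i ⊆ P := fun i x hx => (hPO x).2 ⟨i, hx⟩
  have hnn : ∀ x, 0 ≤ infDist x C := fun x => infDist_nonneg
  have hL1 : 1 ≤ L := by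
    by_contra hcon
    have e2 : e ^ 2 ≤ 1 := pow_le_one₀ he.le he1
    have : 0 < e ^ 2 := by positivity
    nlinarith
  have hWsum : ∑ x ∈ P, infDist x C ≤ ∑ i, ∑ x ∈ K.O i, infDist x C := by
    have : P = Finset.univ.biUnion K.O := by ext x; simp [hPO]
    rw [this, Finset.sum_biUnion fun i _ j _ hij => hdisj i j hij]
  by_cases hcov : ∀ i, K.Covered C i
  -- With all clusters covered the total weight is at most `5 * k * M`. A set of weight `e ^ 2 * M /
  -- 192` is then a fraction of at least `e ^ 2 / (960 * k)`.
  · have hW : ∑ x ∈ P, infDist x C ≤ 5 * k * K.M := by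
      refine hWsum.trans ((Finset.sum_le_sum fun i _ => hcov i).trans ?_)
      rw [Finset.sum_const, nsmul_eq_mul, Finset.card_univ, Fintype.card_fin]
      linarith
    by_cases hsv : ∀ i, K.Served N J e C i
    · have hp : ¬ K.PairOK C := fun h => hd ⟨hsv, h⟩
      have hM : 0 < K.M := by
        rcases K.nonneg.lt_or_eq with h | h
        · exact h
        · obtain ⟨y, hy, y', hy', hyy⟩ := h2
          exact absurd ⟨y, hy, y', hy', hyy, .inl h.symm⟩ hp
      have hk : (1 : ℝ) ≤ k := by
        obtain ⟨i, _⟩ := K.exists_pair hM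
        have : 1 ≤ k := by have := i.2; omega
        exact_mod_cast this
      -- If the pool contained all of `P`, two distinct points of one cluster would form a pair at
      -- distance at most `M`.
      have hWpos : 0 < ∑ x ∈ P, infDist x C := by
        by_contra hcon
        have hz : ∀ x ∈ P, infDist x C = 0 := by
          rw [← Finset.sum_eq_zero_iff_of_nonneg fun x _ => hnn x]
          exact le_antisymm (not_lt.1 hcon) (Finset.sum_nonneg fun x _ => hnn x)
        have hmem : ∀ x ∈ P, x ∈ C := fun x hx =>
          (hC.isClosed.mem_iff_infDist_zero hne).2 (hz x hx)
        obtain ⟨i, x, hx, y, hy, hxy⟩ := K.exists_pair hM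
        refine hp ⟨x, hmem x (hO i hx), y, hmem y (hO i hy), hxy, .inr ?_⟩
        have h1 : dist x (K.q i) + dist y (K.q i) ≤ K.M := by
          rw [← Finset.sum_pair (f := fun z => dist z (K.q i)) hxy]
          refine le_trans (Finset.sum_le_sum_of_subset_of_nonneg ?_ fun _ _ _ => dist_nonneg)
            (K.cost_le i)
          intro z hz
          rcases Finset.mem_insert.1 hz with h | h
          · exact h ▸ hx
          · exact (Finset.mem_singleton.1 h) ▸ hy
        have h3 : dist x y ≤ dist x (K.q i) + dist y (K.q i) := dist_triangle_right _ _ _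
        nlinarith
      -- Every point outside the pool will do: together with its nearest pool point it forms a pair
      -- whose distance is at most the total weight.
      refine ⟨P.filter fun x => 0 < infDist x C, Finset.filter_subset _ _, hWpos, ?_, ?_⟩
      · have e1 : ∑ y ∈ P.filter (fun x => 0 < infDist x C), infDist y C
            = ∑ x ∈ P, infDist x C := by
          refine Finset.sum_filter_of_ne fun x _ hx => lt_of_le_of_ne (hnn x) (Ne.symm hx)
        rw [e1]
        have : 1 ≤ 960 * (k : ℝ) * L := by nlinarith
        exact le_mul_of_one_le_left hWpos.le this
      · intro y hy
        obtain ⟨hyP, hy0⟩ := Finset.mem_filter.1 hy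
        obtain ⟨z, hz, hdz⟩ := exists_dist_eq_infDist hC hne y
        refine potential_lt_of_pairOK (Set.subset_insert y C) hne hp
          ⟨y, Set.mem_insert y C, z, Set.mem_insert_of_mem y hz, ?_, .inr ?_⟩
        · rw [← dist_pos, ← hdz]; exact hy0
        · rw [← hdz]
          exact (Finset.single_le_sum (fun x _ => hnn x) hyP).trans hW
    · push Not at hsv
      obtain ⟨i, hi⟩ := hsv
      have hg := Nat.findGreatest_spec (P := fun j => K.LevelOK N e C i j) (Nat.zero_le J)
        (.inl rfl)
      set j := Nat.findGreatest (fun j => K.LevelOK N e C i j) J with hj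
      have hjJ : j ≤ J := Nat.findGreatest_le J
      have hlt : j < J := by
        rcases hjJ.lt_or_eq with h | h
        · exact h
        · exfalso
          rcases hg with h0 | ⟨c, hc, hcd⟩
          · rw [h0] at h; subst h; simp at hJ; linarith
          -- At level `J` the bound on the squared distance would be negative, since `36 * 256 / 3 =
          -- 3072 < J * e ^ 2`. The only escape is `μ = 0`, and then the point reached is `q i`
          -- itself, which serves the cluster.
          · have hmu : K.mu i = 0 := by
              have h1 : (0 : ℝ) ≤ dist c (K.q i) ^ 2 := by positivity
              have h3 : 0 ≤ K.mu i ^ 2 * (3072 - j * e ^ 2) := by nlinarith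
              by_contra hmu
              have h4 : 0 < K.mu i ^ 2 := by positivity
              rw [h] at h3
              nlinarith
            rw [hmu] at hcd
            have hc0 : dist c (K.q i) = 0 := by
              have h1 : (0 : ℝ) ≤ dist c (K.q i) ^ 2 := by positivity
              have h2 : dist c (K.q i) ^ 2 = 0 := by linarith
              exact pow_eq_zero_iff (two_ne_zero) |>.1 h2
            rw [dist_eq_zero] at hc0
            subst hc0
            rw [h] at hc
            refine hi ⟨_, hc, (K.cost_le i).trans ?_⟩
            have := K.nonneg
            nlinarith
      have hl' : ¬ K.LevelOK N e C i (j + 1) :=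
        Nat.findGreatest_is_greatest (P := fun j => K.LevelOK N e C i j) (Nat.lt_succ_self j) hlt
      obtain ⟨hM, G, hGO, hG1, hG2⟩ :=
        level_progress hC hne he he1 hN (hcov i) hi hjJ hg hl'
      have hGP : ∑ y ∈ G, infDist y C ≤ ∑ x ∈ P, infDist x C :=
        Finset.sum_le_sum_of_subset_of_nonneg (hGO.trans (hO i)) fun x _ _ => hnn x
      have hMG : 0 < e ^ 2 * K.M := by positivity
      refine ⟨G, hGO.trans (hO i), by linarith, ?_, fun y hy =>
        potential_lt_of_level (Set.subset_insert y C) hne hlt (hG2 y hy)⟩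
      have h5 : K.M ≤ L * (e ^ 2 * K.M) := by nlinarith
      have h6 : L * (e ^ 2 * K.M) ≤ L * (192 * ∑ y ∈ G, infDist y C) := by gcongr
      have h7 : 5 * (k : ℝ) * K.M ≤ 5 * k * (L * (192 * ∑ y ∈ G, infDist y C)) := by
        gcongr
        linarith
      linarith
  · push Not at hcov
    obtain ⟨i₀, hi₀⟩ := hcov
    -- The cluster of largest weight is uncovered as well and carries at least a `1 / k` fraction of
    -- the total.
    obtain ⟨i, -, hmax⟩ := Finset.exists_max_image Finset.univ
      (fun i => ∑ x ∈ K.O i, infDist x C) ⟨i₀, Finset.mem_univ _⟩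
    have hi : 5 * K.M < ∑ x ∈ K.O i, infDist x C :=
      (not_le.1 hi₀).trans_le (hmax i₀ (Finset.mem_univ _))
    obtain ⟨G, hGO, hG1, hG2⟩ := uncovered_cluster K.nonneg (K.cost_le i) hi
    have hGP : ∑ y ∈ K.O i, infDist y C ≤ ∑ x ∈ P, infDist x C :=
      Finset.sum_le_sum_of_subset_of_nonneg (hO i) fun x _ _ => hnn x
    have hM := K.nonneg
    refine ⟨G, hGO.trans (hO i), by linarith, ?_, fun y hy =>
      potential_lt_of_covered (Set.subset_insert y C) hne (not_le.2 hi) (hG2 y hy)⟩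
    have h1 : ∑ x ∈ P, infDist x C ≤ k * ∑ x ∈ K.O i, infDist x C := by
      refine hWsum.trans ((Finset.sum_le_sum fun i' hi' => hmax i' hi').trans ?_)
      rw [Finset.sum_const, nsmul_eq_mul, Finset.card_univ, Fintype.card_fin]
    have h2 : (k : ℝ) * ∑ x ∈ K.O i, infDist x C ≤ k * (5 * ∑ y ∈ G, infDist y C) := by gcongr
    have h3 : 0 ≤ ∑ y ∈ G, infDist y C := Finset.sum_nonneg fun x _ => hnn x
    have h4 : (k : ℝ) * (5 * ∑ y ∈ G, infDist y C) * 1 ≤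
        k * (5 * ∑ y ∈ G, infDist y C) * (192 * L) := by
      gcongr
      linarith
    linarith

/-- A good pool yields distinct centers. -/
theorem Done.exists_centers {C : Set V} {ε : ℝ} {n : ℕ} (hε : 0 < ε) (hd : K.Done N J (ε / 2) C)
    (hdisj : ∀ i j, i ≠ j → Disjoint (K.O i) (K.O j)) (hn0 : 0 < n)
    (hn : ∀ i, (K.O i).card ≤ n) (hkN : k ≤ N) :
    ∃ y ∈ C, ∃ y' ∈ C, ∃ (c : Fin k → V) (a : Fin k → ℕ),
      (∀ j, c j ∈ reach N C J) ∧ (∀ j, a j < N) ∧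
      Function.Injective (fun j => c j + ((a j : ℝ) / N * (ε / (10 * k * n))) • (y - y')) ∧
      ∀ j, ∑ x ∈ K.O j, dist x (c j + ((a j : ℝ) / N * (ε / (10 * k * n))) • (y - y'))
        ≤ (1 + ε) * K.M := by
  classical
  obtain ⟨hs, y, hy, y', hy', hyy, hpair⟩ := hd
  choose c hc hcost using hs
  rcases Nat.eq_zero_or_pos k with hk0 | hk
  · subst hk0
    exact ⟨y, hy, y', hy', c, fun _ => 0, hc, fun i => i.elim0, fun i => i.elim0, fun i => i.elim0⟩
  have hN0 : 0 < N := by omega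
  have hNr : (0 : ℝ) < N := by exact_mod_cast hN0
  have hkr : (0 : ℝ) < k := by exact_mod_cast hk
  have hnr : (0 : ℝ) < n := by exact_mod_cast hn0
  set v : ℝ := ε / (10 * k * n) with hv
  have hv0 : 0 < v := by positivity
  -- Each center gets `N` candidates on a short segment in the common direction `y - y'`. With `dist
  -- y y' ≤ 5 * k * M`, a shift is at most `ε * M / (2 * n)`, hence costs a cluster at most `ε * M /
  -- 2`.
  set f : Fin k → ℕ → V := fun j a => c j + ((a : ℝ) / N * v) • (y - y') with hf
  have hfinj : ∀ j, Function.Injective (f j) := by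
    intro j a b hab
    simp only [hf, add_right_inj] at hab
    have h1 := smul_left_injective ℝ (sub_ne_zero.2 hyy) hab
    have h2 : (a : ℝ) / N = b / N := mul_right_cancel₀ hv0.ne' h1
    have h3 : (a : ℝ) = b := by rwa [div_left_inj' hNr.ne'] at h2
    exact_mod_cast h3
  have hf0 : ∀ j, f j 0 = c j := by intro j; simp [hf]
  -- If `M = 0`, a nonempty cluster tolerates no shift at all; otherwise every candidate is
  -- admissible.
  set A : Fin k → Finset ℕ := fun j =>
    if (K.O j).Nonempty ∧ K.M = 0 then {0} else Finset.range N with hA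
  have hall : ∀ s : Finset (Fin k), s.card ≤ (s.biUnion fun j => (A j).image (f j)).card := by
    intro s
    by_cases hex : ∃ j ∈ s, ¬ ((K.O j).Nonempty ∧ K.M = 0)
    · obtain ⟨j, hj, hne⟩ := hex
      have h1 : ((A j).image (f j)).card = N := by
        rw [Finset.card_image_of_injective _ (hfinj j)]
        simp only [hA, if_neg hne, Finset.card_range]
      have h2 : ((A j).image (f j)).card ≤ (s.biUnion fun j => (A j).image (f j)).card :=
        Finset.card_le_card (Finset.subset_biUnion_of_mem (fun j => (A j).image (f j)) hj)
      have h3 : s.card ≤ k := by simpa using Finset.card_le_univ s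
      omega
    -- Here each center serves a nonempty cluster at cost 0, so it is a point of that cluster, and
    -- disjoint clusters give distinct centers.
    · push Not at hex
      have hmem : ∀ j ∈ s, c j ∈ K.O j := by
        intro j hj
        obtain ⟨⟨x, hx⟩, hM⟩ := hex j hj
        have h1 := hcost j
        rw [hM, mul_zero] at h1
        have h2 := (Finset.single_le_sum (f := fun x => dist x (c j))
          (fun x _ => dist_nonneg) hx).trans h1
        rw [← dist_le_zero.1 h2]
        exact hx
      have hinj : Set.InjOn c s := by
        intro i hi j hj hij
        by_contra hne
        exact Finset.disjoint_left.1 (hdisj i j hne) (hmem i hi) (hij ▸ hmem j hj)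
      rw [← Finset.card_image_of_injOn hinj]
      refine Finset.card_le_card fun z hz => ?_
      obtain ⟨j, hj, rfl⟩ := Finset.mem_image.1 hz
      refine Finset.mem_biUnion.2 ⟨j, hj, Finset.mem_image.2 ⟨0, ?_, hf0 j⟩⟩
      simp only [hA, if_pos (hex j hj), Finset.mem_singleton]
  -- Hall's marriage theorem picks pairwise distinct candidates.
  obtain ⟨g, hg, hgA⟩ := (Finset.all_card_le_biUnion_card_iff_exists_injective _).1 hall
  choose a haA hag using fun j => Finset.mem_image.1 (hgA j)
  have haN : ∀ j, a j < N := by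
    intro j
    have := haA j
    simp only [hA] at this
    split_ifs at this
    · rw [Finset.mem_singleton.1 this]; exact hN0
    · exact Finset.mem_range.1 this
  refine ⟨y, hy, y', hy', c, a, hc, haN, ?_, ?_⟩
  · intro i j hij
    refine hg ?_
    rw [← hag i, ← hag j]
    exact hij
  · intro j
    have hM := K.nonneg
    by_cases hO : (K.O j).Nonempty
    · by_cases hM0 : K.M = 0
      · have := haA j
        simp only [hA, if_pos (And.intro hO hM0), Finset.mem_singleton] at this
        rw [this]
        simp only [Nat.cast_zero, zero_div, zero_mul, zero_smul, add_zero]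
        refine (hcost j).trans ?_
        rw [hM0]; simp
      · have hd5 := hpair.resolve_left hM0
        set w := ((a j : ℝ) / N * v) • (y - y') with hw
        have hwn : ‖w‖ ≤ ε * K.M / (2 * n) := by
          rw [hw, norm_smul, Real.norm_of_nonneg (by positivity), ← dist_eq_norm]
          have h1 : (a j : ℝ) / N ≤ 1 := by
            rw [div_le_one hNr]; exact_mod_cast (haN j).le
          calc (a j : ℝ) / N * v * dist y y' ≤ 1 * v * (5 * k * K.M) := by gcongr
            _ = ε * K.M / (2 * n) := by rw [hv]; field_simp; ring
        have h1 : ∑ x ∈ K.O j, dist x (c j + w) ≤ ∑ x ∈ K.O j, (dist x (c j) + ‖w‖) := by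
          refine Finset.sum_le_sum fun x _ => ?_
          refine (dist_triangle x (c j) (c j + w)).trans ?_
          rw [dist_self_add_right]
        rw [Finset.sum_add_distrib, Finset.sum_const, nsmul_eq_mul] at h1
        have h2 : ((K.O j).card : ℝ) * ‖w‖ ≤ n * (ε * K.M / (2 * n)) := by
          gcongr
          exact_mod_cast hn j
        have h3 : n * (ε * K.M / (2 * n)) = ε * K.M / 2 := by field_simp
        have := hcost j
        linarith
    · rw [Finset.not_nonempty_iff_eq_empty.1 hO, Finset.sum_empty]
      positivity

end Clusters

end MinLoad

/-! ## The building blocks of the program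

Cell `0` of the following integer arrays is used as a variable: `10` to `17` for the parameters of
the algorithm, `20` to `26` for loop counters, `30` for coins, `31` for random numbers, `32`, `33`,
`35`, `36`, `39`, `40` for pointers to points, `34` for the size of the pool, and `37`, `38` for
pointers into the output. Integer array `2` is the pool, a list of pointers to points in the
real array `1`; real array `3` holds the distances of the points to the pool. -/

namespace RealRAM

/-- Cell `0` of an integer array, used as a variable. -/
abbrev var (a : ℕ) : NExp := .get a (.lit 0)

/-- Cell `0` of a real array, used as a variable. -/
abbrev rvar (a : ℕ) : RExp := .get a (.lit 0)

/-- Assignment to an integer variable. -/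
abbrev assign (a : ℕ) (e : NExp) : Prog := .setNat a (.lit 0) e

/-- Assignment to a real variable. -/
abbrev rassign (a : ℕ) (e : RExp) : Prog := .setReal a (.lit 0) e

/-- The invariant is indexed by the coins read so far instead of their number, because the result
depends on the coins themselves. -/
theorem Hoare.forLoop_coins {i a c : ℕ} {p : Prog} {s : State} {T : ℕ}
    {I : List Bool → State → Prop} {l : List Bool} (hi : p.writesNat i = false)
    (ha : (RealRAM.forLoop i a c p).writesNat a = false)
    (hN : s.nat a c = l.length) (h0 : I [] (s.writeNat i 0 0))
    (hs : ∀ l₁ b s', I l₁ s' → Frame (RealRAM.forLoop i a c p) s s' →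
      Hoare p s' [b] T (fun s'' => I (l₁ ++ [b]) (s''.writeNat i 0 (l₁.length + 1)))) :
    Hoare (RealRAM.forLoop i a c p) s l (l.length * (T + 12) + 9) (I l) := by
  have key : ∀ l₂ l₁ s', l₁ ++ l₂ = l → I l₁ s' → s'.nat i 0 = l₁.length →
      Frame (RealRAM.forLoop i a c p) s s' →
      Hoare (.loop (.natLt (.get i (.lit 0)) (.get a (.lit c)))
        (.seq p (.setNat i (.lit 0) (.add (.get i (.lit 0)) (.lit 1))))) s' l₂
        (l₂.length * (T + 12) + 6) (I l) := by
    intro l₂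
    induction l₂ with
    | nil =>
      intro l₁ s' hl hI hc hF
      rw [List.append_nil] at hl
      subst hl
      rw [List.length_nil, Nat.zero_mul]
      refine Hoare.loop_false ?_ hI
      simp [BExp.Holds, NExp.eval, hc, hF.nat a ha, hN]
    | cons b l₂ ih =>
      intro l₁ s' hl hI hc hF
      have hb : (BExp.natLt (.get i (.lit 0)) (.get a (.lit c))).Holds s' := by
        simp only [BExp.Holds, NExp.eval, hc, hF.nat a ha, hN, ← hl]
        simp
      have step := Hoare.seq (l' := l₂) (Hoare.seq
        (q := .setNat i (.lit 0) (.add (.get i (.lit 0)) (.lit 1))) (T' := 6) (l' := [])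
        (Q' := fun s'' => I (l₁ ++ [b]) s'' ∧ s''.nat i 0 = l₁.length + 1 ∧
          Frame (RealRAM.forLoop i a c p) s s'')
        (hs l₁ b s' hI hF).frame fun s₁ hs₁ => Hoare.setNat (by
          have : s₁.nat i 0 = l₁.length := by rw [hs₁.2.nat i hi, hc]
          simp only [NExp.eval, this]
          exact ⟨hs₁.1, by simp, hF.trans_forLoop hs₁.2⟩))
        (fun s₁ hs₁ => ih (l₁ ++ [b]) s₁ (by simpa using hl) hs₁.1 (by simpa using hs₁.2.1)
          hs₁.2.2)
      refine (Hoare.loop_true hb step).mono ?_ fun _ h => h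
      simp only [BExp.cost, NExp.cost, List.length_cons, Nat.succ_mul]
      omega
  have := Hoare.setNat_seq (a := i) (i := .lit 0) (e := .lit 0)
    (key l [] _ rfl h0 (by simp [NExp.eval]) (forLoop_frame_start i a c p s))
  refine this.mono ?_ fun _ h => h
  simp only [NExp.cost]
  omega

theorem Luck.of_hoare {p : Prog} {s : State} {l : List Bool} {T B : ℕ} {Q : State → Prop}
    (hl : l.length = B) (h : Hoare p s l T Q) : Luck p s T B ((1 / 2) ^ B) Q :=
  le_bitProb_of_mem l hl h

/-- Read a random number of `N` bits into variable `31`, where `N` is read from variable `a`, and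
put `2 ^ N` into the real variable `10`. -/
def randomBits (a : ℕ) : Prog :=
  .seq (assign 31 (.lit 0)) (.seq (rassign 10 (.ofNat (.lit 1)))
    (forLoop 21 a 0 (.seq (.flip 30 (.lit 0))
      (.seq (assign 31 (.add (.add (var 31) (var 31)) (var 30)))
        (rassign 10 (.add (rvar 10) (rvar 10)))))))

/-- Doubling and adding the new coin is Horner's rule, which fits the order of digits in `bitsVal`.
-/
theorem randomBits_spec {s : State} {a : ℕ} {l : List Bool} (ha : s.nat a 0 = l.length)
    (h1 : a ≠ 21) (h2 : a ≠ 30) (h3 : a ≠ 31) :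
    Hoare (randomBits a) s l (40 * l.length + 20)
      (fun s' => s'.nat 31 0 = bitsVal l ∧ s'.real 10 0 = 2 ^ l.length) := by
  refine (Hoare.setNat_seq (Hoare.setReal_seq (Hoare.forLoop_coins (T := 19)
    (I := fun l₁ s' => s'.nat 31 0 = bitsVal l₁ ∧ s'.real 10 0 = 2 ^ l₁.length)
    (by rfl) ?_ ?_ ?_ ?_))).mono ?_ fun _ h => h
  · simp [forLoop, Prog.writesNat, h1.symm, h2.symm, h3.symm]
  · simp [NExp.eval, ha, h3]
  · simp [NExp.eval, RExp.eval, bitsVal]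
  · intro l₁ b s' hI _
    refine (Hoare.seq (l := [b]) (l' := []) (Hoare.flip (Q := fun s₁ => s₁ = _) rfl) ?_).mono
      (T := 2 + 17) le_rfl fun _ h => h
    rintro _ rfl
    refine (Hoare.setNat_seq (Hoare.setReal ?_)).mono (by simp [NExp.cost, RExp.cost]) fun _ h => h
    simp only [State.writeNat_nat, State.writeReal_nat, State.writeReal_real, NExp.eval, RExp.eval,
      State.writeNat_real, bitsVal_append]
    simp [hI.1, hI.2, bitsVal, pow_succ]
    constructor <;> ring
  · simp [NExp.cost, RExp.cost]
    omega

end RealRAM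

namespace MinLoad

open RealRAM Metric

/-- The point whose coordinates start in cell `p` of `f`. -/
noncomputable def readPt (d : ℕ) (f : ℕ → ℝ) (p : ℕ) : Pt d :=
  WithLp.toLp 2 fun c : Fin d => f (p + c)

theorem dist_readPt_sq (d : ℕ) (f g : ℕ → ℝ) (p q : ℕ) :
    dist (readPt d f p) (readPt d g q) ^ 2 =
      ∑ c ∈ Finset.range d, (f (p + c) - g (q + c)) * (f (p + c) - g (q + c)) := by
  rw [EuclideanSpace.dist_eq, Real.sq_sqrt (Finset.sum_nonneg fun _ _ => sq_nonneg _),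
    Finset.sum_range]
  refine Finset.sum_congr rfl fun c _ => ?_
  rw [Real.dist_eq, sq_abs]
  simp [readPt, sq]

theorem readPt_congr {d : ℕ} {f g : ℕ → ℝ} {p q : ℕ} (h : ∀ c < d, f (p + c) = g (q + c)) :
    readPt d f p = readPt d g q := by
  unfold readPt
  congr 1
  funext c
  exact h c c.2

/-- Compute the squared distance of two points of the real array `A`. -/
def sqDist (A p q : ℕ) : Prog :=
  .seq (rassign 11 (.ofNat (.lit 0)))
    (forLoop 21 0 1 (rassign 11 (.add (rvar 11)
      (.mul (.sub (.get A (.add (var p) (var 21))) (.get A (.add (var q) (var 21))))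
        (.sub (.get A (.add (var p) (var 21))) (.get A (.add (var q) (var 21))))))))

theorem sqDist_spec {s : State} {A p q d : ℕ} (hd : s.nat 0 1 = d) (hd1 : 1 ≤ d) (hA : A ≠ 11)
    (hp : p ≠ 21) (hq : q ≠ 21) :
    Hoare (sqDist A p q) s [] (60 * d) (fun s' => s'.real 11 0 =
      dist (readPt d (s.real A) (s.nat p 0)) (readPt d (s.real A) (s.nat q 0)) ^ 2) := by
  refine (Hoare.setReal_seq (Hoare.forLoop (N := d) (T := 32)
    (I := fun m s' => s'.real 11 0 = ∑ c ∈ Finset.range m,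
      (s.real A (s.nat p 0 + c) - s.real A (s.nat q 0 + c)) *
        (s.real A (s.nat p 0 + c) - s.real A (s.nat q 0 + c)))
    (by rfl) (by rfl) ?_ ?_ ?_)).mono ?_ ?_
  · simpa using hd
  · simp [NExp.eval, RExp.eval]
  · intro m s' _ hI hm hF
    refine (Hoare.setReal ?_).mono (by simp [NExp.cost, RExp.cost]) fun _ h => h
    have e1 : s'.real A = s.real A := by
      rw [hF.real A (by simp [forLoop, Prog.writesReal, hA.symm]),
        State.writeReal_real_of_ne _ hA]
    have e2 : s'.nat p = s.nat p := hF.nat p (by simp [forLoop, Prog.writesNat, hp.symm])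
    have e3 : s'.nat q = s.nat q := hF.nat q (by simp [forLoop, Prog.writesNat, hq.symm])
    simp [NExp.eval, RExp.eval, hI, e1, e2, e3, hm, Finset.sum_range_succ]
  · simp [NExp.cost, RExp.cost]
    omega
  · intro s' h
    rw [dist_readPt_sq]
    exact h

/-- Write the point with coordinates `e` to the place of the real array `A` that variable `q`
points to; variable `21` numbers the coordinates. -/
def writePt (A q : ℕ) (e : RExp) : Prog :=
  forLoop 21 0 1 (.setReal A (.add (var q) (var 21)) e)

theorem writePt_spec {s : State} {A q d : ℕ} {e : RExp} {f : ℕ → ℝ} (hd : s.nat 0 1 = d)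
    (hd1 : 1 ≤ d) (hq : q ≠ 21)
    (he : ∀ c s', c < d → s'.nat 21 0 = c → Frame (writePt A q e) s s' →
      (∀ m, m < s.nat q 0 ∨ s.nat q 0 + c ≤ m → s'.real A m = s.real A m) → e.eval s' = f c) :
    Hoare (writePt A q e) s [] ((e.cost + 27) * d) (fun s' =>
      (∀ c, c < d → s'.real A (s.nat q 0 + c) = f c) ∧
      ∀ m, m < s.nat q 0 ∨ s.nat q 0 + d ≤ m → s'.real A m = s.real A m) := by
  refine (Hoare.forLoop (N := d) (T := e.cost + 6)
    (I := fun m s' => (∀ c, c < m → s'.real A (s.nat q 0 + c) = f c) ∧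
      ∀ j, j < s.nat q 0 ∨ s.nat q 0 + m ≤ j → s'.real A j = s.real A j)
    (by rfl) (by rfl) hd ?_ ?_).mono ?_ fun _ h => h
  · exact ⟨fun c hc => absurd hc (Nat.not_lt_zero c), fun _ _ => rfl⟩
  · intro m s' hm hI hc hF
    refine (Hoare.setReal ?_).mono (by simp [NExp.cost]; omega) fun _ h => h
    have e2 : s'.nat q = s.nat q := hF.nat q (by simp [forLoop, Prog.writesNat, hq.symm])
    have e3 := he m s' hm hc hF hI.2
    simp only [State.writeNat_real, State.writeReal_real, NExp.eval, hc, e2, true_and]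
    constructor
    · intro c hcm
      split_ifs with h
      · have : c = m := by omega
        rw [e3, this]
      · exact hI.1 c (by omega)
    · intro j hj
      rw [if_neg (by omega)]
      exact hI.2 j (by omega)
  · have : (e.cost + 27) * d = d * (e.cost + 6 + 12) + 9 * d := by ring
    omega

theorem infDist_insert {V : Type*} [PseudoMetricSpace V] (x y : V) {C : Set V}
    (hne : C.Nonempty) : infDist x (insert y C) = min (dist x y) (infDist x C) := by
  refine le_antisymm (le_min (infDist_le_dist_of_mem (Set.mem_insert y C))
    (infDist_le_infDist_of_subset (Set.subset_insert y C) hne)) ?_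
  rw [le_infDist ⟨y, Set.mem_insert y C⟩]
  rintro z (rfl | hz)
  · exact min_le_left _ _
  · exact (min_le_right _ _).trans (infDist_le_dist_of_mem hz)

/-- Real array `3` holds the distances of the `n` points to `C`, or `-1` if `C` is empty. -/
def DistOK (n d : ℕ) (C : Set (Pt d)) (s : State) : Prop :=
  ∀ i < n, (C = ∅ ∧ s.real 3 i = -1) ∨
    (C.Nonempty ∧ s.real 3 i = infDist (readPt d (s.real 1) (i * d)) C)

/-- Update the distances after the point that variable `32` points to has been put into the
pool. -/
def updateDist : Prog :=
  .seq (assign 33 (.lit 0)) (forLoop 20 0 0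
    (.seq (sqDist 1 33 32)
      (.seq (.cond (.not (.and (.not (.realLt (.get 3 (var 20)) (.ofNat (.lit 0))))
          (.not (.realLt (.sqrt (rvar 11)) (.get 3 (var 20))))))
        (.setReal 3 (var 20) (.sqrt (rvar 11))) .skip)
        (assign 33 (.add (var 33) (.get 0 (.lit 1)))))))

/-- A negative entry marks an empty pool and forces the first distance to be stored. The value 0 of
`infDist` on the empty set could not serve as a mark, since it is also a genuine distance. -/
theorem updateDist_spec {s : State} {n d : ℕ} (hn : s.nat 0 0 = n) (hd : s.nat 0 1 = d)
    (hn1 : 1 ≤ n) (hd1 : 1 ≤ d) {C : Set (Pt d)} (hD : DistOK n d C s) :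
    Hoare updateDist s [] (150 * (n * d))
      (DistOK n d (insert (readPt d (s.real 1) (s.nat 32 0)) C)) := by
  set y := readPt d (s.real 1) (s.nat 32 0) with hy
  refine (Hoare.setNat_seq (Hoare.forLoop (N := n) (T := 60 * d + 40)
    (I := fun m s' => s'.nat 33 0 = m * d ∧
      (∀ i < m, s'.real 3 i = infDist (readPt d (s.real 1) (i * d)) (insert y C)) ∧
      ∀ i, m ≤ i → s'.real 3 i = s.real 3 i)
    (by rfl) (by rfl) ?_ ?_ ?_)).frame.mono ?_ ?_
  · simpa using hn
  · simp [NExp.eval]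
  · intro m s' hm hI hc hF
    have e1 : s'.real 1 = s.real 1 := hF.real 1 rfl
    have e0 : s'.nat 0 = s.nat 0 := hF.nat 0 rfl
    have e32 : s'.nat 32 = s.nat 32 := hF.nat 32 rfl
    refine (Hoare.seq_nil (sqDist_spec (by rw [e0, hd]) hd1 (by norm_num) (by norm_num)
      (by norm_num)) fun s₁ h₁ hF₁ => Hoare.seq_nil (T := 24) (T' := 7)
        (Q := fun s₂ => (∀ i < m + 1, s₂.real 3 i =
          infDist (readPt d (s.real 1) (i * d)) (insert y C)) ∧
          ∀ i, m + 1 ≤ i → s₂.real 3 i = s.real 3 i)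
        ?_ fun s₂ h₂ hF₂ => (Hoare.setNat ?_).mono (by simp [NExp.cost]) fun _ h => h).mono
      (T := 60 * d + (24 + 7)) (by omega) fun _ h => h
    · rw [e1, e32, hI.1, ← hy] at h₁
      have hs1 : √(s₁.real 11 0) = dist (readPt d (s.real 1) (m * d)) y := by
        rw [h₁, Real.sqrt_sq dist_nonneg]
      have e3 : s₁.real 3 = s'.real 3 := hF₁.real 3 rfl
      have e20 : s₁.nat 20 0 = m := by rw [hF₁.nat 20 rfl, hc]
      have e3m : s₁.real 3 m = s.real 3 m := by rw [e3, hI.2.2 m le_rfl]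
      refine (Hoare.cond (T := 6) (fun hb => (Hoare.setReal ?_).mono (by
          simp [NExp.cost, RExp.cost]) fun _ h => h)
        fun hb => (Hoare.skip ?_).mono (by norm_num) fun _ h => h).mono
          (by simp [BExp.cost, NExp.cost, RExp.cost]) fun _ h => h
      · simp only [BExp.Holds, RExp.eval, NExp.eval, e20, hs1, e3m] at hb
        have key : dist (readPt d (s.real 1) (m * d)) y =
            infDist (readPt d (s.real 1) (m * d)) (insert y C) := by
          rcases hD m hm with ⟨hC, h⟩ | ⟨hC, h⟩
          · rw [hC]; simp
          · rw [infDist_insert _ _ hC, min_eq_left]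
            rw [← h]
            by_contra hcon
            refine hb ⟨?_, fun h' => hcon h'.le⟩
            rw [h]
            simpa using infDist_nonneg
        simp only [State.writeReal_real, NExp.eval, e20, RExp.eval, true_and, hs1]
        refine ⟨fun i hi => ?_, fun i hi => ?_⟩
        · split_ifs with him
          · rw [him]; exact key
          · rw [e3]; exact hI.2.1 i (by omega)
        · rw [if_neg (by omega), e3]
          exact hI.2.2 i (by omega)
      · simp only [BExp.Holds, RExp.eval, NExp.eval, e20, hs1, e3m, not_not, Nat.cast_zero] at hb
        refine ⟨fun i hi => ?_, fun i hi => by rw [e3]; exact hI.2.2 i (by omega)⟩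
        rcases Nat.lt_succ_iff_lt_or_eq.1 hi with hi | rfl
        · rw [e3]; exact hI.2.1 i hi
        · rw [e3m]
          rcases hD i hm with ⟨hC, h⟩ | ⟨hC, h⟩
          · rw [h] at hb
            exact absurd (by norm_num) hb.1
          · rw [infDist_insert _ _ hC, min_eq_right, h]
            rw [← h]
            exact not_lt.1 hb.2
    · have e33 : s₂.nat 33 0 = m * d := by
        rw [hF₂.nat 33 rfl, hF₁.nat 33 rfl, hI.1]
      have e01 : s₂.nat 0 1 = d := by
        rw [hF₂.nat 0 rfl, hF₁.nat 0 rfl, e0, hd]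
      simp only [State.writeNat_nat, State.writeNat_real, NExp.eval, e33, e01]
      refine ⟨by simp; ring, h₂⟩
  · have h1 : n ≤ n * d := Nat.le_mul_of_pos_right n hd1
    have h2 : n * (60 * d + 40 + 12) = 60 * (n * d) + 52 * n := by ring
    simp only [NExp.cost]
    omega
  · rintro s' ⟨⟨-, h, -⟩, hF⟩
    have e1 : s'.real 1 = s.real 1 := hF.real 1 rfl
    exact fun i hi => .inr ⟨⟨y, Set.mem_insert y C⟩, by rw [e1]; exact h i hi⟩

end MinLoad

/-! ### The pool and sampling proportional to the distance to it -/

namespace MinLoad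

open RealRAM Metric

/-- The points in the pool. -/
def poolSet (d : ℕ) (s : State) : Set (Pt d) :=
  {z | ∃ v < s.nat 34 0, z = readPt d (s.real 1) (s.nat 2 v)}

theorem finite_poolSet (d : ℕ) (s : State) : (poolSet d s).Finite := by
  refine ((Set.finite_lt_nat (s.nat 34 0)).image
    fun v => readPt d (s.real 1) (s.nat 2 v)).subset ?_
  rintro z ⟨v, hv, rfl⟩
  exact ⟨v, hv, rfl⟩

theorem poolSet_congr {d : ℕ} {s s' : State} (h1 : s'.nat 34 = s.nat 34)
    (h2 : s'.nat 2 = s.nat 2) (h3 : s'.real 1 = s.real 1) : poolSet d s' = poolSet d s := by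
  unfold poolSet
  rw [h1, h2, h3]

/-- The pool is in order: real array `3` holds the distances to it. -/
def PoolOK (n d : ℕ) (s : State) : Prop := DistOK n d (poolSet d s) s

theorem PoolOK.congr {n d : ℕ} {s s' : State} (h : PoolOK n d s) (h1 : s'.nat 34 = s.nat 34)
    (h2 : s'.nat 2 = s.nat 2) (h3 : s'.real 1 = s.real 1) (h4 : s'.real 3 = s.real 3) :
    PoolOK n d s' := by
  unfold PoolOK DistOK
  rw [poolSet_congr h1 h2 h3, h3, h4]
  exact h

/-- Put the point that variable `32` points to into the pool. -/
def push : Prog :=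
  .seq (.setNat 2 (var 34) (var 32)) (.seq (assign 34 (.add (var 34) (.lit 1))) updateDist)

theorem push_spec {s : State} {n d : ℕ} (hn : s.nat 0 0 = n) (hd : s.nat 0 1 = d)
    (hn1 : 1 ≤ n) (hd1 : 1 ≤ d) (hD : PoolOK n d s) :
    Hoare push s [] (170 * (n * d)) (fun s' => PoolOK n d s' ∧
      poolSet d s' = insert (readPt d (s.real 1) (s.nat 32 0)) (poolSet d s) ∧
      s'.nat 34 0 = s.nat 34 0 + 1) := by
  set s₁ := s.writeNat 2 (s.nat 34 0) (s.nat 32 0) with hs₁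
  set s₂ := s₁.writeNat 34 0 (s₁.nat 34 0 + 1) with hs₂
  have h34 : s₂.nat 34 0 = s.nat 34 0 + 1 := by simp [hs₂, hs₁]
  have hset : poolSet d s₂ = insert (readPt d (s.real 1) (s.nat 32 0)) (poolSet d s) := by
    ext z
    have h2 : ∀ v, s₂.nat 2 v = if v = s.nat 34 0 then s.nat 32 0 else s.nat 2 v := by
      intro v; simp [hs₂, hs₁]
    have hr : s₂.real 1 = s.real 1 := rfl
    simp only [poolSet, Set.mem_insert_iff, h34, hr, h2, Set.mem_ofPred_eq]
    constructor
    · rintro ⟨v, hv, rfl⟩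
      split_ifs with h
      · exact .inl rfl
      · exact .inr ⟨v, by omega, rfl⟩
    · rintro (rfl | ⟨v, hv, rfl⟩)
      · exact ⟨s.nat 34 0, by omega, by simp⟩
      · exact ⟨v, by omega, by rw [if_neg (by omega)]⟩
  have hu := updateDist_spec (s := s₂) (n := n) (d := d) (C := poolSet d s)
    (by simpa [hs₂, hs₁] using hn) (by simpa [hs₂, hs₁] using hd) hn1 hd1 hD
  have h1 : 1 ≤ n * d := Nat.one_le_iff_ne_zero.2 (by positivity)
  refine (Hoare.setNat_seq (Hoare.setNat_seq hu.frame)).mono ?_ ?_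
  · simp only [NExp.cost]; omega
  · rintro s' ⟨h, hF⟩
    have e32 : s₂.nat 32 0 = s.nat 32 0 := by simp [hs₂, hs₁]
    have hps : poolSet d s' = poolSet d s₂ :=
      poolSet_congr (hF.nat 34 rfl) (hF.nat 2 rfl) (hF.real 1 rfl)
    refine ⟨?_, by rw [hps, hset], by rw [hF.nat 34 rfl, h34]⟩
    unfold PoolOK
    rw [hps, hset, ← e32]
    exact h

/-- Empty the pool. -/
def clearPool : Prog :=
  .seq (assign 34 (.lit 0))
    (forLoop 20 0 0 (.setReal 3 (var 20) (.sub (.ofNat (.lit 0)) (.ofNat (.lit 1)))))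

theorem clearPool_spec {s : State} {n d : ℕ} (hn : s.nat 0 0 = n) :
    Hoare clearPool s [] (25 * n + 20) (fun s' => PoolOK n d s' ∧ s'.nat 34 0 = 0) := by
  refine (Hoare.setNat_seq (Hoare.forLoop (N := n) (T := 8)
    (I := fun m s' => ∀ i < m, s'.real 3 i = -1) (by rfl) (by rfl) ?_ ?_ ?_).frame).mono ?_ ?_
  · simpa using hn
  · intro i hi; omega
  · intro m s' hm hI hc hF
    refine (Hoare.setReal ?_).mono (by simp [NExp.cost, RExp.cost]) fun _ h => h
    intro i hi
    simp only [State.writeNat_real, State.writeReal_real, NExp.eval, hc, RExp.eval, true_and]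
    split_ifs with h
    · norm_num
    · exact hI i (by omega)
  · simp only [NExp.cost]; omega
  · rintro s' ⟨h, hF⟩
    have e34 : s'.nat 34 0 = 0 := by rw [hF.nat 34 rfl]; simp [NExp.eval]
    refine ⟨fun i hi => .inl ⟨?_, h i hi⟩, e34⟩
    unfold poolSet
    rw [e34]
    simp

/-- Let variable `32` point to a random point, chosen with probability proportional to the
distance to the pool. -/
def sample : Prog :=
  .seq (randomBits 16) (.seq (rassign 12 (.ofNat (.lit 0)))
    (.seq (forLoop 20 0 0 (rassign 12 (.add (rvar 12) (.get 3 (var 20)))))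
    (.seq (rassign 13 (.mul (.div (.ofNat (var 31)) (rvar 10)) (rvar 12)))
    (.seq (rassign 14 (.ofNat (.lit 0))) (.seq (assign 32 (.lit 0)) (.seq (assign 33 (.lit 0))
    (forLoop 20 0 0
      (.seq (.cond (.and (.not (.realLt (rvar 13) (rvar 14)))
          (.realLt (rvar 13) (.add (rvar 14) (.get 3 (var 20)))))
        (assign 32 (var 33)) .skip)
      (.seq (rassign 14 (.add (rvar 14) (.get 3 (var 20))))
        (assign 33 (.add (var 33) (.get 0 (.lit 1)))))))))))))

/-- The statement is conditional on the interval hit by the random number, in the form required by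
`le_bitProb_pick`. If all weights vanish, no interval is hit and the pointer keeps its default 0,
the first input point, which does no harm. -/
theorem sample_spec {s : State} {n d B : ℕ} {l : List Bool} (hn : s.nat 0 0 = n)
    (hd : s.nat 0 1 = d) (hB : s.nat 16 0 = B) (hl : l.length = B)
    (hw : ∀ i < n, 0 ≤ s.real 3 i) :
    Hoare sample s l (40 * B + 100 * n + 100) (fun s' => ∀ i < n,
      ∑ j ∈ Finset.range i, s.real 3 j ≤
          (bitsVal l : ℝ) / 2 ^ B * ∑ i ∈ Finset.range n, s.real 3 i →
        (bitsVal l : ℝ) / 2 ^ B * ∑ i ∈ Finset.range n, s.real 3 i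
          < ∑ j ∈ Finset.range (i + 1), s.real 3 j → s'.nat 32 0 = i * d) := by
  set w := s.real 3 with hwdef
  set u := (bitsVal l : ℝ) / 2 ^ B * ∑ i ∈ Finset.range n, w i with hu
  have hmono : ∀ i j, i ≤ j → j ≤ n →
      ∑ m ∈ Finset.range i, w m ≤ ∑ m ∈ Finset.range j, w m := by
    intro i j hij hj
    refine Finset.sum_le_sum_of_subset_of_nonneg
      (Finset.range_subset_range.2 hij) fun m hm _ => hw m ?_
    have := Finset.mem_range.1 hm
    omega
  have hbits := randomBits_spec (s := s) (a := 16) (l := l) (by rw [hB, hl]) (by norm_num)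
    (by norm_num) (by norm_num)
  suffices H : Hoare sample s (l ++ []) (40 * l.length + 20 + (100 * n + 80))
      (fun s' => ∀ i < n, ∑ j ∈ Finset.range i, w j ≤ u →
        u < ∑ j ∈ Finset.range (i + 1), w j → s'.nat 32 0 = i * d) by
    rw [List.append_nil] at H
    exact H.mono (by omega) fun _ h => h
  refine Hoare.seq hbits.frame ?_
  rintro s₁ ⟨⟨h31, h10⟩, hF₁⟩
  have e0 : s₁.nat 0 = s.nat 0 := hF₁.nat 0 rfl
  have e3 : s₁.real 3 = w := hF₁.real 3 rfl
  refine (Hoare.setReal_seq (Hoare.seq_nil (Hoare.forLoop (N := n) (T := 8)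
    (I := fun m s' => s'.real 12 0 = ∑ i ∈ Finset.range m, w i) (by rfl) (by rfl) ?_ ?_ ?_)
    fun s₂ h₂ hF₂ => Hoare.setReal_seq (Hoare.setReal_seq (Hoare.setNat_seq (Hoare.setNat_seq
      (Hoare.forLoop (N := n) (T := 40)
      (I := fun m s' => s'.real 14 0 = ∑ i ∈ Finset.range m, w i ∧ s'.nat 33 0 = m * d ∧
        ∀ i < m, ∑ j ∈ Finset.range i, w j ≤ u →
          u < ∑ j ∈ Finset.range (i + 1), w j → s'.nat 32 0 = i * d)
      (by rfl) (by rfl) ?_ ?_ ?_)))))).mono ?_ ?_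
  · simp [e0, hn]
  · simp [RExp.eval, NExp.eval]
  · intro m s' hm hI hc hF
    refine (Hoare.setReal ?_).mono (by simp [NExp.cost, RExp.cost]) fun _ h => h
    have e3' : s'.real 3 = w := by
      rw [hF.real 3 rfl, State.writeReal_real_of_ne _ (by norm_num), e3]
    simp [RExp.eval, NExp.eval, hI, hc, e3', Finset.sum_range_succ]
  · simp [hF₂.nat 0 rfl, e0, hn]
  · simp [RExp.eval, NExp.eval]
  · intro m s' hm hI hc hF
    have e3' : s'.real 3 = w := by
      rw [hF.real 3 rfl]
      simp only [State.writeNat_real]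
      rw [State.writeReal_real_of_ne _ (by norm_num), State.writeReal_real_of_ne _ (by norm_num),
        hF₂.real 3 rfl, State.writeReal_real_of_ne _ (by norm_num), e3]
    have e13 : s'.real 13 0 = u := by
      have e31 : s₂.nat 31 0 = bitsVal l := by rw [hF₂.nat 31 rfl, State.writeReal_nat, h31]
      have e10 : s₂.real 10 0 = 2 ^ B := by
        rw [hF₂.real 10 rfl, State.writeReal_real_of_ne _ (by norm_num), h10, hl]
      rw [hF.real 13 rfl]
      simp [RExp.eval, NExp.eval, e31, e10, h₂, hu]
    have e0' : s'.nat 0 1 = d := by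
      rw [hF.nat 0 rfl]
      simp [hF₂.nat 0 rfl, e0, hd]
    refine (Hoare.seq_nil (T := 21) (T' := 17)
      (Q := fun s₃ => ∀ i < m + 1, ∑ j ∈ Finset.range i, w j ≤ u →
          u < ∑ j ∈ Finset.range (i + 1), w j → s₃.nat 32 0 = i * d) ?_
      fun s₃ h₃ hF₃ => (Hoare.setReal_seq (Hoare.setNat ?_)).mono
        (by simp [NExp.cost, RExp.cost]) fun _ h => h).mono (by norm_num) fun _ h => h
    · refine (Hoare.cond (T := 4) (fun hb => (Hoare.setNat ?_).mono (by simp [NExp.cost])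
        fun _ h => h) fun hb => (Hoare.skip ?_).mono (by norm_num) fun _ h => h).mono
          (by simp [BExp.cost, NExp.cost, RExp.cost]) fun _ h => h
      · simp only [BExp.Holds, RExp.eval, NExp.eval, hc, e13, hI.1, e3', not_lt] at hb
        intro i hi h1 h2
        -- The intervals are disjoint, so a hit in round `m` excludes every earlier index.
        have him : i = m := by
          rcases Nat.lt_succ_iff_lt_or_eq.1 hi with h | h
          · have := hmono (i + 1) m h hm.le
            linarith [hb.1]
          · exact h
        simp [NExp.eval, hI.2.1, him]
      · simp only [BExp.Holds, RExp.eval, NExp.eval, hc, e13, hI.1, e3', not_lt] at hb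
        intro i hi h1 h2
        rcases Nat.lt_succ_iff_lt_or_eq.1 hi with h | rfl
        · exact hI.2.2 i h h1 h2
        · rw [Finset.sum_range_succ] at h2
          exact absurd ⟨h1, h2⟩ hb
    · have e14 : s₃.real 14 0 = ∑ i ∈ Finset.range m, w i := by rw [hF₃.real 14 rfl, hI.1]
      have e33 : s₃.nat 33 0 = m * d := by rw [hF₃.nat 33 rfl, hI.2.1]
      have e20 : s₃.nat 20 0 = m := by rw [hF₃.nat 20 rfl, hc]
      have e3'' : s₃.real 3 = w := by rw [hF₃.real 3 rfl, e3']
      have e01 : s₃.nat 0 1 = d := by rw [hF₃.nat 0 rfl, e0']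
      refine ⟨?_, ?_, ?_⟩
      · simp [RExp.eval, NExp.eval, e14, e20, e3'', Finset.sum_range_succ]
      · simp [NExp.eval, e33, e01]; ring
      · intro i hi h1 h2
        have := h₃ i hi h1 h2
        simp [NExp.eval, this]
  · simp [NExp.cost, RExp.cost]
    omega
  · exact fun s' h => h.2.2

end MinLoad

/-! ### Growing a good pool with a definite probability -/

namespace MinLoad

open RealRAM Metric

/-- The parameters of the algorithm: the number of points, the dimension, the number of centers,
the number of steps for a center, the number of samples, and the number of bits of a guess. -/
structure Params where
  n : ℕ
  d : ℕ
  k : ℕ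
  J : ℕ
  S : ℕ
  h : ℕ
  ε : ℝ
  n_pos : 1 ≤ n
  d_pos : 1 ≤ d

/-- The parameters are where the program expects them. -/
structure Params.Stored (A : Params) (s : State) : Prop where
  n : s.nat 0 0 = A.n
  d : s.nat 0 1 = A.d
  k : s.nat 0 2 = A.k
  J : s.nat 11 0 = A.J
  S : s.nat 12 0 = A.S
  h : s.nat 13 0 = A.h
  B : s.nat 16 0 = A.n + A.h
  nd : s.nat 17 0 = A.n * A.d
  ε : s.real 0 0 = A.ε

theorem Params.Stored.congr {A : Params} {s s' : State} (h : A.Stored s)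
    (h0 : s'.nat 0 = s.nat 0) (h1 : s'.nat 11 = s.nat 11) (h2 : s'.nat 12 = s.nat 12)
    (h3 : s'.nat 13 = s.nat 13) (h4 : s'.nat 16 = s.nat 16) (h5 : s'.nat 17 = s.nat 17)
    (h6 : s'.real 0 = s.real 0) : A.Stored s' := by
  obtain ⟨a, b, c, d, e, f, g, i, j⟩ := h
  constructor <;> simp only [h0, h1, h2, h3, h4, h5, h6] <;> assumption

/-- Some pairs of points in the pool are distinct. -/
def TwoPoints (d : ℕ) (s : State) : Prop := ∃ y ∈ poolSet d s, ∃ y' ∈ poolSet d s, y ≠ y'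

/-- Sample a point and put it into the pool. -/
def samplePush : Prog := .seq sample push

/-- Start a pool with the first point and the auxiliary point behind the input. -/
def startPool : Prog :=
  .seq clearPool (.seq (assign 32 (.lit 0)) (.seq push (.seq (assign 32 (var 17)) push)))

/-- Build a pool by sampling. -/
def growPool : Prog := .seq startPool (forLoop 22 12 0 samplePush)

/-- Time for a sample. -/
def Params.sampleTime (A : Params) : ℕ := 450 * (A.n * A.d) + 40 * A.h

section

variable {A : Params} {s : State}

theorem PoolOK.weights_nonneg {n d : ℕ} {s : State} (h : PoolOK n d s)
    (hne : (poolSet d s).Nonempty) : ∀ i < n, s.real 3 i =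
      infDist (readPt d (s.real 1) (i * d)) (poolSet d s) := by
  intro i hi
  rcases h i hi with ⟨h0, -⟩ | ⟨-, h⟩
  · exact absurd h0 hne.ne_empty
  · exact h

/-- A sample goes into the pool. -/
theorem samplePush_spec (hA : A.Stored s) (hP : PoolOK A.n A.d s)
    (hne : (poolSet A.d s).Nonempty) {l : List Bool} (hl : l.length = A.n + A.h) :
    Hoare samplePush s l A.sampleTime (fun s' => PoolOK A.n A.d s' ∧
      s'.nat 34 0 = s.nat 34 0 + 1 ∧
      ∃ y, poolSet A.d s' = insert y (poolSet A.d s) ∧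
        ∀ i < A.n, ∑ j ∈ Finset.range i, s.real 3 j ≤
          (bitsVal l : ℝ) / 2 ^ (A.n + A.h) * ∑ i ∈ Finset.range A.n, s.real 3 i →
        (bitsVal l : ℝ) / 2 ^ (A.n + A.h) * ∑ i ∈ Finset.range A.n, s.real 3 i
          < ∑ j ∈ Finset.range (i + 1), s.real 3 j → y = readPt A.d (s.real 1) (i * A.d)) := by
  have hn1 := A.n_pos
  have hd1 := A.d_pos
  have hs := sample_spec (n := A.n) (d := A.d) hA.n hA.d hA.B hl fun i hi => by
    rw [hP.weights_nonneg hne i hi]; exact infDist_nonneg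
  have hnd : A.n ≤ A.n * A.d := Nat.le_mul_of_pos_right _ hd1
  suffices H : Hoare samplePush s (l ++ []) (40 * (A.n + A.h) + 100 * A.n + 100 +
      170 * (A.n * A.d)) (fun s' => PoolOK A.n A.d s' ∧
      s'.nat 34 0 = s.nat 34 0 + 1 ∧
      ∃ y, poolSet A.d s' = insert y (poolSet A.d s) ∧
        ∀ i < A.n, ∑ j ∈ Finset.range i, s.real 3 j ≤
          (bitsVal l : ℝ) / 2 ^ (A.n + A.h) * ∑ i ∈ Finset.range A.n, s.real 3 i →
        (bitsVal l : ℝ) / 2 ^ (A.n + A.h) * ∑ i ∈ Finset.range A.n, s.real 3 i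
          < ∑ j ∈ Finset.range (i + 1), s.real 3 j →
            y = readPt A.d (s.real 1) (i * A.d)) by
    rw [List.append_nil] at H
    refine H.mono ?_ fun _ h => h
    unfold Params.sampleTime
    omega
  refine Hoare.seq hs.frame ?_
  rintro s₁ ⟨h₁, hF₁⟩
  have e34 : s₁.nat 34 = s.nat 34 := hF₁.nat 34 rfl
  have e1 : s₁.real 1 = s.real 1 := hF₁.real 1 rfl
  have ep : poolSet A.d s₁ = poolSet A.d s := poolSet_congr e34 (hF₁.nat 2 rfl) e1
  refine (push_spec (n := A.n) (d := A.d) (by rw [hF₁.nat 0 rfl, hA.n])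
    (by rw [hF₁.nat 0 rfl, hA.d]) hn1 hd1
    (hP.congr e34 (hF₁.nat 2 rfl) e1 (hF₁.real 3 rfl))).mono le_rfl ?_
  rintro s₂ ⟨h1, h2, h3⟩
  refine ⟨h1, by rw [h3, e34], _, by rw [h2, ep], ?_⟩
  intro i hi h4 h5
  rw [h₁ i hi h4 h5, e1]

/-- When the auxiliary point differs from the first point, the pool has two distinct points even if
the input is a single point. The later shift of the centers needs such a nonzero direction. -/
theorem startPool_spec (hA : A.Stored s) :
    Hoare startPool s [] (450 * (A.n * A.d)) (fun s' => PoolOK A.n A.d s' ∧ s'.nat 34 0 = 2 ∧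
      poolSet A.d s' = {readPt A.d (s.real 1) (A.n * A.d), readPt A.d (s.real 1) 0}) := by
  have hn1 := A.n_pos
  have hd1 := A.d_pos
  have hnd : A.n ≤ A.n * A.d := Nat.le_mul_of_pos_right _ hd1
  refine (Hoare.seq_nil (clearPool_spec (d := A.d) hA.n) fun s₁ h₁ hF₁ => Hoare.setNat_seq
    (Hoare.seq_nil (push_spec (n := A.n) (d := A.d) ?_ ?_ hn1 hd1 ?_) fun s₂ h₂ hF₂ =>
      Hoare.setNat_seq ((push_spec (n := A.n) (d := A.d) ?_ ?_ hn1 hd1 ?_).mono le_rfl ?_))).mono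
    ?_ fun _ h => h
  · simp [hF₁.nat 0 rfl, hA.n]
  · simp [hF₁.nat 0 rfl, hA.d]
  · exact h₁.1
  · simp [hF₂.nat 0 rfl, hF₁.nat 0 rfl, hA.n]
  · simp [hF₂.nat 0 rfl, hF₁.nat 0 rfl, hA.d]
  · exact h₂.1
  · rintro s₃ ⟨h1, h2, h3⟩
    refine ⟨h1, ?_, ?_⟩
    · rw [h3]
      simp [h₂.2.2, h₁.2]
    · rw [h2]
      have p0 : poolSet A.d s₁ = ∅ := by
        unfold poolSet; rw [h₁.2]; simp
      have e1 : poolSet A.d (s₂.writeNat 32 ((NExp.lit 0).eval s₂) ((var 17).eval s₂)) =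
          {readPt A.d (s.real 1) 0} := by
        refine (poolSet_congr (s := s₂) (by rfl) (by rfl) (by rfl)).trans (h₂.2.1.trans ?_)
        rw [show poolSet A.d (s₁.writeNat 32 ((NExp.lit 0).eval s₁) ((NExp.lit 0).eval s₁)) = ∅
          from p0]
        simp [NExp.eval, hF₁.real 1 rfl]
      rw [e1]
      have e17 : s₂.nat 17 0 = A.n * A.d := by
        rw [hF₂.nat 17 rfl]
        simp [hF₁.nat 17 rfl, hA.nd]
      have er : s₂.real 1 = s.real 1 := (hF₂.real 1 rfl).trans (hF₁.real 1 rfl)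
      simp [NExp.eval, e17, er]
  · simp only [NExp.cost]
    omega

/-- Time for building a pool. -/
def Params.growTime (A : Params) : ℕ := 450 * (A.n * A.d) + (A.S * (A.sampleTime + 12) + 9)

theorem growPool_all (hA : A.Stored s) :
    All growPool s A.growTime (A.S * (A.n + A.h)) (fun s' => PoolOK A.n A.d s' ∧
      s'.nat 34 0 = A.S + 2) := by
  have := All.seq (startPool_spec hA).all fun s₁ h₁ hF₁ => All.forLoop (i := 22) (a := 12) (c := 0)
    (p := samplePush) (s := s₁) (N := A.S) (T := A.sampleTime) (B := A.n + A.h)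
    (I := fun m s' => PoolOK A.n A.d s' ∧ s'.nat 34 0 = m + 2) (by rfl) (by rfl)
    (by rw [hF₁.nat 12 rfl, hA.S]) ⟨h₁.1, by simp [h₁.2.1]⟩ ?_
  · rw [Nat.zero_add] at this
    exact this.mono le_rfl fun s' h => ⟨h.1, by rw [h.2]⟩
  · intro m s' hm hI hc hF l hl
    have hA' : A.Stored s' := hA.congr ((hF.nat 0 rfl).trans (hF₁.nat 0 rfl))
      ((hF.nat 11 rfl).trans (hF₁.nat 11 rfl)) ((hF.nat 12 rfl).trans (hF₁.nat 12 rfl))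
      ((hF.nat 13 rfl).trans (hF₁.nat 13 rfl)) ((hF.nat 16 rfl).trans (hF₁.nat 16 rfl))
      ((hF.nat 17 rfl).trans (hF₁.nat 17 rfl)) ((hF.real 0 rfl).trans (hF₁.real 0 rfl))
    refine (samplePush_spec hA' hI.1 ⟨_, 0, by omega, rfl⟩ hl).mono le_rfl ?_
    rintro s'' ⟨h1, h2, -⟩
    refine ⟨h1, ?_⟩
    simp only [State.writeNat_nat]
    simp [h2, hI.2]

/-- With some luck, the pool becomes good enough for all clusters. -/
theorem growPool_luck (hA : A.Stored s) {K : Clusters (Pt A.d) A.k} {P : Finset (Pt A.d)} {e L : ℝ}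
    (hPO : ∀ x, x ∈ P ↔ ∃ i, x ∈ K.O i) (hdisj : ∀ i j, i ≠ j → Disjoint (K.O i) (K.O j))
    (hinj : Set.InjOn (fun i => readPt A.d (s.real 1) (i * A.d)) (Finset.range A.n))
    (hPx : P = (Finset.range A.n).image (fun i => readPt A.d (s.real 1) (i * A.d)))
    (h2 : readPt A.d (s.real 1) (A.n * A.d) ≠ readPt A.d (s.real 1) 0)
    (he : 0 < e) (he1 : e ≤ 1) (hN : 256 ≤ ((2 ^ A.h : ℕ) : ℝ) * e ^ 2)
    (hJ : 3072 < A.J * e ^ 2) (hL : 1 ≤ L * e ^ 2) (hh : 1920 * A.k * L ≤ 2 ^ A.h)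
    (hS : A.k + A.k * A.J + 2 ≤ A.S) :
    Luck growPool s A.growTime (A.S * (A.n + A.h)) (((1 / 2) ^ A.h) ^ A.S) (fun s' =>
      s'.nat 34 0 = A.S + 2 ∧ K.Done (2 ^ A.h) A.J e (poolSet A.d s')) := by
  classical
  -- The invariant says that after `m` samples the pool is good enough or its potential is at least
  -- `m`. A good pool stays good, and after `S` samples the second alternative contradicts
  -- `potential_le`.
  have := Luck.seq (q := 1) (q' := ((1 / 2) ^ A.h) ^ A.S) (by positivity)
    (startPool_spec hA).all.luck fun s₁ h₁ hF₁ => Luck.forLoop (i := 22) (a := 12) (c := 0)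
    (p := samplePush) (s := s₁) (N := A.S) (T := A.sampleTime) (B := A.n + A.h)
    (q := (1 / 2) ^ A.h)
    (I := fun m s' => PoolOK A.n A.d s' ∧ s'.nat 34 0 = m + 2 ∧ TwoPoints A.d s' ∧
      (K.Done (2 ^ A.h) A.J e (poolSet A.d s') ∨
        m ≤ K.potential (2 ^ A.h) A.J e (poolSet A.d s'))) (by positivity) (by rfl) (by rfl)
    (by rw [hF₁.nat 12 rfl, hA.S]) ⟨h₁.1, by simp [h₁.2.1], ?_, .inr (Nat.zero_le _)⟩ ?_
  · rw [Nat.zero_add, one_mul] at this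
    refine this.mono le_rfl le_rfl fun s' h => ⟨h.2.1, ?_⟩
    rcases h.2.2.2 with h | h
    · exact h
    · have := K.potential_le (2 ^ A.h) A.J e (poolSet A.d s')
      omega
  · have : poolSet A.d (s₁.writeNat 22 0 0) = poolSet A.d s₁ := poolSet_congr rfl rfl rfl
    unfold TwoPoints
    rw [this, h₁.2.2]
    exact ⟨_, .inl rfl, _, .inr rfl, h2⟩
  · intro m s' hm hI hc hF
    have hA' : A.Stored s' := hA.congr ((hF.nat 0 rfl).trans (hF₁.nat 0 rfl))
      ((hF.nat 11 rfl).trans (hF₁.nat 11 rfl)) ((hF.nat 12 rfl).trans (hF₁.nat 12 rfl))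
      ((hF.nat 13 rfl).trans (hF₁.nat 13 rfl)) ((hF.nat 16 rfl).trans (hF₁.nat 16 rfl))
      ((hF.nat 17 rfl).trans (hF₁.nat 17 rfl)) ((hF.real 0 rfl).trans (hF₁.real 0 rfl))
    have e1 : s'.real 1 = s.real 1 := (hF.real 1 rfl).trans (hF₁.real 1 rfl)
    obtain ⟨hP, hlen, htwo, hprog⟩ := hI
    have hne : (poolSet A.d s').Nonempty := let ⟨y, hy, _⟩ := htwo; ⟨y, hy⟩
    have hw := hP.weights_nonneg hne
    set C := poolSet A.d s' with hC
    set w := s'.real 3 with hwdef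
    have hpost : ∀ (s'' : State) (y : Pt A.d), PoolOK A.n A.d s'' → s''.nat 34 0 = s'.nat 34 0 + 1 →
        poolSet A.d s'' = insert y C →
        (K.Done (2 ^ A.h) A.J e (insert y C) ∨
          m + 1 ≤ K.potential (2 ^ A.h) A.J e (insert y C)) →
        PoolOK A.n A.d (s''.writeNat 22 0 (m + 1)) ∧
          (s''.writeNat 22 0 (m + 1)).nat 34 0 = m + 1 + 2 ∧
          TwoPoints A.d (s''.writeNat 22 0 (m + 1)) ∧
          (K.Done (2 ^ A.h) A.J e (poolSet A.d (s''.writeNat 22 0 (m + 1))) ∨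
            m + 1 ≤ K.potential (2 ^ A.h) A.J e (poolSet A.d (s''.writeNat 22 0 (m + 1)))) := by
      intro s'' y g1 g2 g3 g4
      have g5 : poolSet A.d (s''.writeNat 22 0 (m + 1)) = insert y C :=
        (poolSet_congr rfl rfl rfl).trans g3
      refine ⟨g1, ?_, ?_, by rw [g5]; exact g4⟩
      · simp only [State.writeNat_nat]
        simp [g2, hlen]
      · unfold TwoPoints
        rw [g5]
        obtain ⟨z, hz, z', hz', hzz⟩ := htwo
        exact ⟨z, .inr hz, z', .inr hz', hzz⟩
    by_cases hd : K.Done (2 ^ A.h) A.J e C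
    · refine Luck.mono (T := A.sampleTime) (q := 1) ?_ le_rfl
        (pow_le_one₀ (by norm_num) (by norm_num)) fun _ h => h
      refine All.luck fun l hl => (samplePush_spec hA' hP hne hl).mono le_rfl ?_
      rintro s'' ⟨g1, g2, y, g3, -⟩
      exact hpost s'' y g1 g2 g3 (.inl (hd.mono (Set.subset_insert y C)))
    · have hm' := hprog.resolve_left hd
      obtain ⟨G, hGP, hW0, hWG, hG⟩ := Clusters.exists_progress (K := K) hPO hdisj
        (finite_poolSet A.d s') htwo he he1 (by exact_mod_cast hN) hJ hL hd
      set G' := (Finset.range A.n).filter fun i => readPt A.d (s.real 1) (i * A.d) ∈ G with hG'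
      have hsumP : ∑ x ∈ P, infDist x C = ∑ i ∈ Finset.range A.n, w i := by
        rw [hPx, Finset.sum_image hinj]
        refine Finset.sum_congr rfl fun i hi => ?_
        rw [hw i (Finset.mem_range.1 hi), e1]
      have hsumG : ∑ x ∈ G, infDist x C = ∑ i ∈ G', w i := by
        have hGi : G = G'.image fun i => readPt A.d (s.real 1) (i * A.d) := by
          ext z
          constructor
          · intro hz
            have := hGP hz
            rw [hPx] at this
            obtain ⟨i, hi, rfl⟩ := Finset.mem_image.1 this
            exact Finset.mem_image.2 ⟨i, Finset.mem_filter.2 ⟨hi, hz⟩, rfl⟩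
          · intro hz
            obtain ⟨i, hi, rfl⟩ := Finset.mem_image.1 hz
            exact (Finset.mem_filter.1 hi).2
        rw [hGi, Finset.sum_image (hinj.mono (Finset.coe_subset.2 (Finset.filter_subset _ _)))]
        refine Finset.sum_congr rfl fun i hi => ?_
        rw [hw i (Finset.mem_range.1 (Finset.mem_filter.1 hi).1), e1]
      rw [hsumP] at hW0 hWG
      rw [hsumG] at hWG
      have hpick := le_bitProb_pick (B := A.n + A.h) w
        (fun i hi => by rw [hw i hi]; exact infDist_nonneg) hW0 G'
        (fun i hi => Finset.mem_range.1 (Finset.mem_filter.1 hi).1)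
      refine le_trans ?_ (hpick.trans (bitProb_mono fun l hl hA1 => ?_))
      · set W := ∑ i ∈ Finset.range A.n, w i with hWd
        set g := ∑ i ∈ G', w i with hgd
        have p2 : (0 : ℝ) < (1 / 2) ^ A.h := by positivity
        have hpow : (2 : ℝ) ^ A.h * (1 / 2) ^ A.h = 1 := by rw [← mul_pow]; norm_num
        -- A sample uses `n + h` bits, so the rounding error is at most half of the lower bound in
        -- `hg`. The crude estimate `n ≤ 2 ^ n` avoids computing a logarithm of `n`.
        have hn : (A.n : ℝ) * (1 / 2) ^ (A.n + A.h) ≤ (1 / 2) ^ A.h := by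
          have : (A.n : ℝ) ≤ 2 ^ A.n := by exact_mod_cast Nat.lt_two_pow_self.le
          have h3 : (2 : ℝ) ^ A.n * (1 / 2) ^ A.n = 1 := by rw [← mul_pow]; norm_num
          rw [pow_add, ← mul_assoc]
          have : (A.n : ℝ) * (1 / 2) ^ A.n ≤ 2 ^ A.n * (1 / 2) ^ A.n := by gcongr
          rw [h3] at this
          nlinarith
        have hg : 2 * (1 / 2) ^ A.h ≤ g / W := by
          rw [le_div_iff₀ hW0]
          have hg0 : 0 ≤ g := by
            refine Finset.sum_nonneg fun i hi => ?_
            rw [hw i (Finset.mem_range.1 (Finset.mem_filter.1 hi).1)]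
            exact infDist_nonneg
          have h4 : 2 * W ≤ 2 ^ A.h * g := by
            have : 1920 * A.k * L * g ≤ 2 ^ A.h * g := by gcongr
            linarith
          calc 2 * (1 / 2 : ℝ) ^ A.h * W = (1 / 2) ^ A.h * (2 * W) := by ring
            _ ≤ (1 / 2) ^ A.h * (2 ^ A.h * g) := by gcongr
            _ = g := by rw [← mul_assoc, mul_comm ((1 / 2 : ℝ) ^ A.h), hpow, one_mul]
        linarith
      · refine (samplePush_spec hA' hP hne hl).mono le_rfl ?_
        rintro s'' ⟨g1, g2, y, g3, g4⟩
        obtain ⟨i, hi, hi1, hi2⟩ := hA1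
        obtain ⟨hin, hiG⟩ := Finset.mem_filter.1 hi
        have hy := g4 i (Finset.mem_range.1 hin) hi1 hi2
        rw [e1] at hy
        refine hpost s'' y g1 g2 g3 (.inr ?_)
        have : K.potential (2 ^ A.h) A.J e C < K.potential (2 ^ A.h) A.J e (insert y C) :=
          hG y (hy ▸ hiG)
        omega

end

end MinLoad

/-! ### Guessing centers -/

/-- Sequential composition when the second part uses no coins. -/
theorem RealRAM.Hoare.seq_det {p q : RealRAM.Prog} {s : RealRAM.State} {l : List Bool} {T T' : ℕ}
    {Q Q' : RealRAM.State → Prop} (h : Hoare p s l T Q)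
    (h' : ∀ s', Q s' → Frame p s s' → Hoare q s' [] T' Q') : Hoare (.seq p q) s l (T + T') Q' := by
  have := h.frame.seq (l' := []) fun s' hs' => h' s' hs'.1 hs'.2
  rwa [List.append_nil] at this

namespace MinLoad

open RealRAM Metric

/-- Let variable `a` point to a random point of the pool. -/
def guess (a : ℕ) : Prog := .seq (randomBits 13) (assign a (.get 2 (var 31)))

/-- Put a random fraction into the real variable `15`. -/
def guessFraction : Prog :=
  .seq (randomBits 13) (rassign 15 (.div (.ofNat (var 31)) (rvar 10)))

/-- Coordinate of the center under construction. -/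
def centerCoord : RExp := .get 2 (.add (var 38) (var 21))

/-- Coordinate of the point that variable `a` points to. -/
def pointCoord (a : ℕ) : RExp := .get 1 (.add (var a) (var 21))

/-- Start a center at a random point of the pool. -/
def startCenter : Prog := .seq (guess 32) (writePt 2 38 (pointCoord 32))

/-- Move the center some part of the way towards a random point of the pool. -/
def moveCenter : Prog :=
  .seq (guess 32) (.seq guessFraction (writePt 2 38
    (.add centerCoord (.mul (rvar 15) (.sub (pointCoord 32) centerCoord)))))

/-- Shift the center by a random small multiple of the difference of two points of the pool. -/
def shiftCenter : Prog :=
  .seq guessFraction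
    (.seq (rassign 15 (.mul (rvar 15) (.div (rvar 0)
      (.mul (.mul (.ofNat (.lit 10)) (.ofNat (.get 0 (.lit 2)))) (.ofNat (.get 0 (.lit 0)))))))
    (writePt 2 38 (.add centerCoord (.mul (rvar 15) (.sub (pointCoord 35) (pointCoord 36))))))

/-- Build a center. -/
def makeCenter : Prog :=
  .seq startCenter (.seq (forLoop 25 11 0 moveCenter)
    (.seq shiftCenter (assign 38 (.add (var 38) (.get 0 (.lit 1))))))

/-- Build a tuple of centers. -/
def makeCenters : Prog :=
  .seq (guess 35) (.seq (guess 36) (.seq (assign 38 (var 37)) (forLoop 24 0 2 makeCenter)))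

/-- The string `l` may also encode an index beyond the pool; such a guess is merely useless. As the
pool has at most `2 ^ h` entries, each of them is hit by some string. -/
theorem guess_spec {s : State} {a h : ℕ} {l : List Bool} (hh : s.nat 13 0 = h)
    (hl : l.length = h) :
    Hoare (guess a) s l (40 * h + 30) (fun s' => s'.nat a 0 = s.nat 2 (bitsVal l)) := by
  refine ((randomBits_spec (s := s) (a := 13) (l := l) (by rw [hh, hl]) (by norm_num)
    (by norm_num) (by norm_num)).seq_det fun s₁ h₁ hF₁ => Hoare.setNat ?_).mono ?_ fun _ h => h
  · simp [NExp.eval, h₁.1, hF₁.nat 2 rfl]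
  · simp only [NExp.cost]
    omega

theorem guessFraction_spec {s : State} {h : ℕ} {l : List Bool} (hh : s.nat 13 0 = h)
    (hl : l.length = h) :
    Hoare guessFraction s l (40 * h + 30) (fun s' => s'.real 15 0 = (bitsVal l : ℝ) / 2 ^ h) := by
  refine ((randomBits_spec (s := s) (a := 13) (l := l) (by rw [hh, hl]) (by norm_num)
    (by norm_num) (by norm_num)).seq_det fun s₁ h₁ hF₁ => Hoare.setReal ?_).mono ?_ fun _ h => h
  · simp [NExp.eval, RExp.eval, h₁.1, h₁.2, hl]
  · simp only [NExp.cost, RExp.cost]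
    omega

/-- The part of the output before the center under construction is left alone. -/
def KeepsOutput (s s' : State) : Prop := ∀ m < s.nat 38 0, s'.real 2 m = s.real 2 m

theorem startCenter_spec {s : State} {d h : ℕ} {l : List Bool} (hd : s.nat 0 1 = d) (hd1 : 1 ≤ d)
    (hh : s.nat 13 0 = h) (hl : l.length = h) :
    Hoare startCenter s l (40 * h + 70 * d) (fun s' =>
      readPt d (s'.real 2) (s.nat 38 0) = readPt d (s.real 1) (s.nat 2 (bitsVal l)) ∧
      KeepsOutput s s') := by
  refine ((guess_spec (a := 32) hh hl).seq_det fun s₁ h₁ hF₁ => (writePt_spec (s := s₁) (A := 2)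
    (q := 38) (e := pointCoord 32) (d := d) (f := fun c => s.real 1 (s.nat 2 (bitsVal l) + c))
    (by rw [hF₁.nat 0 rfl, hd]) hd1 (by norm_num) ?_).mono le_rfl ?_).mono ?_ fun _ h => h
  · intro c s' _ hc hF _
    simp [pointCoord, RExp.eval, NExp.eval, hc, hF.real 1 rfl, hF.nat 32 rfl, h₁,
      hF₁.real 1 rfl]
  · rintro s' ⟨g1, g2⟩
    rw [hF₁.nat 38 rfl] at g1 g2
    exact ⟨readPt_congr g1, fun m hm => by rw [g2 m (.inl hm), hF₁.real 2 rfl]⟩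
  · simp only [pointCoord, RExp.cost, NExp.cost]
    omega

theorem moveCenter_spec {s : State} {d h : ℕ} {l₁ l₂ : List Bool} (hd : s.nat 0 1 = d)
    (hd1 : 1 ≤ d) (hh : s.nat 13 0 = h) (hl₁ : l₁.length = h) (hl₂ : l₂.length = h) :
    Hoare moveCenter s (l₁ ++ l₂) (80 * h + 150 * d) (fun s' =>
      readPt d (s'.real 2) (s.nat 38 0) = readPt d (s.real 2) (s.nat 38 0) +
        ((bitsVal l₂ : ℝ) / 2 ^ h) • (readPt d (s.real 1) (s.nat 2 (bitsVal l₁)) -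
          readPt d (s.real 2) (s.nat 38 0)) ∧
      KeepsOutput s s') := by
  set f : ℕ → ℝ := fun c => s.real 2 (s.nat 38 0 + c) + (bitsVal l₂ : ℝ) / 2 ^ h *
    (s.real 1 (s.nat 2 (bitsVal l₁) + c) - s.real 2 (s.nat 38 0 + c)) with hf
  refine ((guess_spec (a := 32) hh hl₁).frame.seq fun s₁ h₁ => (guessFraction_spec (s := s₁)
    (h := h) (by rw [h₁.2.nat 13 rfl, hh]) hl₂).seq_det fun s₂ h₂ hF₂ => (writePt_spec (s := s₂)
    (A := 2) (q := 38) (d := d) (f := f)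
    (by rw [hF₂.nat 0 rfl, h₁.2.nat 0 rfl, hd]) hd1 (by norm_num) ?_).mono le_rfl ?_).mono ?_
      fun _ h => h
  · intro c s' _ hc hF hk
    have e38 : s₂.nat 38 = s.nat 38 := (hF₂.nat 38 rfl).trans (h₁.2.nat 38 rfl)
    have e2 : s₂.real 2 = s.real 2 := (hF₂.real 2 rfl).trans (h₁.2.real 2 rfl)
    have e1 : s'.real 1 = s.real 1 :=
      (hF.real 1 rfl).trans ((hF₂.real 1 rfl).trans (h₁.2.real 1 rfl))
    have e32 : s'.nat 32 0 = s.nat 2 (bitsVal l₁) := by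
      rw [hF.nat 32 rfl, hF₂.nat 32 rfl, h₁.1]
    have e15 : s'.real 15 0 = (bitsVal l₂ : ℝ) / 2 ^ h := by rw [hF.real 15 rfl, h₂]
    have e38' : s'.nat 38 0 = s.nat 38 0 := by rw [hF.nat 38 rfl, e38]
    have ec : s'.real 2 (s.nat 38 0 + c) = s.real 2 (s.nat 38 0 + c) := by
      rw [hk _ (.inr (by rw [e38])), e2]
    simp [pointCoord, centerCoord, RExp.eval, NExp.eval, hc, e1, e32, e15, e38', ec, hf]
  · rintro s' ⟨g1, g2⟩
    have e38 : s₂.nat 38 = s.nat 38 := (hF₂.nat 38 rfl).trans (h₁.2.nat 38 rfl)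
    have e2 : s₂.real 2 = s.real 2 := (hF₂.real 2 rfl).trans (h₁.2.real 2 rfl)
    rw [e38] at g1 g2
    refine ⟨?_, fun m hm => by rw [g2 m (.inl hm), e2]⟩
    ext c
    simp [readPt, g1 c c.2, hf]
  · simp only [pointCoord, centerCoord, RExp.cost, NExp.cost]
    omega

theorem shiftCenter_spec {A : Params} {s : State} {l : List Bool} (hA : A.Stored s)
    (hl : l.length = A.h) :
    Hoare shiftCenter s l (40 * A.h + 150 * A.d) (fun s' =>
      readPt A.d (s'.real 2) (s.nat 38 0) = readPt A.d (s.real 2) (s.nat 38 0) +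
        ((bitsVal l : ℝ) / 2 ^ A.h * (A.ε / (10 * A.k * A.n))) •
          (readPt A.d (s.real 1) (s.nat 35 0) - readPt A.d (s.real 1) (s.nat 36 0)) ∧
      KeepsOutput s s') := by
  have hd1 := A.d_pos
  set f : ℕ → ℝ := fun c => s.real 2 (s.nat 38 0 + c) +
    ((bitsVal l : ℝ) / 2 ^ A.h * (A.ε / (10 * A.k * A.n))) *
    (s.real 1 (s.nat 35 0 + c) - s.real 1 (s.nat 36 0 + c)) with hf
  refine ((guessFraction_spec hA.h hl).seq_det fun s₁ h₁ hF₁ => Hoare.setReal_seq ((writePt_spec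
    (A := 2) (q := 38) (d := A.d) (f := f) ?_ hd1 (by norm_num) ?_).mono le_rfl ?_)).mono ?_
      fun _ h => h
  · simp [hF₁.nat 0 rfl, hA.d]
  · intro c s' _ hc hF hk
    have e1 : s'.real 1 = s.real 1 := (hF.real 1 rfl).trans (hF₁.real 1 rfl)
    have e35 : s'.nat 35 = s.nat 35 := (hF.nat 35 rfl).trans (hF₁.nat 35 rfl)
    have e36 : s'.nat 36 = s.nat 36 := (hF.nat 36 rfl).trans (hF₁.nat 36 rfl)
    have e38 : s'.nat 38 = s.nat 38 := (hF.nat 38 rfl).trans (hF₁.nat 38 rfl)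
    have e15 : s'.real 15 0 = (bitsVal l : ℝ) / 2 ^ A.h * (A.ε / (10 * A.k * A.n)) := by
      rw [hF.real 15 rfl]
      simp [RExp.eval, NExp.eval, h₁, hF₁.real 0 rfl, hF₁.nat 0 rfl, hA.k, hA.n, hA.ε]
    have ec : s'.real 2 (s.nat 38 0 + c) = s.real 2 (s.nat 38 0 + c) := by
      rw [hk _ (.inr (by simp [hF₁.nat 38 rfl]))]
      simp [hF₁.real 2 rfl]
    simp [pointCoord, centerCoord, RExp.eval, NExp.eval, hc, e1, e35, e36, e15, e38, ec, hf]
  · rintro s' ⟨g1, g2⟩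
    simp only [State.writeReal_nat, hF₁.nat 38 rfl] at g1 g2
    refine ⟨?_, fun m hm => by rw [g2 m (.inl hm)]; simp [hF₁.real 2 rfl]⟩
    ext c
    simp [readPt, g1 c c.2, hf]
  · simp only [pointCoord, centerCoord, RExp.cost, NExp.cost]
    omega

/-- The definition of `reach` peels off the last step, whereas the program makes the first step
first. The sequence `f` serves as the invariant of its loop. -/
theorem exists_path {V : Type*} [NormedAddCommGroup V] [InnerProductSpace ℝ V] {N : ℕ} {C : Set V}
    {j : ℕ} {z : V} (hz : z ∈ reach N C j) :
    ∃ f : ℕ → V, f 0 ∈ C ∧ f j = z ∧ ∀ m < j, ∃ y ∈ C, ∃ a < N,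
      f (m + 1) = f m + ((a : ℝ) / N) • (y - f m) := by
  induction j generalizing z with
  | zero => exact ⟨fun _ => z, hz, rfl, fun m hm => absurd hm (Nat.not_lt_zero m)⟩
  | succ j ih =>
    obtain ⟨c, hc, y, hy, a, ha, rfl⟩ := hz
    obtain ⟨f, h0, hj, hf⟩ := ih hc
    refine ⟨fun m => if m ≤ j then f m else c + ((a : ℝ) / N) • (y - c), by simpa using h0,
      by simp, fun m hm => ?_⟩
    rcases Nat.lt_succ_iff_lt_or_eq.1 hm with h | rfl
    · obtain ⟨y', hy', a', ha', e⟩ := hf m h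
      refine ⟨y', hy', a', ha', ?_⟩
      simp only [if_pos h.le, if_pos (Nat.succ_le_of_lt h)]
      exact e
    · refine ⟨y, hy, a, ha, ?_⟩
      simp [hj]

/-- Time for a center. -/
def Params.centerTime (A : Params) : ℕ :=
  40 * A.h + 70 * A.d + ((A.J * (80 * A.h + 150 * A.d + 12) + 9) + (40 * A.h + 150 * A.d + 7))

/-- Number of coins for a center. -/
def Params.centerCoins (A : Params) : ℕ := A.h + (A.J * (A.h + A.h) + (A.h + 0))

/-- For unlucky coins: whatever is guessed, the pointer advances and the output before it survives.
-/
theorem makeCenter_all {A : Params} {s : State} (hA : A.Stored s) :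
    All makeCenter s A.centerTime A.centerCoins (fun s' =>
      s'.nat 38 0 = s.nat 38 0 + A.d ∧ KeepsOutput s s') := by
  have hd1 := A.d_pos
  refine All.seq (Q := KeepsOutput s) (fun l hl => (startCenter_spec hA.d hd1 hA.h hl).mono le_rfl
    fun _ h => h.2) fun s₁ h₁ hF₁ => All.seq (All.forLoop (N := A.J) (I := fun _ => KeepsOutput s)
      (by rfl) (by rfl) (by rw [hF₁.nat 11 rfl, hA.J]) h₁ ?_) fun s₂ h₂ hF₂ =>
        All.seq (Q := KeepsOutput s) (fun l hl => (shiftCenter_spec (A := A) ?_ hl).mono le_rfl ?_)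
          fun s₃ h₃ hF₃ => (Hoare.setNat ?_).all
  · intro m s' _ hI _ hF l hl
    have e : l = l.take A.h ++ l.drop A.h := (List.take_append_drop _ _).symm
    rw [e]
    refine (moveCenter_spec (d := A.d) (h := A.h) (by rw [hF.nat 0 rfl, hF₁.nat 0 rfl, hA.d]) hd1
      (by rw [hF.nat 13 rfl, hF₁.nat 13 rfl, hA.h]) (by simp; omega) (by simp; omega)).mono
      le_rfl ?_
    rintro s'' ⟨-, h⟩ m hm
    rw [State.writeNat_real, h m (by rwa [hF.nat 38 rfl, hF₁.nat 38 rfl]), hI m hm]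
  · exact hA.congr ((hF₂.nat 0 rfl).trans (hF₁.nat 0 rfl))
      ((hF₂.nat 11 rfl).trans (hF₁.nat 11 rfl)) ((hF₂.nat 12 rfl).trans (hF₁.nat 12 rfl))
      ((hF₂.nat 13 rfl).trans (hF₁.nat 13 rfl)) ((hF₂.nat 16 rfl).trans (hF₁.nat 16 rfl))
      ((hF₂.nat 17 rfl).trans (hF₁.nat 17 rfl)) ((hF₂.real 0 rfl).trans (hF₁.real 0 rfl))
  · rintro s' ⟨-, h⟩ m hm
    rw [h m (by rwa [hF₂.nat 38 rfl, hF₁.nat 38 rfl]), h₂ m hm]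
  · refine ⟨?_, h₃⟩
    simp [NExp.eval, hF₃.nat 38 rfl, hF₂.nat 38 rfl, hF₁.nat 38 rfl, hF₃.nat 0 rfl,
      hF₂.nat 0 rfl, hF₁.nat 0 rfl, hA.d]

theorem exists_coins_of_mem_poolSet {d h : ℕ} {s : State} (hS : s.nat 34 0 ≤ 2 ^ h) {y : Pt d}
    (hy : y ∈ poolSet d s) :
    ∃ l : List Bool, l.length = h ∧ readPt d (s.real 1) (s.nat 2 (bitsVal l)) = y := by
  obtain ⟨v, hv, rfl⟩ := hy
  obtain ⟨l, hl, e⟩ := exists_bitsVal_eq (h := h) (lt_of_lt_of_le hv hS)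
  exact ⟨l, hl, by rw [e]⟩

/-- All guesses have to be right: the start, then a point and a fraction for each of the `J` moves,
and the shift. At least one coin string does this, which is what the bound counts. -/
theorem makeCenter_luck {A : Params} {s : State} (hA : A.Stored s) (hS : s.nat 34 0 ≤ 2 ^ A.h)
    {z : Pt A.d} (hz : z ∈ reach (2 ^ A.h) (poolSet A.d s) A.J) {a : ℕ} (ha : a < 2 ^ A.h) :
    Luck makeCenter s A.centerTime A.centerCoins ((1 / 2) ^ A.centerCoins) (fun s' =>
      s'.nat 38 0 = s.nat 38 0 + A.d ∧ KeepsOutput s s' ∧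
      readPt A.d (s'.real 2) (s.nat 38 0) = z +
        ((a : ℝ) / (2 ^ A.h : ℕ) * (A.ε / (10 * A.k * A.n))) •
          (readPt A.d (s.real 1) (s.nat 35 0) - readPt A.d (s.real 1) (s.nat 36 0))) := by
  have hd1 := A.d_pos
  obtain ⟨f, hf0, hfJ, hf⟩ := exists_path hz
  have eq : (1 / 2 : ℝ) ^ A.centerCoins =
      (1 / 2) ^ A.h * (((1 / 2) ^ (A.h + A.h)) ^ A.J * ((1 / 2) ^ A.h * 1)) := by
    unfold Params.centerCoins
    rw [pow_add, pow_add, Nat.add_zero, mul_one, ← pow_mul (1 / 2 : ℝ) (A.h + A.h) A.J,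
      Nat.mul_comm A.J]
  rw [eq]
  obtain ⟨l₀, hl₀, e₀⟩ := exists_coins_of_mem_poolSet hS hf0
  obtain ⟨l₃, hl₃, e₃⟩ := exists_bitsVal_eq ha
  refine Luck.seq (Q := fun s' => KeepsOutput s s' ∧ readPt A.d (s'.real 2) (s.nat 38 0) = f 0)
    (by positivity) (Luck.of_hoare hl₀ ((startCenter_spec hA.d hd1 hA.h hl₀).mono le_rfl
    fun _ h => ⟨h.2, by rw [h.1, e₀]⟩)) fun s₁ h₁ hF₁ => Luck.seq (by positivity)
      (Luck.forLoop (N := A.J)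
      (I := fun m s' => KeepsOutput s s' ∧ readPt A.d (s'.real 2) (s.nat 38 0) = f m)
      (by positivity) (by rfl) (by rfl) (by rw [hF₁.nat 11 rfl, hA.J]) h₁ ?_) fun s₂ h₂ hF₂ =>
        Luck.seq (Q := fun s' => KeepsOutput s s' ∧
          readPt A.d (s'.real 2) (s.nat 38 0) = z +
        ((a : ℝ) / (2 ^ A.h : ℕ) * (A.ε / (10 * A.k * A.n))) •
          (readPt A.d (s.real 1) (s.nat 35 0) - readPt A.d (s.real 1) (s.nat 36 0)))
          zero_le_one (Luck.of_hoare hl₃ ((shiftCenter_spec (A := A) ?_ hl₃).mono le_rfl ?_))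
          fun s₃ h₃ hF₃ => (Hoare.setNat ?_).all.luck
  · intro m s' hm hI _ hF
    obtain ⟨y, hy, b, hb, e⟩ := hf m hm
    obtain ⟨l₁, hl₁, e₁⟩ := exists_coins_of_mem_poolSet hS hy
    obtain ⟨l₂, hl₂, e₂⟩ := exists_bitsVal_eq hb
    refine Luck.of_hoare (l := l₁ ++ l₂) (by simp [hl₁, hl₂]) ((moveCenter_spec (d := A.d)
      (h := A.h) (by rw [hF.nat 0 rfl, hF₁.nat 0 rfl, hA.d]) hd1
      (by rw [hF.nat 13 rfl, hF₁.nat 13 rfl, hA.h]) hl₁ hl₂).mono le_rfl ?_)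
    have e38 : s'.nat 38 = s.nat 38 := (hF.nat 38 rfl).trans (hF₁.nat 38 rfl)
    rintro s'' ⟨g1, g2⟩
    refine ⟨fun m hm => ?_, ?_⟩
    · rw [State.writeNat_real, g2 m (by rwa [e38]), hI.1 m hm]
    · rw [State.writeNat_real, ← e38, g1, e38, hI.2, e, hF.nat 2 rfl, hF₁.nat 2 rfl,
        hF.real 1 rfl, hF₁.real 1 rfl, e₁, e₂]
      push_cast
      rfl
  · exact hA.congr ((hF₂.nat 0 rfl).trans (hF₁.nat 0 rfl))
      ((hF₂.nat 11 rfl).trans (hF₁.nat 11 rfl)) ((hF₂.nat 12 rfl).trans (hF₁.nat 12 rfl))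
      ((hF₂.nat 13 rfl).trans (hF₁.nat 13 rfl)) ((hF₂.nat 16 rfl).trans (hF₁.nat 16 rfl))
      ((hF₂.nat 17 rfl).trans (hF₁.nat 17 rfl)) ((hF₂.real 0 rfl).trans (hF₁.real 0 rfl))
  · have e38 : s₂.nat 38 = s.nat 38 := (hF₂.nat 38 rfl).trans (hF₁.nat 38 rfl)
    rintro s' ⟨g1, g2⟩
    refine ⟨fun m hm => ?_, ?_⟩
    · rw [g2 m (by rwa [e38]), h₂.1 m hm]
    · rw [← e38, g1, e38, h₂.2, hfJ, hF₂.nat 35 rfl, hF₁.nat 35 rfl, hF₂.nat 36 rfl,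
        hF₁.nat 36 rfl, hF₂.real 1 rfl, hF₁.real 1 rfl, e₃]
      push_cast
      rfl
  · refine ⟨?_, h₃.1, h₃.2⟩
    simp [NExp.eval, hF₃.nat 38 rfl, hF₂.nat 38 rfl, hF₁.nat 38 rfl, hF₃.nat 0 rfl,
      hF₂.nat 0 rfl, hF₁.nat 0 rfl, hA.d]

/-- Time for a tuple of centers. -/
def Params.tupleTime (A : Params) : ℕ :=
  40 * A.h + 30 + (40 * A.h + 30 + (4 + (A.k * (A.centerTime + 12) + 9)))

/-- Number of coins for a tuple of centers. -/
def Params.tupleCoins (A : Params) : ℕ := A.h + (A.h + (0 + A.k * A.centerCoins))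

theorem makeCenters_all {A : Params} {s : State} (hA : A.Stored s) :
    All makeCenters s A.tupleTime A.tupleCoins (fun s' =>
      s'.nat 38 0 = s.nat 37 0 + A.k * A.d ∧ ∀ m < s.nat 37 0, s'.real 2 m = s.real 2 m) := by
  refine All.seq (Q := fun _ => True) (fun l hl => (guess_spec hA.h hl).mono le_rfl
    fun _ _ => trivial) fun s₁ _ hF₁ => All.seq (Q := fun _ => True)
    (fun l hl => (guess_spec (by rw [hF₁.nat 13 rfl, hA.h]) hl).mono le_rfl
      fun _ _ => trivial) fun s₂ _ hF₂ => All.seq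
    (Hoare.setNat (Q := fun s' => s'.nat 38 0 = s.nat 37 0) ?_).all fun s₃ h₃ hF₃ => All.forLoop
    (N := A.k) (I := fun m s' => s'.nat 38 0 = s.nat 37 0 + m * A.d ∧
      ∀ m < s.nat 37 0, s'.real 2 m = s.real 2 m) (by rfl) (by rfl)
      (by rw [hF₃.nat 0 rfl, hF₂.nat 0 rfl, hF₁.nat 0 rfl, hA.k]) ?_ ?_
  · simp [NExp.eval, hF₂.nat 37 rfl, hF₁.nat 37 rfl]
  · refine ⟨by simp [h₃], fun m _ => ?_⟩
    rw [State.writeNat_real, hF₃.real 2 rfl, hF₂.real 2 rfl, hF₁.real 2 rfl]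
  · intro m s' _ hI _ hF
    have hA' : A.Stored s' := by
      have hA1 : A.Stored s₁ := hA.congr (hF₁.nat 0 rfl) (hF₁.nat 11 rfl) (hF₁.nat 12 rfl)
        (hF₁.nat 13 rfl) (hF₁.nat 16 rfl) (hF₁.nat 17 rfl) (hF₁.real 0 rfl)
      have hA2 : A.Stored s₂ := hA1.congr (hF₂.nat 0 rfl) (hF₂.nat 11 rfl) (hF₂.nat 12 rfl)
        (hF₂.nat 13 rfl) (hF₂.nat 16 rfl) (hF₂.nat 17 rfl) (hF₂.real 0 rfl)
      have hA3 : A.Stored s₃ := hA2.congr (hF₃.nat 0 rfl) (hF₃.nat 11 rfl) (hF₃.nat 12 rfl)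
        (hF₃.nat 13 rfl) (hF₃.nat 16 rfl) (hF₃.nat 17 rfl) (hF₃.real 0 rfl)
      exact hA3.congr (hF.nat 0 rfl) (hF.nat 11 rfl) (hF.nat 12 rfl)
        (hF.nat 13 rfl) (hF.nat 16 rfl) (hF.nat 17 rfl) (hF.real 0 rfl)
    refine (makeCenter_all hA').mono le_rfl ?_
    rintro s'' ⟨g1, g2⟩
    refine ⟨?_, fun j hj => ?_⟩
    · simp [g1, hI.1]; ring
    · rw [State.writeNat_real, g2 j (by rw [hI.1]; omega), hI.2 j hj]

theorem makeCenters_luck {A : Params} {s : State} (hA : A.Stored s) (hS : s.nat 34 0 ≤ 2 ^ A.h)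
    {y y' : Pt A.d} (hy : y ∈ poolSet A.d s) (hy' : y' ∈ poolSet A.d s)
    {c : Fin A.k → Pt A.d} {a : Fin A.k → ℕ}
    (hc : ∀ j, c j ∈ reach (2 ^ A.h) (poolSet A.d s) A.J) (ha : ∀ j, a j < 2 ^ A.h) :
    Luck makeCenters s A.tupleTime A.tupleCoins ((1 / 2) ^ A.tupleCoins) (fun s' =>
      ∀ j : Fin A.k, readPt A.d (s'.real 2) (s.nat 37 0 + j * A.d) = c j +
        ((a j : ℝ) / (2 ^ A.h : ℕ) * (A.ε / (10 * A.k * A.n))) • (y - y')) := by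
  obtain ⟨l, hl, e⟩ := exists_coins_of_mem_poolSet hS hy
  obtain ⟨l', hl', e'⟩ := exists_coins_of_mem_poolSet hS hy'
  have eq : (1 / 2 : ℝ) ^ A.tupleCoins =
      (1 / 2) ^ A.h * ((1 / 2) ^ A.h * (1 * ((1 / 2) ^ A.centerCoins) ^ A.k)) := by
    unfold Params.tupleCoins
    rw [pow_add, pow_add, Nat.zero_add, one_mul, ← pow_mul (1 / 2 : ℝ) A.centerCoins A.k,
      Nat.mul_comm A.k]
  rw [eq]
  refine Luck.seq (by positivity) (Luck.of_hoare hl (guess_spec hA.h hl)) fun s₁ h₁ hF₁ => Luck.seq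
    (by positivity) (Luck.of_hoare hl' (guess_spec (by rw [hF₁.nat 13 rfl, hA.h]) hl'))
    fun s₂ h₂ hF₂ => Luck.seq (by positivity)
    (Hoare.setNat (Q := fun s' => s'.nat 38 0 = s.nat 37 0) ?_).all.luck fun s₃ h₃ hF₃ =>
    (Luck.forLoop (N := A.k) (I := fun m s' => s'.nat 38 0 = s.nat 37 0 + m * A.d ∧
      ∀ j : Fin A.k, (j : ℕ) < m → readPt A.d (s'.real 2) (s.nat 37 0 + j * A.d) = c j +
        ((a j : ℝ) / (2 ^ A.h : ℕ) * (A.ε / (10 * A.k * A.n))) • (y - y')) (by positivity)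
      (by rfl) (by rfl)
      (by rw [hF₃.nat 0 rfl, hF₂.nat 0 rfl, hF₁.nat 0 rfl, hA.k]) ?_ ?_).mono le_rfl le_rfl
      fun s' h j => h.2 j j.2
  · simp [NExp.eval, hF₂.nat 37 rfl, hF₁.nat 37 rfl]
  · exact ⟨by simp [h₃], fun j hj => absurd hj (Nat.not_lt_zero _)⟩
  · intro m s' hm hI _ hF
    have hA' : A.Stored s' := by
      have hA1 : A.Stored s₁ := hA.congr (hF₁.nat 0 rfl) (hF₁.nat 11 rfl) (hF₁.nat 12 rfl)
        (hF₁.nat 13 rfl) (hF₁.nat 16 rfl) (hF₁.nat 17 rfl) (hF₁.real 0 rfl)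
      have hA2 : A.Stored s₂ := hA1.congr (hF₂.nat 0 rfl) (hF₂.nat 11 rfl) (hF₂.nat 12 rfl)
        (hF₂.nat 13 rfl) (hF₂.nat 16 rfl) (hF₂.nat 17 rfl) (hF₂.real 0 rfl)
      have hA3 : A.Stored s₃ := hA2.congr (hF₃.nat 0 rfl) (hF₃.nat 11 rfl) (hF₃.nat 12 rfl)
        (hF₃.nat 13 rfl) (hF₃.nat 16 rfl) (hF₃.nat 17 rfl) (hF₃.real 0 rfl)
      exact hA3.congr (hF.nat 0 rfl) (hF.nat 11 rfl) (hF.nat 12 rfl)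
        (hF.nat 13 rfl) (hF.nat 16 rfl) (hF.nat 17 rfl) (hF.real 0 rfl)
    have e34 : s'.nat 34 = s.nat 34 :=
      (hF.nat 34 rfl).trans ((hF₃.nat 34 rfl).trans ((hF₂.nat 34 rfl).trans (hF₁.nat 34 rfl)))
    have e2 : s'.nat 2 = s.nat 2 :=
      (hF.nat 2 rfl).trans ((hF₃.nat 2 rfl).trans ((hF₂.nat 2 rfl).trans (hF₁.nat 2 rfl)))
    have er : s'.real 1 = s.real 1 :=
      (hF.real 1 rfl).trans ((hF₃.real 1 rfl).trans ((hF₂.real 1 rfl).trans (hF₁.real 1 rfl)))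
    have ep : poolSet A.d s' = poolSet A.d s := poolSet_congr e34 e2 er
    have e35 : readPt A.d (s'.real 1) (s'.nat 35 0) = y := by
      rw [er, hF.nat 35 rfl, hF₃.nat 35 rfl, hF₂.nat 35 rfl, h₁, e]
    have e36 : readPt A.d (s'.real 1) (s'.nat 36 0) = y' := by
      rw [er, hF.nat 36 rfl, hF₃.nat 36 rfl, h₂, hF₁.nat 2 rfl, e']
    refine (makeCenter_luck hA' (by rw [e34]; exact hS) (z := c ⟨m, hm⟩)
      (by rw [ep]; exact hc _) (ha ⟨m, hm⟩)).mono le_rfl le_rfl ?_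
    rintro s'' ⟨g1, g2, g3⟩
    refine ⟨by simp [g1, hI.1]; ring, fun j hj => ?_⟩
    rw [State.writeNat_real]
    rcases Nat.lt_succ_iff_lt_or_eq.1 hj with h | h
    · rw [← hI.2 j h]
      refine readPt_congr fun i hi => g2 _ ?_
      rw [hI.1]
      have : (j + 1) * A.d ≤ m * A.d := Nat.mul_le_mul_right _ h
      rw [Nat.add_mul] at this
      omega
    · have : j = ⟨m, hm⟩ := Fin.ext h
      subst this
      rw [← hI.1, g3, e35, e36]

end MinLoad

/-! ### Keeping tuples of distinct centers, and one round -/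

namespace MinLoad

open RealRAM Metric

/-- Multiply the squared distances of all pairs of the new centers. -/
def checkDistinct : Prog :=
  .seq (rassign 16 (.ofNat (.lit 1))) (.seq (assign 39 (var 37))
    (forLoop 24 0 2 (.seq (assign 40 (var 37))
      (.seq (forLoop 26 24 0 (.seq (sqDist 2 39 40)
        (.seq (rassign 16 (.mul (rvar 16) (rvar 11)))
          (assign 40 (.add (var 40) (.get 0 (.lit 1)))))))
        (assign 39 (.add (var 39) (.get 0 (.lit 1))))))))

/-- Keep the new centers if they are distinct. -/
def keepDistinct : Prog :=
  .seq checkDistinct (.cond (.realLt (.ofNat (.lit 0)) (rvar 16))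
    (.seq (assign 1 (.add (var 1) (.lit 1))) (assign 37 (var 38))) .skip)

/-- One round of the algorithm: build a pool and then a tuple of centers. -/
def oneRound : Prog := .seq growPool (.seq makeCenters keepDistinct)

/-- The product is positive exactly when no two centers coincide, so a single comparison of reals
decides. -/
theorem checkDistinct_spec {s : State} {d k : ℕ} (hd : s.nat 0 1 = d) (hk : s.nat 0 2 = k)
    (hd1 : 1 ≤ d) :
    Hoare checkDistinct s [] (k * (k * (60 * d + 30) + 40) + 20) (fun s' => s'.real 16 0 =
      ∏ j ∈ Finset.range k, ∏ i ∈ Finset.range j,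
        dist (readPt d (s.real 2) (s.nat 37 0 + j * d))
          (readPt d (s.real 2) (s.nat 37 0 + i * d)) ^ 2) := by
  set z : ℕ → Pt d := fun j => readPt d (s.real 2) (s.nat 37 0 + j * d) with hz
  refine (Hoare.setReal_seq (Hoare.setNat_seq (Hoare.forLoop (N := k)
    (T := k * (60 * d + 30) + 28)
    (I := fun m s' => s'.nat 39 0 = s.nat 37 0 + m * d ∧ s'.real 16 0 =
      ∏ j ∈ Finset.range m, ∏ i ∈ Finset.range j, dist (z j) (z i) ^ 2)
    (by rfl) (by rfl) ?_ ?_ ?_))).mono ?_ fun s' h => h.2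
  · simpa using hk
  · simp [NExp.eval, RExp.eval]
  · intro m s' hm hI hc hF
    have e0 : s'.nat 0 = s.nat 0 := hF.nat 0 rfl
    have e37 : s'.nat 37 = s.nat 37 := hF.nat 37 rfl
    have e2 : s'.real 2 = s.real 2 := by
      rw [hF.real 2 rfl, State.writeNat_real, State.writeReal_real_of_ne _ (by norm_num)]
    refine (Hoare.setNat_seq (Hoare.seq_nil (Hoare.forLoop (N := m) (T := 60 * d + 14)
      (I := fun r s'' => s''.nat 40 0 = s.nat 37 0 + r * d ∧ s''.real 16 0 =
        (∏ j ∈ Finset.range m, ∏ i ∈ Finset.range j, dist (z j) (z i) ^ 2) *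
          ∏ i ∈ Finset.range r, dist (z m) (z i) ^ 2) (by rfl) (by rfl) ?_ ?_ ?_)
      fun s₂ h₂ hF₂ => Hoare.setNat ?_)).mono ?_ fun _ h => h
    · simpa using hc
    · simp [NExp.eval, e37, hI.2]
    · intro r s'' hr hI' hc' hF'
      have f0 : s''.nat 0 = s.nat 0 := (hF'.nat 0 rfl).trans e0
      have f2 : s''.real 2 = s.real 2 := (hF'.real 2 rfl).trans e2
      have f39 : s''.nat 39 0 = s.nat 37 0 + m * d := by
        rw [hF'.nat 39 rfl]
        simpa using hI.1
      refine (Hoare.seq_nil (sqDist_spec (d := d) (by rw [f0, hd]) hd1 (by norm_num) (by norm_num)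
        (by norm_num)) fun s₃ h₃ hF₃ => Hoare.setReal_seq (Hoare.setNat ?_)).mono
        (by simp only [NExp.cost, RExp.cost]; omega) fun _ h => h
      rw [f2, f39, hI'.1] at h₃
      have g16 : s₃.real 16 0 = s''.real 16 0 := by rw [hF₃.real 16 rfl]
      have g40 : s₃.nat 40 0 = s.nat 37 0 + r * d := by rw [hF₃.nat 40 rfl, hI'.1]
      have g0 : s₃.nat 0 1 = d := by rw [hF₃.nat 0 rfl, f0, hd]
      constructor
      · simp [NExp.eval, g40, g0]; ring
      · simp [NExp.eval, RExp.eval, h₃, g16, hI'.2, Finset.prod_range_succ, mul_assoc, hz]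
    · have g39 : s₂.nat 39 0 = s.nat 37 0 + m * d := by
        rw [hF₂.nat 39 rfl]
        simpa using hI.1
      have g0 : s₂.nat 0 1 = d := by
        rw [hF₂.nat 0 rfl]
        simpa [e0] using hd
      constructor
      · simp [NExp.eval, g39, g0]; ring
      · rw [Finset.prod_range_succ]
        exact h₂.2
    · have h1 : m * (60 * d + 14 + 12) ≤ k * (60 * d + 30) :=
        Nat.mul_le_mul hm.le (by omega)
      simp only [NExp.cost]
      omega
  · have h1 : k * (k * (60 * d + 30) + 28 + 12) = k * (k * (60 * d + 30) + 40) := by ring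
    simp only [NExp.cost, RExp.cost]
    omega

/-- The tuple number `l` of the output. -/
noncomputable def tuple (d k : ℕ) (s : State) (l : ℕ) (j : Fin k) : Pt d :=
  readPt d (s.real 2) ((l * k + j) * d)

/-- The output found so far consists of tuples of distinct centers. -/
structure OutputOK (d k : ℕ) (s : State) : Prop where
  ptr : s.nat 37 0 = s.nat 1 0 * k * d
  inj : ∀ l < s.nat 1 0, Function.Injective (tuple d k s l)

/-- Some tuple in the output satisfies `φ`. -/
def Found (d k : ℕ) (φ : (Fin k → Pt d) → Prop) (s : State) : Prop :=
  ∃ l < s.nat 1 0, φ (tuple d k s l)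

theorem tuple_congr {d k : ℕ} {s s' : State} {l : ℕ}
    (h : ∀ m < (l + 1) * k * d, s'.real 2 m = s.real 2 m) : tuple d k s' l = tuple d k s l := by
  funext j
  refine readPt_congr fun c hc => h _ ?_
  have h1 : (l * k + j + 1) * d ≤ (l + 1) * k * d := by
    refine Nat.mul_le_mul_right d ?_
    have := j.2
    rw [Nat.add_mul]
    omega
  rw [Nat.add_mul (l * k + j)] at h1
  omega

theorem tuple_congr_of_lt {d k : ℕ} {s s' : State} {l N : ℕ} (hl : l < N)
    (h : ∀ m < N * k * d, s'.real 2 m = s.real 2 m) : tuple d k s' l = tuple d k s l :=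
  tuple_congr fun m hm => h m (hm.trans_le (Nat.mul_le_mul_right d (Nat.mul_le_mul_right k hl)))

/-- A rejected tuple is not erased: variable `37` stays, so that the next tuple overwrites it and
the output remains contiguous. -/
theorem keepDistinct_spec {s : State} {d k : ℕ} (hd : s.nat 0 1 = d) (hk : s.nat 0 2 = k)
    (hd1 : 1 ≤ d) (hO : OutputOK d k s) (h38 : s.nat 38 0 = s.nat 37 0 + k * d) :
    Hoare keepDistinct s [] (k * (k * (60 * d + 30) + 40) + 40) (fun s' => OutputOK d k s' ∧
      s.nat 1 0 ≤ s'.nat 1 0 ∧ s'.nat 1 0 ≤ s.nat 1 0 + 1 ∧ s'.real 2 = s.real 2 ∧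
      (Function.Injective (tuple d k s (s.nat 1 0)) → s'.nat 1 0 = s.nat 1 0 + 1)) := by
  have hz : ∀ j, readPt d (s.real 2) (s.nat 37 0 + j * d) =
      readPt d (s.real 2) ((s.nat 1 0 * k + j) * d) := by
    intro j
    rw [hO.ptr]
    congr 1
    ring
  refine (Hoare.seq_nil (checkDistinct_spec hd hk hd1) fun s₁ h₁ hF₁ => Hoare.cond (T := 10)
    (fun hb => (Hoare.setNat_seq (Hoare.setNat ?_)).mono (by simp [NExp.cost]) fun _ h => h)
    fun hb => (Hoare.skip ?_).mono (by norm_num) fun _ h => h).mono ?_ fun _ h => h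
  · have e1 : s₁.nat 1 = s.nat 1 := hF₁.nat 1 rfl
    have e2 : s₁.real 2 = s.real 2 := hF₁.real 2 rfl
    have e38 : s₁.nat 38 = s.nat 38 := hF₁.nat 38 rfl
    have hinj : Function.Injective (tuple d k s (s.nat 1 0)) := by
      simp only [BExp.Holds, RExp.eval, NExp.eval, h₁, Nat.cast_zero] at hb
      have hne : ∀ j < k, ∀ i < j, readPt d (s.real 2) (s.nat 37 0 + j * d) ≠
          readPt d (s.real 2) (s.nat 37 0 + i * d) := by
        intro j hj i hi heq
        refine hb.ne' (Finset.prod_eq_zero (Finset.mem_range.2 hj)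
          (Finset.prod_eq_zero (Finset.mem_range.2 hi) ?_))
        rw [heq, dist_self]
        norm_num
      intro i j hij
      by_contra hne'
      rcases lt_or_gt_of_ne (fun h => hne' (Fin.ext h)) with h | h
      · exact hne j j.2 i h (by rw [hz, hz]; exact hij.symm)
      · exact hne i i.2 j h (by rw [hz, hz]; exact hij)
    set s₂ := (s₁.writeNat 1 ((NExp.lit 0).eval s₁) (((var 1).add (.lit 1)).eval s₁)) with hs₂
    have g1 : (s₂.writeNat 37 ((NExp.lit 0).eval s₂) ((var 38).eval s₂)).nat 1 0
        = s.nat 1 0 + 1 := by simp [hs₂, NExp.eval, e1]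
    have g2 : (s₂.writeNat 37 ((NExp.lit 0).eval s₂) ((var 38).eval s₂)).real 2 = s.real 2 := e2
    refine ⟨⟨?_, ?_⟩, by omega, by omega, g2, fun _ => g1⟩
    · rw [g1]
      simp [hs₂, NExp.eval, e38, h38, hO.ptr]
      ring
    · intro l hl
      rw [g1] at hl
      rw [tuple_congr (s := s) fun m _ => by rw [g2]]
      rcases Nat.lt_succ_iff_lt_or_eq.1 hl with h | rfl
      · exact hO.inj l h
      · exact hinj
  · have e1 : s₁.nat 1 = s.nat 1 := hF₁.nat 1 rfl
    have e2 : s₁.real 2 = s.real 2 := hF₁.real 2 rfl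
    have e37 : s₁.nat 37 = s.nat 37 := hF₁.nat 37 rfl
    refine ⟨⟨by rw [e37, e1]; exact hO.ptr, fun l hl => ?_⟩, by rw [e1], by rw [e1]; omega, e2,
      fun hinj => ?_⟩
    · rw [tuple_congr (s := s) fun m _ => by rw [e2]]
      exact hO.inj l (by rwa [e1] at hl)
    · exfalso
      refine hb ?_
      simp only [BExp.Holds, RExp.eval, NExp.eval, h₁, Nat.cast_zero]
      refine Finset.prod_pos fun j hj => Finset.prod_pos fun i hi => ?_
      have hj' := Finset.mem_range.1 hj
      have hi' := Finset.mem_range.1 hi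
      refine pow_pos (dist_pos.2 fun heq => ?_) 2
      rw [hz, hz] at heq
      have := @hinj ⟨j, hj'⟩ ⟨i, by omega⟩ heq
      have := congrArg Fin.val this
      simp only at this
      omega
  · simp only [BExp.cost, RExp.cost, NExp.cost]
    omega

/-- Time for a round. -/
def Params.roundTime (A : Params) : ℕ :=
  A.growTime + (A.tupleTime + (A.k * (A.k * (60 * A.d + 30) + 40) + 40))

/-- Number of coins for a round. -/
def Params.roundCoins (A : Params) : ℕ := A.S * (A.n + A.h) + (A.tupleCoins + 0)

theorem oneRound_all {A : Params} {s : State} (hA : A.Stored s) (hO : OutputOK A.d A.k s) :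
    All oneRound s A.roundTime A.roundCoins (fun s' => OutputOK A.d A.k s' ∧
      s'.nat 1 0 ≤ s.nat 1 0 + 1 ∧ ∀ φ, Found A.d A.k φ s → Found A.d A.k φ s') := by
  refine All.seq (growPool_all hA) fun s₁ h₁ hF₁ => ?_
  have hA₁ : A.Stored s₁ := hA.congr (hF₁.nat 0 rfl) (hF₁.nat 11 rfl) (hF₁.nat 12 rfl)
    (hF₁.nat 13 rfl) (hF₁.nat 16 rfl) (hF₁.nat 17 rfl) (hF₁.real 0 rfl)
  refine All.seq (makeCenters_all hA₁) fun s₂ h₂ hF₂ => ?_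
  have e1 : s₂.nat 1 = s.nat 1 := (hF₂.nat 1 rfl).trans (hF₁.nat 1 rfl)
  have e37 : s₂.nat 37 = s.nat 37 := (hF₂.nat 37 rfl).trans (hF₁.nat 37 rfl)
  have ht : ∀ l < s.nat 1 0, tuple A.d A.k s₂ l = tuple A.d A.k s l := fun l hl =>
    tuple_congr_of_lt hl fun m hm => by
      rw [h₂.2 m (by rwa [hF₁.nat 37 rfl, hO.ptr]), hF₁.real 2 rfl]
  refine Hoare.all ((keepDistinct_spec (by rw [hF₂.nat 0 rfl, hA₁.d])
    (by rw [hF₂.nat 0 rfl, hA₁.k]) A.d_pos ⟨by rw [e37, e1, hO.ptr], fun l hl => ?_⟩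
    (by rw [h₂.1, hF₂.nat 37 rfl])).mono le_rfl ?_)
  · rw [e1] at hl
    rw [ht l hl]
    exact hO.inj l hl
  · rintro s' ⟨g1, g2, g3, g4, -⟩
    rw [e1] at g2 g3
    refine ⟨g1, g3, ?_⟩
    rintro φ ⟨l, hl, hφ⟩
    refine ⟨l, by omega, ?_⟩
    rw [tuple_congr (s := s₂) fun m _ => by rw [g4], ht l hl]
    exact hφ

/-- The error is split in two: the pool is required to be good for `ε / 2`, and the other half pays
for the shift that makes the centers distinct. -/
theorem oneRound_luck {A : Params} {s : State} (hA : A.Stored s) (hO : OutputOK A.d A.k s)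
    {K : Clusters (Pt A.d) A.k} {P : Finset (Pt A.d)} {L : ℝ}
    (hPO : ∀ x, x ∈ P ↔ ∃ i, x ∈ K.O i) (hdisj : ∀ i j, i ≠ j → Disjoint (K.O i) (K.O j))
    (hinj : Set.InjOn (fun i => readPt A.d (s.real 1) (i * A.d)) (Finset.range A.n))
    (hPx : P = (Finset.range A.n).image (fun i => readPt A.d (s.real 1) (i * A.d)))
    (h2 : readPt A.d (s.real 1) (A.n * A.d) ≠ readPt A.d (s.real 1) 0)
    (hε : 0 < A.ε) (hε1 : A.ε < 1) (hN : 256 ≤ ((2 ^ A.h : ℕ) : ℝ) * (A.ε / 2) ^ 2)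
    (hJ : 3072 < A.J * (A.ε / 2) ^ 2) (hL : 1 ≤ L * (A.ε / 2) ^ 2)
    (hh : 1920 * A.k * L ≤ 2 ^ A.h)
    (hS : A.k + A.k * A.J + 2 ≤ A.S) (hSh : A.S + 2 ≤ 2 ^ A.h) (hkh : A.k ≤ 2 ^ A.h) :
    Luck oneRound s A.roundTime A.roundCoins
      (((1 / 2) ^ A.h) ^ A.S * ((1 / 2) ^ A.tupleCoins * 1))
      (Found A.d A.k fun C => ∀ j, ∑ x ∈ K.O j, dist x (C j) ≤ (1 + A.ε) * K.M) := by
  classical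
  refine Luck.seq (by positivity) (growPool_luck hA hPO hdisj hinj hPx h2 (by linarith)
    (by linarith) hN hJ hL hh hS) fun s₁ h₁ hF₁ => ?_
  have hA₁ : A.Stored s₁ := hA.congr (hF₁.nat 0 rfl) (hF₁.nat 11 rfl) (hF₁.nat 12 rfl)
    (hF₁.nat 13 rfl) (hF₁.nat 16 rfl) (hF₁.nat 17 rfl) (hF₁.real 0 rfl)
  have hcard : ∀ i, (K.O i).card ≤ A.n := by
    intro i
    have : K.O i ⊆ P := fun x hx => (hPO x).2 ⟨i, hx⟩
    refine (Finset.card_le_card this).trans ?_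
    rw [hPx]
    exact Finset.card_image_le.trans (by simp)
  obtain ⟨y, hy, y', hy', c, a, hc, ha, hfinj, hcost⟩ := Clusters.Done.exists_centers hε h₁.2 hdisj
    A.n_pos hcard hkh
  -- The lucky values of the new centers and the sure preservation of the old output are needed for
  -- the same run.
  refine Luck.seq zero_le_one ((makeCenters_luck hA₁ (by rw [h₁.1]; exact hSh) hy hy' hc ha).and_all
    (makeCenters_all hA₁) ?_) fun s₂ h₂ hF₂ => ?_
  · rintro t t' ⟨g1, g2⟩ hn hr
    exact ⟨by rw [← hn]; exact g1, by rw [← hr]; exact g2⟩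
  obtain ⟨g0, g1, g2⟩ := h₂
  have e1 : s₂.nat 1 = s.nat 1 := (hF₂.nat 1 rfl).trans (hF₁.nat 1 rfl)
  have e37 : s₂.nat 37 = s.nat 37 := (hF₂.nat 37 rfl).trans (hF₁.nat 37 rfl)
  have ht : ∀ l < s.nat 1 0, tuple A.d A.k s₂ l = tuple A.d A.k s l := fun l hl =>
    tuple_congr_of_lt hl fun m hm => by
      rw [g2 m (by rwa [hF₁.nat 37 rfl, hO.ptr]), hF₁.real 2 rfl]
  have hnew : tuple A.d A.k s₂ (s.nat 1 0) = fun j => c j +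
      ((a j : ℝ) / (2 ^ A.h : ℕ) * (A.ε / (10 * A.k * A.n))) • (y - y') := by
    funext j
    rw [← g0 j, tuple, hF₁.nat 37 rfl, hO.ptr]
    congr 1
    ring
  refine (Hoare.all ((keepDistinct_spec (by rw [hF₂.nat 0 rfl, hA₁.d])
    (by rw [hF₂.nat 0 rfl, hA₁.k]) A.d_pos ⟨by rw [e37, e1, hO.ptr], fun l hl => ?_⟩
    (by rw [g1, hF₂.nat 37 rfl])).mono le_rfl ?_)).luck
  · rw [e1] at hl
    rw [ht l hl]
    exact hO.inj l hl
  · rintro s' ⟨-, -, -, g4, g5⟩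
    rw [e1, hnew] at g5
    refine ⟨s.nat 1 0, by rw [g5 hfinj]; omega, ?_⟩
    rw [tuple_congr (s := s₂) fun m _ => by rw [g4], hnew]
    exact hcost

end MinLoad

/-! ## Computing the parameters -/

namespace RealRAM

theorem Frame.trans {p : Prog} {s s₁ s₂ : State} (h : Frame p s s₁) (h' : Frame p s₁ s₂) :
    Frame p s s₂ :=
  ⟨fun a ha => (h'.nat a ha).trans (h.nat a ha), fun a ha => (h'.real a ha).trans (h.real a ha)⟩

/-- A loop whose test succeeds exactly `N` times. -/
theorem Hoare.loop_count {b : BExp} {p : Prog} {s : State} {N T : ℕ} {I : ℕ → State → Prop}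
    (h0 : I 0 s) (hb : ∀ m s', I m s' → Frame p s s' → (b.Holds s' ↔ m < N))
    (hs : ∀ m s', m < N → I m s' → Frame p s s' → Hoare p s' [] T (I (m + 1))) :
    Hoare (.loop b p) s [] (N * (T + b.cost + 1) + b.cost + 1) (I N) := by
  have key : ∀ r m s', m + r = N → I m s' → Frame p s s' →
      Hoare (.loop b p) s' [] (r * (T + b.cost + 1) + b.cost + 1) (I N) := by
    intro r
    induction r with
    | zero =>
      intro m s' hm hI hF
      have e : m = N := by omega
      subst e
      rw [Nat.zero_mul, Nat.zero_add]
      exact Hoare.loop_false (by rw [hb m s' hI hF]; omega) hI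
    | succ r ih =>
      intro m s' hm hI hF
      refine (Hoare.loop_true ((hb m s' hI hF).2 (by omega)) (Hoare.seq_nil
        (hs m s' (by omega) hI hF) fun s₁ h₁ hF₁ =>
          ih (m + 1) s₁ (by omega) h₁ (hF.trans hF₁))).mono ?_ fun _ h => h
      rw [Nat.succ_mul]
      omega
  exact key N 0 s (by omega) h0 (Frame.refl p s)

/-- Set the integer variable `v` to the least integer that is at least `e`. -/
def ceilTo (v : ℕ) (e : RExp) : Prog :=
  .seq (assign v (.lit 0))
    (.loop (.realLt (.ofNat (var v)) e) (assign v (.add (var v) (.lit 1))))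

/-- There is no rounding instruction, so the ceiling is found by counting. This is affordable
because it is only applied to numbers bounded by `J`, `S` or `4 * S * h`. -/
theorem ceilTo_spec {v : ℕ} {e : RExp} {s : State} {r : ℝ}
    (he : ∀ s', Frame (ceilTo v e) s s' → e.eval s' = r) :
    Hoare (ceilTo v e) s [] ((⌈r⌉₊ + 1) * (e.cost + 15)) (fun s' => s'.nat v 0 = ⌈r⌉₊) := by
  refine (Hoare.setNat_seq (Hoare.loop_count (N := ⌈r⌉₊) (T := 6)
    (I := fun m s' => s'.nat v 0 = m) ?_ ?_ ?_)).mono ?_ fun _ h => h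
  · simp [NExp.eval]
  · intro m s' hI hF
    have : e.eval s' = r := by
      refine he s' ⟨fun a ha => ?_, fun a _ => hF.real a rfl⟩
      simp only [ceilTo, Prog.writesNat, Bool.or_self, beq_eq_false_iff_ne] at ha
      rw [hF.nat a (beq_eq_false_iff_ne.2 ha), State.writeNat_nat_of_ne _ ha.symm]
    simp [BExp.Holds, RExp.eval, NExp.eval, hI, this, Nat.lt_ceil]
  · intro m s' _ hI _
    refine (Hoare.setNat ?_).mono (by simp [NExp.cost]) fun _ h => h
    simp [NExp.eval, hI]
  · simp only [NExp.cost, RExp.cost, BExp.cost]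
    ring_nf
    omega

end RealRAM

namespace MinLoad

open RealRAM

/-- Put the number of bits of a guess into variable `13`. -/
def setBits : Prog :=
  .seq (assign 31 (.lit 1)) (.seq (assign 13 (.lit 0))
    (.loop (.natLt (var 31) (.add (var 12) (var 12)))
      (.seq (assign 31 (.add (var 31) (var 31))) (assign 13 (.add (var 13) (.lit 1))))))

theorem setBits_spec {s : State} {S : ℕ} (hS : s.nat 12 0 = S) :
    Hoare setBits s [] (22 * Nat.clog 2 (2 * S) + 15)
      (fun s' => s'.nat 13 0 = Nat.clog 2 (2 * S)) := by
  refine (Hoare.setNat_seq (Hoare.setNat_seq (Hoare.loop_count (N := Nat.clog 2 (2 * S)) (T := 13)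
    (I := fun m s' => s'.nat 31 0 = 2 ^ m ∧ s'.nat 13 0 = m) ?_ ?_ ?_))).mono ?_ fun _ h => h.2
  · simp [NExp.eval]
  · rintro m s' ⟨h1, -⟩ hF
    have e12 : s'.nat 12 = s.nat 12 := hF.nat 12 rfl
    rw [Nat.lt_clog_iff_pow_lt one_lt_two]
    simp [BExp.Holds, NExp.eval, h1, e12, hS, two_mul]
  · rintro m s' - ⟨h1, h2⟩ -
    refine (Hoare.setNat_seq (Hoare.setNat ?_)).mono (by simp [NExp.cost]) fun _ h => h
    simp [NExp.eval, h1, h2, pow_succ, mul_two]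
  · simp only [NExp.cost, BExp.cost]
    omega

/-- Put `2 ^ H` into variable `15`, where `H` is read from variable `14`. -/
def setRounds : Prog :=
  .seq (assign 15 (.lit 1)) (forLoop 20 14 0 (assign 15 (.add (var 15) (var 15))))

theorem setRounds_spec {s : State} {H : ℕ} (hH : s.nat 14 0 = H) :
    Hoare setRounds s [] (19 * H + 12) (fun s' => s'.nat 15 0 = 2 ^ H) := by
  refine (Hoare.setNat_seq (Hoare.forLoop (N := H) (T := 7)
    (I := fun m s' => s'.nat 15 0 = 2 ^ m) (by rfl) (by rfl) ?_ ?_ ?_)).mono ?_ fun _ h => h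
  · simpa using hH
  · simp [NExp.eval]
  · intro m s' _ hI _ _
    refine (Hoare.setNat ?_).mono (by simp [NExp.cost]) fun _ h => h
    simp [NExp.eval, hI, pow_succ, mul_two]
  · simp only [NExp.cost]
    omega

/-- Put the number of coordinates of the input into variable `17`. -/
def setLength : Prog :=
  .seq (assign 17 (.lit 0)) (forLoop 20 0 0 (assign 17 (.add (var 17) (.get 0 (.lit 1)))))

theorem setLength_spec {s : State} {n d : ℕ} (hn : s.nat 0 0 = n) (hd : s.nat 0 1 = d) :
    Hoare setLength s [] (19 * n + 12) (fun s' => s'.nat 17 0 = n * d) := by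
  refine (Hoare.setNat_seq (Hoare.forLoop (N := n) (T := 7)
    (I := fun m s' => s'.nat 17 0 = m * d) (by rfl) (by rfl) ?_ ?_ ?_)).mono ?_ fun _ h => h
  · simpa using hn
  · simp [NExp.eval]
  · intro m s' _ hI _ hF
    have e0 : s'.nat 0 = s.nat 0 := hF.nat 0 rfl
    refine (Hoare.setNat ?_).mono (by simp [NExp.cost]) fun _ h => h
    simp [NExp.eval, hI, e0, hd, Nat.succ_mul]
  · simp only [NExp.cost]
    omega

/-- Put a point that differs from the first one behind the input. -/
def addPoint : Prog :=
  .seq (writePt 1 17 (.get 1 (var 21)))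
    (.setReal 1 (var 17) (.add (.get 1 (.lit 0)) (.ofNat (.lit 1))))

/-- The first point is copied and its first coordinate is raised by 1; `hdm` keeps the copy from
overlapping the original. -/
theorem addPoint_spec {s : State} {d m : ℕ} (hd : s.nat 0 1 = d) (hm : s.nat 17 0 = m)
    (hd1 : 1 ≤ d) (hdm : d ≤ m) :
    Hoare addPoint s [] (40 * d) (fun s' => (∀ i < m, s'.real 1 i = s.real 1 i) ∧
      readPt d (s'.real 1) m ≠ readPt d (s'.real 1) 0) := by
  refine (Hoare.seq_nil (writePt_spec (d := d) (f := fun c => s.real 1 c) hd hd1 (by norm_num)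
    fun c s' hc hc' hF hr => ?_) fun s₁ h₁ hF₁ => Hoare.setReal ?_).mono ?_ fun _ h => h
  · simp only [RExp.eval, NExp.eval, hc']
    exact hr c (.inl (by omega))
  · have e17 : s₁.nat 17 0 = m := by rw [hF₁.nat 17 rfl, hm]
    have e1 : s₁.real 1 0 = s.real 1 0 := h₁.2 0 (.inl (by omega))
    simp only [NExp.eval, RExp.eval, e17, e1]
    refine ⟨fun i hi => ?_, fun heq => ?_⟩
    · simp only [State.writeReal_real, true_and, if_neg hi.ne]
      exact h₁.2 i (.inl (by omega))
    · have := congrArg (fun z : Pt d => z ⟨0, hd1⟩) heq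
      simp [readPt, e1, (show (0 : ℕ) ≠ m by omega)] at this
  · simp only [RExp.cost, NExp.cost]
    omega

/-- The parameters have the values that the program computes from the input. -/
structure Params.Tuned (A : Params) : Prop where
  k_pos : 1 ≤ A.k
  ε_pos : 0 < A.ε
  ε_lt : A.ε < 1
  J : A.J = 4000 * ⌈4 / (A.ε * A.ε)⌉₊
  S : A.S = 5000 * A.k * ⌈4 / (A.ε * A.ε)⌉₊
  h : A.h = Nat.clog 2 (2 * A.S)

/-- Compute the parameters of the algorithm and the auxiliary point. -/
def setup : Prog :=
  .seq (ceilTo 10 (.div (.ofNat (.lit 4)) (.mul (rvar 0) (rvar 0))))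
  (.seq (ceilTo 11 (.mul (.ofNat (.lit 4000)) (.ofNat (var 10))))
  (.seq (ceilTo 12 (.mul (.mul (.ofNat (.lit 5000)) (.ofNat (.get 0 (.lit 2)))) (.ofNat (var 10))))
  (.seq setBits
  (.seq (ceilTo 14 (.mul (.mul (.ofNat (.lit 4)) (.ofNat (var 12))) (.ofNat (var 13))))
  (.seq setRounds
  (.seq (assign 16 (.add (.get 0 (.lit 0)) (var 13)))
  (.seq setLength addPoint)))))))

/-- Time for the setup. -/
def Params.setupTime (A : Params) : ℕ :=
  300 * (A.J + A.S + A.S * A.h + A.h + A.n * A.d + 1)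

theorem setup_spec {A : Params} {s : State} (hT : A.Tuned) (hn : s.nat 0 0 = A.n)
    (hd : s.nat 0 1 = A.d) (hk : s.nat 0 2 = A.k) (hε : s.real 0 0 = A.ε) :
    Hoare setup s [] A.setupTime (fun s' => A.Stored s' ∧
      s'.nat 15 0 = 2 ^ (4 * A.S * A.h) ∧ (∀ i < A.n * A.d, s'.real 1 i = s.real 1 i) ∧
      readPt A.d (s'.real 1) (A.n * A.d) ≠ readPt A.d (s'.real 1) 0 ∧ s'.nat 1 = s.nat 1 ∧
      s'.nat 37 = s.nat 37) := by
  have hJ := hT.J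
  have hS := hT.S
  have hh := hT.h
  have hd1 := A.d_pos
  set L := ⌈4 / (A.ε * A.ε)⌉₊ with hL
  have hLS : L ≤ A.J := by omega
  have hndn : A.n ≤ A.n * A.d := Nat.le_mul_of_pos_right _ hd1
  have hndd : A.d ≤ A.n * A.d := Nat.le_mul_of_pos_left _ A.n_pos
  refine (Hoare.seq_nil (ceilTo_spec (r := 4 / (A.ε * A.ε)) fun s' hF => ?_) fun s₁ h₁ hF₁ =>
    Hoare.seq_nil (ceilTo_spec (r := (A.J : ℕ)) fun s' hF => ?_) fun s₂ h₂ hF₂ =>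
    Hoare.seq_nil (ceilTo_spec (r := (A.S : ℕ)) fun s' hF => ?_) fun s₃ h₃ hF₃ =>
    Hoare.seq_nil (setBits_spec (S := A.S) ?_) fun s₄ h₄ hF₄ =>
    Hoare.seq_nil (ceilTo_spec (r := (4 * A.S * A.h : ℕ)) fun s' hF => ?_) fun s₅ h₅ hF₅ =>
    Hoare.seq_nil (setRounds_spec (H := 4 * A.S * A.h) ?_) fun s₆ h₆ hF₆ =>
    Hoare.setNat_seq (Hoare.seq_nil (setLength_spec (n := A.n) (d := A.d) ?_ ?_) fun s₇ h₇ hF₇ =>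
    (addPoint_spec (d := A.d) (m := A.n * A.d) ?_ h₇ hd1 hndd).frame.mono le_rfl ?_)).mono ?_
    fun _ h => h
  · simp [RExp.eval, NExp.eval, hF.real 0 rfl, hε]
  · simp [RExp.eval, NExp.eval, hF.nat 10 rfl, h₁, hJ, hL]
  · simp [RExp.eval, NExp.eval, hF.nat 10 rfl, hF.nat 0 rfl, hF₂.nat 10 rfl, hF₂.nat 0 rfl,
      hF₁.nat 0 rfl, h₁, hS, hk, hL]
  · rw [h₃, Nat.ceil_natCast]
  · simp [RExp.eval, NExp.eval, hF.nat 12 rfl, hF.nat 13 rfl, hF₄.nat 12 rfl, h₃, h₄, hh]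
  · rw [h₅, Nat.ceil_natCast]
  · simp [hF₆.nat 0 rfl, hF₅.nat 0 rfl, hF₄.nat 0 rfl, hF₃.nat 0 rfl, hF₂.nat 0 rfl,
      hF₁.nat 0 rfl, hn]
  · simp [hF₆.nat 0 rfl, hF₅.nat 0 rfl, hF₄.nat 0 rfl, hF₃.nat 0 rfl, hF₂.nat 0 rfl,
      hF₁.nat 0 rfl, hd]
  · rw [hF₇.nat 0 rfl]
    simp [hF₆.nat 0 rfl, hF₅.nat 0 rfl, hF₄.nat 0 rfl, hF₃.nat 0 rfl, hF₂.nat 0 rfl,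
      hF₁.nat 0 rfl, hd]
  · rintro s' ⟨⟨h₈, h₈'⟩, hF₈⟩
    set s₆' := s₆.writeNat 16 ((NExp.lit 0).eval s₆)
      (((NExp.get 0 (.lit 0)).add (var 13)).eval s₆) with hs₆'
    have g : ∀ a, a ≠ 10 → a ≠ 11 → a ≠ 12 → a ≠ 13 → a ≠ 14 → a ≠ 15 → a ≠ 16 → a ≠ 17 →
        a ≠ 20 → a ≠ 21 → a ≠ 31 → s'.nat a = s.nat a := by
      intro a a1 a2 a3 a4 a5 a6 a7 a8 a9 a10 a11
      rw [hF₈.nat a, hF₇.nat a, State.writeNat_nat_of_ne _ a7, hF₆.nat a, hF₅.nat a, hF₄.nat a,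
        hF₃.nat a, hF₂.nat a, hF₁.nat a] <;>
      simp [ceilTo, setBits, setRounds, setLength, addPoint, writePt, forLoop, Prog.writesNat,
        a1.symm, a2.symm, a3.symm, a4.symm, a5.symm, a6.symm, a8.symm, a9.symm, a10.symm,
        a11.symm]
    have g0 : s'.nat 0 = s.nat 0 := g 0 (by norm_num) (by norm_num) (by norm_num) (by norm_num)
      (by norm_num) (by norm_num) (by norm_num) (by norm_num) (by norm_num) (by norm_num)
      (by norm_num)
    have r1 : s₇.real 1 = s.real 1 := by
      rw [hF₇.real 1 rfl, hs₆', State.writeNat_real, hF₆.real 1 rfl, hF₅.real 1 rfl,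
        hF₄.real 1 rfl, hF₃.real 1 rfl, hF₂.real 1 rfl, hF₁.real 1 rfl]
    have r0 : s'.real 0 = s.real 0 := by
      rw [hF₈.real 0 rfl, hF₇.real 0 rfl, hs₆', State.writeNat_real, hF₆.real 0 rfl,
        hF₅.real 0 rfl, hF₄.real 0 rfl, hF₃.real 0 rfl, hF₂.real 0 rfl, hF₁.real 0 rfl]
    have n13 : s₆.nat 13 0 = A.h := by
      rw [hF₆.nat 13 rfl, hF₅.nat 13 rfl, h₄, hh]
    have n0 : s₆.nat 0 = s.nat 0 := by
      rw [hF₆.nat 0 rfl, hF₅.nat 0 rfl, hF₄.nat 0 rfl, hF₃.nat 0 rfl, hF₂.nat 0 rfl, hF₁.nat 0 rfl]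
    refine ⟨⟨by rw [g0, hn], by rw [g0, hd], by rw [g0, hk], ?_, ?_, ?_, ?_, ?_,
      by rw [r0, hε]⟩, ?_, ?_, h₈', ?_, ?_⟩
    · rw [hF₈.nat 11 rfl, hF₇.nat 11 rfl, hs₆', State.writeNat_nat_of_ne _ (by norm_num),
        hF₆.nat 11 rfl, hF₅.nat 11 rfl, hF₄.nat 11 rfl, hF₃.nat 11 rfl, h₂, Nat.ceil_natCast]
    · rw [hF₈.nat 12 rfl, hF₇.nat 12 rfl, hs₆', State.writeNat_nat_of_ne _ (by norm_num),
        hF₆.nat 12 rfl, hF₅.nat 12 rfl, hF₄.nat 12 rfl, h₃, Nat.ceil_natCast]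
    · rw [hF₈.nat 13 rfl, hF₇.nat 13 rfl, hs₆', State.writeNat_nat_of_ne _ (by norm_num), n13]
    · rw [hF₈.nat 16 rfl, hF₇.nat 16 rfl, hs₆']
      simp [NExp.eval, n13, n0, hn]
    · rw [hF₈.nat 17 rfl, h₇]
    · rw [hF₈.nat 15 rfl, hF₇.nat 15 rfl, hs₆', State.writeNat_nat_of_ne _ (by norm_num), h₆]
    · intro i hi
      rw [h₈ i hi, r1]
    · exact g 1 (by norm_num) (by norm_num) (by norm_num) (by norm_num) (by norm_num)
        (by norm_num) (by norm_num) (by norm_num) (by norm_num) (by norm_num) (by norm_num)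
    · exact g 37 (by norm_num) (by norm_num) (by norm_num) (by norm_num) (by norm_num)
        (by norm_num) (by norm_num) (by norm_num) (by norm_num) (by norm_num) (by norm_num)
  · simp only [NExp.cost, RExp.cost, Nat.ceil_natCast, ← hL, ← hh, Params.setupTime]
    have h1 : 4 * A.S * A.h = 4 * (A.S * A.h) := by ring
    rw [h1]
    omega

end MinLoad

/-! ## The whole program -/

namespace MinLoad

open RealRAM

/-- The algorithm. -/
def mainProg : Prog := .seq setup (forLoop 23 15 0 oneRound)

/-- Time for the algorithm. -/
def Params.totalTime (A : Params) : ℕ :=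
  A.setupTime + (2 ^ (4 * A.S * A.h) * (A.roundTime + 12) + 9)

/-- Number of coins for the algorithm. -/
def Params.totalCoins (A : Params) : ℕ := 0 + 2 ^ (4 * A.S * A.h) * A.roundCoins

theorem OutputOK.congr {d k : ℕ} {s s' : State} (h : OutputOK d k s) (h1 : s'.nat 1 = s.nat 1)
    (h37 : s'.nat 37 = s.nat 37) (hr : s'.real 2 = s.real 2) : OutputOK d k s' := by
  refine ⟨by rw [h1, h37, h.ptr], fun l hl => ?_⟩
  rw [tuple_congr (s := s) fun m _ => by rw [hr]]
  exact h.inj l (by rwa [h1] at hl)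

theorem Found.congr {d k : ℕ} {φ : (Fin k → Pt d) → Prop} {s s' : State} (h : Found d k φ s)
    (h1 : s'.nat 1 = s.nat 1) (hr : s'.real 2 = s.real 2) : Found d k φ s' := by
  obtain ⟨l, hl, hφ⟩ := h
  refine ⟨l, by rwa [h1], ?_⟩
  rwa [tuple_congr (s := s) fun m _ => by rw [hr]]

theorem OutputOK.of_empty {d k : ℕ} {s : State} (h1 : s.nat 1 0 = 0) (h37 : s.nat 37 0 = 0) :
    OutputOK d k s :=
  ⟨by simp [h1, h37], fun l hl => by omega⟩

section

variable {A : Params} {s : State}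

theorem mainProg_all (hT : A.Tuned) (hn : s.nat 0 0 = A.n)
    (hd : s.nat 0 1 = A.d) (hk : s.nat 0 2 = A.k) (hε : s.real 0 0 = A.ε)
    (h1 : s.nat 1 0 = 0) (h37 : s.nat 37 0 = 0) :
    All mainProg s A.totalTime A.totalCoins (fun s' => OutputOK A.d A.k s' ∧
      s'.nat 1 0 ≤ 2 ^ (4 * A.S * A.h)) := by
  refine All.seq (setup_spec hT hn hd hk hε).all fun s₁ h₁ _ => ?_
  obtain ⟨hA, hR, -, -, e1, e37⟩ := h₁
  refine All.forLoop (I := fun m s' => OutputOK A.d A.k s' ∧ s'.nat 1 0 ≤ m) (by rfl) (by rfl) hR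
    ?_ ?_
  · refine ⟨OutputOK.of_empty ?_ ?_, ?_⟩ <;> simp [e1, e37, h1, h37]
  · intro m s' _ hI _ hF
    have hA' : A.Stored s' := hA.congr (hF.nat 0 rfl) (hF.nat 11 rfl) (hF.nat 12 rfl)
      (hF.nat 13 rfl) (hF.nat 16 rfl) (hF.nat 17 rfl) (hF.real 0 rfl)
    refine (oneRound_all hA' hI.1).mono le_rfl ?_
    rintro s'' ⟨g1, g2, -⟩
    refine ⟨g1.congr (State.writeNat_nat_of_ne _ (by norm_num))
      (State.writeNat_nat_of_ne _ (by norm_num)) rfl, ?_⟩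
    rw [State.writeNat_nat_of_ne _ (by norm_num)]
    omega

theorem Params.Tuned.ceil_ge (hT : A.Tuned) : 4 ≤ ⌈4 / (A.ε * A.ε)⌉₊ := by
  have h1 := hT.ε_pos
  have h2 := hT.ε_lt
  have : (4 : ℝ) ≤ ⌈4 / (A.ε * A.ε)⌉₊ := by
    refine le_trans ?_ (Nat.le_ceil _)
    rw [le_div_iff₀ (by positivity)]
    nlinarith
  exact_mod_cast this

/-- This asks for one sample more than the potential can absorb, as `growPool_luck` requires. -/
theorem Params.Tuned.k_add_le (hT : A.Tuned) : A.k + A.k * A.J + 2 ≤ A.S := by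
  rw [hT.S, hT.J]
  have h1 := hT.ceil_ge
  have h2 := hT.k_pos
  generalize ⌈4 / (A.ε * A.ε)⌉₊ = L at *
  nlinarith [Nat.mul_le_mul h2 h1]

theorem Params.Tuned.le_S (hT : A.Tuned) : 20000 ≤ A.S := by
  rw [hT.S]
  have h1 := hT.ceil_ge
  have h2 := hT.k_pos
  generalize ⌈4 / (A.ε * A.ε)⌉₊ = L at *
  nlinarith [Nat.mul_le_mul h2 h1]

theorem Params.Tuned.le_two_pow (hT : A.Tuned) : 2 * A.S ≤ 2 ^ A.h := by
  rw [hT.h]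
  exact Nat.le_pow_clog one_lt_two _

theorem Params.Tuned.two_pow_le (hT : A.Tuned) : 2 ^ A.h ≤ 4 * A.S := by
  have hS := hT.le_S
  have h := Nat.pow_pred_clog_lt_self one_lt_two (x := 2 * A.S) (by omega)
  rw [← hT.h] at h
  have hpos : A.h ≠ 0 := by
    intro h0
    have := hT.le_two_pow
    rw [h0] at this
    omega
  obtain ⟨r, hr⟩ := Nat.exists_eq_succ_of_ne_zero hpos
  rw [hr, Nat.pred_succ] at h
  rw [hr, pow_succ]
  omega

theorem Params.Tuned.h_le (hT : A.Tuned) : A.h ≤ A.S := by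
  rw [hT.h]
  refine Nat.clog_le_of_le_pow ?_
  have hS := hT.le_S
  obtain ⟨r, hr⟩ := Nat.exists_eq_add_of_le' (show 1 ≤ A.S by omega)
  rw [hr, pow_succ]
  have : r < 2 ^ r := Nat.lt_two_pow_self
  omega

/-- The samples need `h * S` lucky bits, and the tuple uses `2 * h * (k + k * J + 1)` coins, which
is at most `2 * h * S`. -/
theorem Params.Tuned.coins_le (hT : A.Tuned) : A.h * A.S + A.tupleCoins ≤ 4 * A.S * A.h := by
  have h := Nat.mul_le_mul_right A.h hT.k_add_le
  unfold Params.tupleCoins Params.centerCoins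
  nlinarith

/-- With success probability `p = 2 ^ (-H)`, all `1 / p` rounds fail with probability at most `(1 -
p) ^ (1 / p) ≤ exp (-1)`. -/
theorem half_le_one_sub_pow (H : ℕ) : (1 : ℝ) / 2 ≤ 1 - (1 - (1 / 2) ^ H) ^ 2 ^ H := by
  have h0 : (0 : ℝ) ≤ 1 - (1 / 2) ^ H := by
    have : ((1 : ℝ) / 2) ^ H ≤ 1 := pow_le_one₀ (by norm_num) (by norm_num)
    linarith
  have h1 : (1 - (1 / 2 : ℝ) ^ H) ^ 2 ^ H ≤ Real.exp (-(1 / 2) ^ H) ^ 2 ^ H :=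
    pow_le_pow_left₀ h0 (Real.one_sub_le_exp_neg _) _
  have h2 : Real.exp (-(1 / 2) ^ H) ^ 2 ^ H = Real.exp (-1) := by
    rw [← Real.exp_nat_mul]
    congr 1
    push_cast
    rw [mul_neg, ← mul_pow]
    norm_num
  have h3 : Real.exp (-1) ≤ 1 / 2 := by
    rw [Real.exp_neg, inv_eq_one_div]
    refine one_div_le_one_div_of_le (by norm_num) ?_
    have := Real.add_one_le_exp (1 : ℝ)
    linarith
  linarith

theorem mainProg_luck (hT : A.Tuned) (hn : s.nat 0 0 = A.n)
    (hd : s.nat 0 1 = A.d) (hk : s.nat 0 2 = A.k) (hε : s.real 0 0 = A.ε)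
    (h1 : s.nat 1 0 = 0) (h37 : s.nat 37 0 = 0)
    {K : Clusters (Pt A.d) A.k} {P : Finset (Pt A.d)}
    (hPO : ∀ x, x ∈ P ↔ ∃ i, x ∈ K.O i) (hdisj : ∀ i j, i ≠ j → Disjoint (K.O i) (K.O j))
    (hinj : Set.InjOn (fun i => readPt A.d (s.real 1) (i * A.d)) (Finset.range A.n))
    (hPx : ∀ y, y ∈ P ↔ ∃ i < A.n, readPt A.d (s.real 1) (i * A.d) = y) :
    Luck mainProg s A.totalTime A.totalCoins (1 / 2)
      (Found A.d A.k fun C => ∀ j, ∑ x ∈ K.O j, dist x (C j) ≤ (1 + A.ε) * K.M) := by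
  classical
  set H := 4 * A.S * A.h with hH
  have hε0 := hT.ε_pos
  have hk1 := hT.k_pos
  have hS := hT.le_S
  have h2h := hT.le_two_pow
  have hka := hT.k_add_le
  set L := ⌈4 / (A.ε * A.ε)⌉₊ with hLdef
  have hL : 1 ≤ (L : ℝ) * (A.ε / 2) ^ 2 := by
    have := Nat.le_ceil (4 / (A.ε * A.ε))
    rw [← hLdef, div_le_iff₀ (by positivity)] at this
    nlinarith
  have hLS : 5000 * A.k * L = A.S := hT.S.symm
  have hkL : L ≤ A.k * L := Nat.le_mul_of_pos_left _ hk1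
  have hbig : (2 * (5000 * (A.k * L)) : ℝ) ≤ ((2 ^ A.h : ℕ) : ℝ) := by
    have : 2 * (5000 * (A.k * L)) ≤ 2 ^ A.h := by rw [← mul_assoc 5000, hLS]; exact h2h
    exact_mod_cast this
  have hkL' : (L : ℝ) ≤ A.k * L := by exact_mod_cast hkL
  have hL0 : (0 : ℝ) ≤ L := Nat.cast_nonneg _
  have hq1 : ((1 : ℝ) / 2) ^ H ≤ 1 := pow_le_one₀ (by norm_num) (by norm_num)
  refine (Luck.seq (q := 1) (q' := 1 - (1 - (1 / 2) ^ H) ^ 2 ^ H)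
    ((by norm_num : (0 : ℝ) ≤ 1 / 2).trans (half_le_one_sub_pow H))
    (setup_spec hT hn hd hk hε).all.luck fun s₁ h₁ _ => ?_).mono
    le_rfl (by rw [one_mul]; exact half_le_one_sub_pow H) fun _ h => h
  obtain ⟨hA, hR, hr, h2, e1, e37⟩ := h₁
  have hpt : ∀ i < A.n, readPt A.d (s₁.real 1) (i * A.d) = readPt A.d (s.real 1) (i * A.d) := by
    intro i hi
    refine readPt_congr fun c hc => hr _ ?_
    have := Nat.mul_le_mul_right A.d hi
    rw [Nat.succ_mul] at this
    omega
  -- A good tuple in the output is never lost, so the rounds count as independent attempts at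
  -- `Found`, starting from any well-formed output.
  refine Luck.forLoop_repeat (I := fun m s' => OutputOK A.d A.k s') (by positivity) hq1
    (by rfl) (by rfl) hR ?_ ?_ ?_
  · refine OutputOK.of_empty ?_ ?_ <;> simp [e1, e37, h1, h37]
  · intro s' v h
    exact h.congr (State.writeNat_nat_of_ne _ (by norm_num)) rfl
  · intro m s' _ hI _ hF
    have hA' : A.Stored s' := hA.congr (hF.nat 0 rfl) (hF.nat 11 rfl) (hF.nat 12 rfl)
      (hF.nat 13 rfl) (hF.nat 16 rfl) (hF.nat 17 rfl) (hF.real 0 rfl)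
    have er : s'.real 1 = s₁.real 1 := hF.real 1 rfl
    have hall := oneRound_all hA' hI
    have hO : ∀ s'' : State, OutputOK A.d A.k s'' →
        OutputOK A.d A.k (s''.writeNat 23 0 (m + 1)) := fun s'' h =>
      h.congr (State.writeNat_nat_of_ne _ (by norm_num))
        (State.writeNat_nat_of_ne _ (by norm_num)) rfl
    refine ⟨hall.mono le_rfl fun s'' h => ⟨hO s'' h.1, h.2.2 _⟩, ?_⟩
    have hl := oneRound_luck (K := K) (P := P) (L := L) hA' hI hPO hdisj ?_ ?_ (by rwa [er]) hε0
      hT.ε_lt ?_ ?_ hL ?_ hka (by omega) (by omega)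
    · refine (hl.and_all (Q' := OutputOK A.d A.k) (hall.mono le_rfl fun s'' h => h.1) ?_).mono
        le_rfl ?_ fun s'' h => ⟨hO s'' h.2, h.1⟩
      · intro t t' ht hn hr
        exact ht.congr (by rw [hn]) (by rw [hn]) (by rw [hr])
      · rw [mul_one, ← pow_mul, ← pow_add]
        exact pow_le_pow_of_le_one (by norm_num) (by norm_num) hT.coins_le
    · rw [er]
      intro i hi j hj hij
      have hi' := Finset.mem_range.1 hi
      have hj' := Finset.mem_range.1 hj
      simp only [hpt i hi', hpt j hj'] at hij
      exact hinj hi hj hij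
    · ext y
      rw [hPx, Finset.mem_image]
      simp only [Finset.mem_range, er]
      exact exists_congr fun i => and_congr_right fun hi => by rw [hpt i hi]
    · have h3 : (256 : ℝ) * L ≤ ((2 ^ A.h : ℕ) : ℝ) := by linarith
      calc (256 : ℝ) ≤ 256 * (L * (A.ε / 2) ^ 2) := by linarith
        _ = 256 * L * (A.ε / 2) ^ 2 := by ring
        _ ≤ _ := mul_le_mul_of_nonneg_right h3 (by positivity)
    · rw [hT.J]
      push_cast
      rw [← hLdef, mul_assoc]
      linarith
    · push_cast at hbig
      nlinarith

end

end MinLoad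

/-! ## The bounds -/

namespace MinLoad

open RealRAM

section

variable {A : Params}

theorem Params.Tuned.roundTime_le (hT : A.Tuned) :
    A.roundTime + 12 ≤ A.S ^ 4 * (A.n * A.d) := by
  have hS := hT.le_S
  have hh := hT.h_le
  have hk1 := hT.k_pos
  have hka := hT.k_add_le
  have hJ : A.J ≤ A.S := (Nat.le_mul_of_pos_left _ hk1).trans (by omega)
  have hk : A.k ≤ A.S := by omega
  have hN : 1 ≤ A.n * A.d := Nat.mul_pos A.n_pos A.d_pos
  have hd : A.d ≤ A.n * A.d := Nat.le_mul_of_pos_left _ A.n_pos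
  unfold Params.roundTime Params.growTime Params.sampleTime Params.tupleTime Params.centerTime
  generalize A.n * A.d = N at *
  generalize A.S = S, A.h = h, A.k = k, A.J = J, A.d = d at *
  have a1 : N ≤ S * N := Nat.le_mul_of_pos_left _ (by omega)
  have a1' : S ≤ S * N := Nat.le_mul_of_pos_right _ (by omega)
  have a2 : S * N ≤ S * (S * N) := Nat.le_mul_of_pos_left _ (by omega)
  have a3 : S * (S * N) ≤ S * (S * (S * N)) := Nat.le_mul_of_pos_left _ (by omega)
  have b1 : J * (80 * h + 150 * d + 12) ≤ S * (242 * (S * N)) := Nat.mul_le_mul hJ (by omega)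
  have b2 : S * (450 * N + 40 * h + 12) ≤ S * (502 * (S * N)) := Nat.mul_le_mul le_rfl (by omega)
  have b3 : k * (60 * d + 30) ≤ S * (90 * N) := Nat.mul_le_mul hk (by omega)
  have e1 : S * (242 * (S * N)) = 242 * (S * (S * N)) := by ring
  have e2 : S * (502 * (S * N)) = 502 * (S * (S * N)) := by ring
  have e3 : S * (90 * N) = 90 * (S * N) := by ring
  have b4 : k * (k * (60 * d + 30) + 40) ≤ S * (130 * (S * N)) := Nat.mul_le_mul hk (by omega)
  have e4 : S * (130 * (S * N)) = 130 * (S * (S * N)) := by ring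
  have b5 : k * (40 * h + 70 * d + (J * (80 * h + 150 * d + 12) + 9 + (40 * h + 150 * d + 7)) + 12)
      ≤ S * (570 * (S * (S * N))) := Nat.mul_le_mul hk (by omega)
  have e5 : S * (570 * (S * (S * N))) = 570 * (S * (S * (S * N))) := by ring
  have b6 : 20000 * (S * (S * (S * N))) ≤ S * (S * (S * (S * N))) := Nat.mul_le_mul_right _ hS
  have e6 : S ^ 4 * N = S * (S * (S * (S * N))) := by ring
  omega

theorem Params.Tuned.setupTime_le (hT : A.Tuned) : A.setupTime + 9 ≤ A.S ^ 4 * (A.n * A.d) := by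
  have hS := hT.le_S
  have hh := hT.h_le
  have hJ : A.J ≤ A.S := (Nat.le_mul_of_pos_left _ hT.k_pos).trans (by have := hT.k_add_le; omega)
  have hN : 1 ≤ A.n * A.d := Nat.mul_pos A.n_pos A.d_pos
  unfold Params.setupTime
  generalize A.n * A.d = N at *
  generalize A.S = S, A.h = h, A.J = J at *
  have a1 : N ≤ S * N := Nat.le_mul_of_pos_left _ (by omega)
  have a1' : S ≤ S * N := Nat.le_mul_of_pos_right _ (by omega)
  have a2 : S * N ≤ S * (S * N) := Nat.le_mul_of_pos_left _ (by omega)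
  have b1 : S * h ≤ S * (S * N) := Nat.mul_le_mul le_rfl (by omega)
  have b2 : 20000 * (S * (S * N)) ≤ S * (S * (S * N)) := Nat.mul_le_mul_right _ hS
  have a3 : S * (S * (S * N)) ≤ S * (S * (S * (S * N))) := Nat.le_mul_of_pos_left _ (by omega)
  have e6 : S ^ 4 * N = S * (S * (S * (S * N))) := by ring
  omega

/-- The polynomial cost of a round is absorbed by `S ^ 5 ≤ 2 ^ (S * h)`, which raises the factor in
the exponent from 4 to 5. -/
theorem Params.Tuned.totalTime_le (hT : A.Tuned) :
    A.totalTime ≤ 2 ^ (5 * (A.S * A.h)) * (A.n * A.d) := by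
  have hS := hT.le_S
  have h1 := hT.roundTime_le
  have h2 := hT.setupTime_le
  have h3 : A.S ^ 5 ≤ 2 ^ (A.S * A.h) := by
    calc A.S ^ 5 ≤ (2 ^ A.h) ^ 5 := Nat.pow_le_pow_left (by have := hT.le_two_pow; omega) 5
      _ ≤ (2 ^ A.h) ^ A.S := Nat.pow_le_pow_right (by positivity) (by omega)
      _ = 2 ^ (A.S * A.h) := by rw [← pow_mul, mul_comm]
  set X := A.S ^ 4 * (A.n * A.d) with hX
  have h4 : X ≤ 2 ^ (4 * A.S * A.h) * X := Nat.le_mul_of_pos_left _ (by positivity)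
  have h5 : 2 ^ (4 * A.S * A.h) * (A.roundTime + 12) ≤ 2 ^ (4 * A.S * A.h) * X :=
    Nat.mul_le_mul_left _ h1
  calc A.totalTime ≤ 2 * (2 ^ (4 * A.S * A.h) * X) := by unfold Params.totalTime; omega
    _ ≤ A.S * (2 ^ (4 * A.S * A.h) * X) := Nat.mul_le_mul_right _ (by omega)
    _ = 2 ^ (4 * A.S * A.h) * A.S ^ 5 * (A.n * A.d) := by rw [hX]; ring
    _ ≤ 2 ^ (4 * A.S * A.h) * 2 ^ (A.S * A.h) * (A.n * A.d) :=
      Nat.mul_le_mul_right _ (Nat.mul_le_mul_left _ h3)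
    _ = 2 ^ (5 * (A.S * A.h)) * (A.n * A.d) := by rw [← pow_add]; congr 2; ring

theorem Params.Tuned.two_pow_le_expTildeO (hT : A.Tuned) :
    (2 : ℝ) ^ (5 * (A.S * A.h)) ≤ expTildeO 3375000 1 2 A.k A.ε := by
  have hε := hT.ε_pos
  have hk : (1 : ℝ) ≤ A.k := by exact_mod_cast hT.k_pos
  have hS : (A.S : ℝ) ≤ 25000 * (A.k / A.ε ^ 2) := by
    have h1 : (⌈4 / (A.ε * A.ε)⌉₊ : ℝ) ≤ 5 / A.ε ^ 2 := by
      have h2 := (Nat.ceil_lt_add_one (a := 4 / (A.ε * A.ε)) (by positivity)).le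
      have h3 : 1 ≤ 1 / A.ε ^ 2 := by
        rw [le_div_iff₀ (by positivity), one_mul]
        exact pow_le_one₀ hε.le hT.ε_lt.le
      calc (⌈4 / (A.ε * A.ε)⌉₊ : ℝ) ≤ 4 / (A.ε * A.ε) + 1 := h2
        _ ≤ 4 / (A.ε * A.ε) + 1 / A.ε ^ 2 := by linarith
        _ = 5 / A.ε ^ 2 := by rw [← sq, ← add_div]; norm_num
    rw [hT.S]
    push_cast
    calc 5000 * (A.k : ℝ) * ⌈4 / (A.ε * A.ε)⌉₊ ≤ 5000 * (A.k : ℝ) * (5 / A.ε ^ 2) :=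
          mul_le_mul_of_nonneg_left h1 (by positivity)
      _ = 25000 * (A.k / A.ε ^ 2) := by ring
  unfold expTildeO
  set X := (A.k : ℝ) / A.ε ^ 2 with hX
  have hX0 : 0 ≤ X := by positivity
  have hlog : (0.69 : ℝ) < Real.log 2 := by have := Real.log_two_gt_d9; linarith
  have hlog2 : Real.log 2 ≤ Real.log (2 + X) := Real.log_le_log (by norm_num) (by linarith)
  -- From `2 ^ h ≤ 4 * S ≤ 100000 * X ≤ 2 ^ 17 * (2 + X)` one gets `0.69 * h ≤ 18 * log (2 + X)`,
  -- and `18 / 0.69 < 27`.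
  have hh : (A.h : ℝ) ≤ 27 * Real.log (2 + X) := by
    have h1 : ((2 : ℝ) ^ A.h) ≤ 2 ^ 17 * (2 + X) := by
      have : ((2 ^ A.h : ℕ) : ℝ) ≤ ((4 * A.S : ℕ) : ℝ) := by exact_mod_cast hT.two_pow_le
      push_cast at this
      norm_num
      linarith
    have h2 := Real.log_le_log (by positivity) h1
    rw [Real.log_mul (by positivity) (by positivity), Real.log_pow, Real.log_pow] at h2
    push_cast at h2
    have h3 : 0.69 * (A.h : ℝ) ≤ A.h * Real.log 2 := by
      rw [mul_comm]
      exact mul_le_mul_of_nonneg_left hlog.le (Nat.cast_nonneg _)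
    linarith
  rw [← Real.rpow_natCast, pow_one]
  refine Real.rpow_le_rpow_of_exponent_le (by norm_num) ?_
  push_cast
  -- The constant is `5 * 25000 * 27 = 3375000`.
  have := mul_le_mul hS hh (Nat.cast_nonneg _) (by positivity)
  linarith

end

/-! ## Optimal centers -/

theorem centerCost_nonneg {d : ℕ} (c : Pt d) (O : Finset (Pt d)) : 0 ≤ centerCost c O :=
  Finset.sum_nonneg fun _ _ => dist_nonneg

theorem optCost_le {d : ℕ} (c : Pt d) (O : Finset (Pt d)) : optCost O ≤ centerCost c O :=
  ciInf_le ⟨0, by rintro _ ⟨c, rfl⟩; exact centerCost_nonneg c O⟩ c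

theorem exists_centerCost_le {d : ℕ} (O : Finset (Pt d)) :
    ∃ c : Pt d, centerCost c O ≤ optCost O := by
  rcases O.eq_empty_or_nonempty with rfl | ⟨x, hx⟩
  · exact ⟨0, le_ciInf fun c => by simp [centerCost]⟩
  -- The cost is continuous and at least the distance to one point of `O`, which tends to infinity;
  -- hence the minimum is attained.
  · have hcont : Continuous fun c : Pt d => centerCost c O := by
      unfold centerCost
      fun_prop
    obtain ⟨c, hc⟩ := hcont.exists_forall_le (Filter.tendsto_atTop_mono
      (fun c => Finset.single_le_sum (f := fun x => dist x c) (fun _ _ => dist_nonneg) hx)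
      (tendsto_dist_left_cocompact_atTop x))
    exact ⟨c, le_ciInf hc⟩

/-- The clusters of a partition with optimal centers. -/
theorem exists_clusters {d k : ℕ} (hk : 1 ≤ k) (O : Fin k → Finset (Pt d)) :
    ∃ K : Clusters (Pt d) k, K.O = O ∧ K.M = ⨆ i, optCost (O i) := by
  choose q hq using fun i => exists_centerCost_le (O i)
  have : Nonempty (Fin k) := ⟨⟨0, hk⟩⟩
  refine ⟨⟨O, q, ⨆ i, optCost (O i), Real.iSup_nonneg fun i => Real.iInf_nonneg fun c =>
    centerCost_nonneg c (O i), fun i => (hq i).trans (le_ciSup (f := fun i => optCost (O i))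
      (Set.finite_range _).bddAbove i), fun hM => ?_⟩, rfl, rfl⟩
  obtain ⟨i, hi⟩ := exists_lt_of_lt_ciSup hM
  refine ⟨i, ?_⟩
  by_contra hcon
  refine hi.not_ge ?_
  -- A cluster without two distinct points has optimal cost 0, with its only point as center.
  rcases (O i).eq_empty_or_nonempty with h | ⟨x, hx⟩
  · exact (optCost_le 0 _).trans (by simp [centerCost, h])
  · refine (optCost_le x _).trans (Finset.sum_nonpos fun y hy => ?_)
    by_contra hd
    exact hcon ⟨x, hx, y, hy, fun h => hd (by rw [h, dist_self])⟩

/-- The identity permutation suffices, because the `j`-th center is built for the `j`-th cluster. -/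
theorem minLoadCost_le {d k : ℕ} (hk : 1 ≤ k) {C : Fin k → Pt d} {O : Fin k → Finset (Pt d)}
    {a : ℝ} (h : ∀ j, ∑ x ∈ O j, dist x (C j) ≤ a) : minLoadCost C O ≤ a := by
  have : Nonempty (Fin k) := ⟨⟨0, hk⟩⟩
  exact (ciInf_le (Set.finite_range _).bddBelow (1 : Equiv.Perm (Fin k))).trans (ciSup_le h)

/-! ## Input and output -/

theorem readPt_inputState {n d : ℕ} (x : Fin n → Pt d) (k : ℕ) (ε : ℝ) (ω : ℕ → Bool) (i : Fin n) :
    readPt d ((inputState x k ε ω).real 1) (i * d) = x i := by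
  ext c
  have h : finProdFinEquiv (i, c) = (⟨i * d + c, by
      have h1 := Nat.mul_le_mul_right d i.2
      rw [Nat.succ_mul] at h1
      omega⟩ : Fin (n * d)) := Fin.ext (by
        change (c : ℕ) + d * i = i * d + c
        ring)
  have h' := h ▸ Equiv.symm_apply_apply finProdFinEquiv (i, c)
  have hlt := (finProdFinEquiv (i, c)).2
  rw [h] at hlt
  simp only [readPt, inputState, one_ne_zero, if_false, if_true, dif_pos hlt]
  rw [h']

theorem mem_outputList {k d : ℕ} {s : State} {C : Fin k → Pt d} :
    C ∈ outputList k d s ↔ ∃ l < s.nat 1 0, tuple d k s l = C := by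
  unfold outputList
  rw [List.mem_map]
  simp only [List.mem_range]
  rfl

end MinLoad

open MinLoad RealRAM

theorem mainTheorem3 :
    ∃ (prog : RealRAM.Prog) (A b c : ℕ),
      ∀ (d k : ℕ) (ε : ℝ) (P : Finset (MinLoad.Pt d)) (x : Fin P.card ≃ P),
        1 ≤ d → 1 ≤ k → 0 < ε → ε < 1 → P.Nonempty →
        -- whatever the coins show, the program halts in time, and its output is a short list
        -- of sets of exactly `k` centers
        (∀ ω : ℕ → Bool, ∃ (t : ℕ) (s : RealRAM.State),
          RealRAM.Exec prog (MinLoad.inputState (fun i => (x i : MinLoad.Pt d)) k ε ω) t s ∧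
          (t : ℝ) ≤ MinLoad.expTildeO A b c k ε * (P.card : ℝ) * (d : ℝ) ∧
          ((MinLoad.outputList k d s).length : ℝ) ≤ MinLoad.expTildeO A b c k ε ∧
          ∀ C ∈ MinLoad.outputList k d s, Function.Injective C) ∧
        -- for every partition, with probability at least one half, some set in the list is good
        ∀ O : Fin k → Finset (MinLoad.Pt d), MinLoad.IsPartition P O →
          1 / 2 ≤ RealRAM.coinLaw {ω : ℕ → Bool | ∃ (t : ℕ) (s : RealRAM.State),
            RealRAM.Exec prog (MinLoad.inputState (fun i => (x i : MinLoad.Pt d)) k ε ω) t s ∧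
            ∃ C ∈ MinLoad.outputList k d s,
              MinLoad.minLoadCost C O ≤ (1 + ε) * ⨆ i : Fin k, MinLoad.optCost (O i)} := by
  refine ⟨mainProg, 3375000, 1, 2, fun d k ε P x hd hk hε hε1 hP => ?_⟩
  let L := ⌈4 / (ε * ε)⌉₊
  let A : Params := ⟨P.card, d, k, 4000 * L, 5000 * k * L, Nat.clog 2 (2 * (5000 * k * L)), ε,
    hP.card_pos, hd⟩
  have hT : A.Tuned := ⟨hk, hε, hε1, rfl, rfl, rfl⟩
  set s₀ := inputState (fun i => (x i : Pt d)) k ε fun _ => true with hs₀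
  have hs : ∀ ω, inputState (fun i => (x i : Pt d)) k ε ω = s₀.withCoins ω := fun _ => rfl
  have hpt : ∀ i : Fin P.card, readPt d (s₀.real 1) (i * d) = x i :=
    readPt_inputState (fun i => (x i : Pt d)) k ε _
  refine ⟨fun ω => ?_, fun O hO => ?_⟩
  · obtain ⟨l, ω', hl, rfl⟩ := exists_eq_prependCoins A.totalCoins ω
    obtain ⟨s', hr, h1, h2⟩ := mainProg_all (A := A) (s := s₀) hT rfl rfl rfl rfl rfl rfl l hl
    obtain ⟨t, ht, he⟩ := hr ω'
    have hbound := hT.two_pow_le_expTildeO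
    refine ⟨t, s'.withCoins ω', he, ?_, ?_, ?_⟩
    · have h3 : (t : ℝ) ≤ ((2 ^ (5 * (A.S * A.h)) * (A.n * A.d) : ℕ) : ℝ) := by
        exact_mod_cast ht.trans hT.totalTime_le
      push_cast at h3
      rw [mul_assoc]
      exact h3.trans (mul_le_mul_of_nonneg_right hbound
        (mul_nonneg (Nat.cast_nonneg _) (Nat.cast_nonneg _)))
    · have h3 : (outputList k d (s'.withCoins ω')).length ≤ 2 ^ (5 * (A.S * A.h)) := by
        rw [outputList, List.length_map, List.length_range]
        refine h2.trans (Nat.pow_le_pow_right (by norm_num) ?_)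
        rw [mul_assoc]
        exact Nat.mul_le_mul_right _ (by norm_num)
      refine le_trans ?_ hbound
      exact_mod_cast h3
    · intro C hC
      obtain ⟨m, hm, rfl⟩ := mem_outputList.1 hC
      exact h1.inj m hm
  · obtain ⟨K, hKO, hKM⟩ := exists_clusters hk O
    have hluck := mainProg_luck (A := A) (s := s₀) (K := K) (P := P) hT rfl rfl rfl rfl rfl rfl
      (by rw [hKO]; exact hO.mem_iff) (by rw [hKO]; exact hO.disjoint) ?_ ?_
    · have h1 : (1 / 2 : ENNReal) = ENNReal.ofReal (1 / 2) := by
        rw [ENNReal.ofReal_div_of_pos (by norm_num)]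
        simp
      rw [h1]
      -- The favourable strings of length `totalCoins` decide the run whatever the later coins show.
      refine (ENNReal.ofReal_le_ofReal hluck).trans (bitProb_le_coinLaw fun l ω _ hl => ?_)
      obtain ⟨s', hr, m, hm, hφ⟩ := hl
      obtain ⟨t, -, he⟩ := hr ω
      refine ⟨t, s'.withCoins ω, he, tuple d k s' m, mem_outputList.2 ⟨m, hm, rfl⟩, ?_⟩
      rw [hKO, hKM] at hφ
      exact minLoadCost_le hk hφ
    · intro i hi j hj hij
      have hi' := Finset.mem_range.1 hi
      have hj' := Finset.mem_range.1 hj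
      have h := (hpt ⟨i, hi'⟩).symm.trans (hij.trans (hpt ⟨j, hj'⟩))
      exact congrArg Fin.val (x.injective (Subtype.ext h))
    · intro y
      constructor
      · intro hy
        obtain ⟨i, hi⟩ := x.surjective ⟨y, hy⟩
        exact ⟨i, i.2, by rw [hpt i, hi]⟩
      · rintro ⟨i, hi, rfl⟩
        exact (hpt ⟨i, hi⟩).symm ▸ (x ⟨i, hi⟩).2
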